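/- Let $\mathcal H\subset SL(2,\mathbb R)^2$ be the hyperbolicity locus of the full $2$-shift, i.e. the set of pairs $(A_0,A_1)$ such that the cocycle $(x,v)\mapsto(\sigma x,A_{x_0}v)$ over the shift $\sigma$ on $\{0,1\}^{\mathbb Z}$ is uniformly hyperbolic: $\{0,1\}^{\mathbb Z}\times\mathbb R^2$ splits as a continuous direct sum $E^s\oplus E^u$ of invariant line bundles, with $E^s$ uniformly exponentially contracted under forward iteration and $E^u$ under backward iteration. A multicone for $(A,B)$ is a non-empty open set $M\subset\mathbb P^1=\mathbb P(\mathbb R^2)$ with $\overline M\ne\mathbb P^1$, having finitely many connected components with pairwise disjoint closures, and such that $\overline{A(M)}\subset M$ and $\overline{B(M)}\subset M$. A connected component of $\mathcal H$ is called principal if every pair in it has a multicone consisting of a single open interval. A matrix $A\in SL(2,\mathbb R)$ is hyperbolic if $|\operatorname{tr}A|>2$ and parabolic if $|\operatorname{tr}A|=2$ (so $\pm\mathrm{id}$ are parabolic). For $A$ hyperbolic, $u_A$ and $s_A\in\mathbb P^1$ denote its eigendirections with eigenvalue of modulus $>1$ and $<1$ respectively; for $A\neq\pm\mathrm{id}$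 parabolic, $u_A=s_A$ denotes its unique invariant direction; for other $A$ they are undefined. Theorem. (a) Every compact subset of $SL(2,\mathbb R)^2$ intersects only finitely many connected components of $\mathcal H$. (b) The boundary $\partial\mathcal H$ in $SL(2,\mathbb R)^2$ is the disjoint union of the boundaries of the connected components of $\mathcal H$. (c) If $(A,B)\in\partial\mathcal H$, then at least one of the following holds: (i) some product of $A$'s and $B$'s (of positive length) is parabolic; (ii) $u_A$ and $s_B$ are defined and $u_A=s_B$, or $u_B$ and $s_A$ are defined and $u_B=s_A$. (d) If $(A,B)\in\partial\mathcal H$ satisfies (ii), then $(A,B)$ belongs to the boundary of a principal component of $\mathcal H$. -/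

import Mathlib

open Set Topology
open scoped LinearAlgebra.Projectivization Matrix MatrixGroups

namespace FullTwoShift

/-! ### The projective line -/

/-- The projective line `ℙ¹` of `ℝ²`. The group `SL(2, ℝ)` acts on it through Mathlib's action on
`Projectivization`, that is, `A • [v] = [A v]`. -/
abbrev P1 : Type := ℙ ℝ (Fin 2 → ℝ)

/-- `ℙ¹` carries the quotient topology of `ℝ² ∖ {0}`. -/
noncomputable instance instTopologicalSpaceP1 : TopologicalSpace P1 :=
  TopologicalSpace.coinduced (Projectivization.mk' ℝ) inferInstance

/-! ### Uniformly hyperbolic cocycles -/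

section Cocycle

variable {X : Type*} [TopologicalSpace X]

/-- The products `A^n(x) = A(f^{n-1} x) ⋯ A(f x) A(x)`, for `n ≥ 0`. -/
def cocycleIter (f : X ≃ₜ X) (A : X → SL(2, ℝ)) : ℕ → X → SL(2, ℝ)
  | 0, _ => 1
  | n + 1, x => A (f^[n] x) * cocycleIter f A n x

/-- The products `A^{-n}(x) = A(f^{-n} x)⁻¹ ⋯ A(f^{-1} x)⁻¹`, for `n ≥ 0`. -/
def cocycleIterNeg (f : X ≃ₜ X) (A : X → SL(2, ℝ)) (n : ℕ) (x : X) : SL(2, ℝ) :=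
  (cocycleIter f A n (f.symm^[n] x))⁻¹

/-- The cocycle `(x, v) ↦ (f x, A(x) v)` on `X × ℝ²` is uniformly hyperbolic: the bundle `X × ℝ²`
splits as a continuous direct sum `Eˢ ⊕ Eᵘ` of invariant line bundles, `Eˢ` being uniformly
contracted in the future and `Eᵘ` in the past. (Both bundles have rank one, since the matrices have
determinant one; the choice of the norm on `ℝ²` is absorbed by the constant `C`.) -/
def UniformlyHyperbolic (f : X ≃ₜ X) (A : X → SL(2, ℝ)) : Prop :=
  ∃ Es Eu : X → P1,
    Continuous Es ∧ Continuous Eu ∧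
    (∀ x, IsCompl (Es x).submodule (Eu x).submodule) ∧
    (∀ x, A x • Es x = Es (f x)) ∧
    (∀ x, A x • Eu x = Eu (f x)) ∧
    ∃ C r : ℝ, 0 < C ∧ 0 < r ∧ r < 1 ∧ ∀ (n : ℕ) (x : X),
      (∀ v ∈ (Es x).submodule,
        ‖(cocycleIter f A n x : Matrix (Fin 2) (Fin 2) ℝ) *ᵥ v‖ ≤ C * r ^ n * ‖v‖) ∧
      (∀ v ∈ (Eu x).submodule,
        ‖(cocycleIterNeg f A n x : Matrix (Fin 2) (Fin 2) ℝ) *ᵥ v‖ ≤ C * r ^ n * ‖v‖)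

end Cocycle

/-! ### The full 2-shift and its hyperbolicity locus -/

/-- The shift `(x_i) ↦ (x_{i+1})` on the full shift `2^ℤ` (with the product topology). -/
def shift : (ℤ → Fin 2) ≃ₜ (ℤ → Fin 2) where
  toFun x i := x (i + 1)
  invFun x i := x (i - 1)
  left_inv x := by funext i; simp
  right_inv x := by funext i; simp
  continuous_toFun := by fun_prop
  continuous_invFun := by fun_prop

/-- The matrix attached to a letter by the pair `p = (A, B)`: `0 ↦ A`, `1 ↦ B`. -/
def letter (p : SL(2, ℝ) × SL(2, ℝ)) : Fin 2 → SL(2, ℝ) := ![p.1, p.2]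

/-- The hyperbolicity locus `ℋ ⊆ SL(2, ℝ)²` of the full 2-shift. -/
def hypLocus : Set (SL(2, ℝ) × SL(2, ℝ)) :=
  {p | UniformlyHyperbolic shift fun x => letter p (x 0)}

/-- The set of connected components of a subset `S` of a topological space. -/
def componentsOf {X : Type*} [TopologicalSpace X] (S : Set X) : Set (Set X) :=
  {C | ∃ x ∈ S, C = connectedComponentIn S x}

/-! ### Multicones and principal components -/

/-- `M ⊆ ℙ¹` is a multicone for the pair `p`: it is non-empty, open, not dense, has finitely many
components, with pairwise disjoint closures, and is mapped by each of the two matrices into a set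
whose closure is contained in `M`. -/
structure IsMulticone (p : SL(2, ℝ) × SL(2, ℝ)) (M : Set P1) : Prop where
  nonempty : M.Nonempty
  isOpen : IsOpen M
  closure_ne_univ : closure M ≠ univ
  closure_image_subset : ∀ i : Fin 2, closure ((fun x : P1 => letter p i • x) '' M) ⊆ interior M
  finite_components : (componentsOf M).Finite
  disjoint_closures : (componentsOf M).PairwiseDisjoint closure

/-- An open interval of `ℙ¹`: non-empty, open, connected, with more than one point in the
complement. -/
def IsOpenInterval (I : Set P1) : Prop :=
  IsOpen I ∧ IsConnected I ∧ Iᶜ.Nontrivial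

/-- A principal component of `ℋ`: a connected component each of whose elements has a multicone
consisting of a single interval. -/
def IsPrincipalComponent (C : Set (SL(2, ℝ) × SL(2, ℝ))) : Prop :=
  C ∈ componentsOf hypLocus ∧ ∀ p ∈ C, ∃ M, IsMulticone p M ∧ IsOpenInterval M

/-! ### Types of matrices, stable and unstable directions -/

/-- `|tr A| > 2`. -/
def Hyperbolic (A : SL(2, ℝ)) : Prop := 2 < |(A : Matrix (Fin 2) (Fin 2) ℝ).trace|

/-- `|tr A| = 2`; in particular `± id` are parabolic. -/
def Parabolic (A : SL(2, ℝ)) : Prop := |(A : Matrix (Fin 2) (Fin 2) ℝ).trace| = 2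

/-- `d = u_A`: the eigendirection of a hyperbolic `A` whose eigenvalue has modulus larger than one,
or the unique invariant direction of a parabolic `A ≠ ± id`. No direction is `u_A` if `A` is
elliptic or `A = ± id`. -/
def IsUnstableDir (A : SL(2, ℝ)) (d : P1) : Prop :=
  (Hyperbolic A ∧ ∃ c : ℝ, 1 < |c| ∧
    ∀ v ∈ d.submodule, (A : Matrix (Fin 2) (Fin 2) ℝ) *ᵥ v = c • v) ∨
  (Parabolic A ∧ A ≠ 1 ∧ A ≠ -1 ∧ A • d = d)

/-- `d = s_A`: the eigendirection of a hyperbolic `A` whose eigenvalue has modulus less than one,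
or the unique invariant direction of a parabolic `A ≠ ± id`. No direction is `s_A` if `A` is
elliptic or `A = ± id`. -/
def IsStableDir (A : SL(2, ℝ)) (d : P1) : Prop :=
  (Hyperbolic A ∧ ∃ c : ℝ, |c| < 1 ∧
    ∀ v ∈ d.submodule, (A : Matrix (Fin 2) (Fin 2) ℝ) *ᵥ v = c • v) ∨
  (Parabolic A ∧ A ≠ 1 ∧ A ≠ -1 ∧ A • d = d)

/-- `u_A` and `s_B` are defined and `u_A = s_B`. -/
def UnstableEqStable (A B : SL(2, ℝ)) : Prop :=
  ∃ d : P1, IsUnstableDir A d ∧ IsStableDir B d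

/-- Some (non-empty) product of `A`'s and `B`'s is parabolic, where `p = (A, B)`. -/
def HasParabolicProduct (p : SL(2, ℝ) × SL(2, ℝ)) : Prop :=
  ∃ w : List (Fin 2), w ≠ [] ∧ Parabolic (w.map (letter p)).prod

end FullTwoShift

/-!
Pairs are studied through the traces `x = tr A`, `y = tr B`, `z = tr AB` and the commutator trace
`κ = x² + y² + z² - xyz - 2`. Up to signs, `x, y > 2` on the hyperbolicity locus. If `κ < 2`, or if
`xy < 2z`, the pair is conjugate to one with positive entries, so an open quadrant is an interval
multicone: this is the principal component. If `κ = 2` and `2z < xy`, then `u_A = s_B` or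
`u_B = s_A`, and the pair is not uniformly hyperbolic. If `κ > 2` and `2z < xy`, replacing `(A, B)`
by `(A, AB)` or `(AB, B)` lowers the traces by a definite amount as long as `z > 2`, so after
finitely many steps either `|z| ≤ 2`, which a uniformly hyperbolic pair excludes, or `z < -2`. In
the latter case `A` and `B` are, up to sign, products of reflections in three pairwise
ultraparallel lines of the hyperbolic plane. The norm of a word in such reflections grows
exponentially with its reduced length, which gives uniform hyperbolicity.

The components are therefore indexed by signs, reduction words and orientations of Schottky pairs.
A long reduction word forces large traces, so the components form a locally finite family, and
weakening the defining inequalities shows that their closures are pairwise disjoint. On the boundary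
of a component one of the inequalities becomes an equality: a trace equal to `±2` gives a parabolic
product, and `κ = 2` gives `u_A = s_B` or `u_B = s_A`, which is possible only for principal
components.
-/

namespace FullTwoShift

open Filter
open scoped Matrix.Norms.Frobenius

/-! ### The Frobenius norm on `SL(2, ℝ)` -/

/-- Real `2 × 2` matrices; their norm is throughout the Frobenius norm. -/
abbrev Mat2 : Type := Matrix (Fin 2) (Fin 2) ℝ

lemma norm_apply_le_frobenius_norm {m n E : Type*} [Fintype m] [Fintype n]
    [SeminormedAddCommGroup E] (M : Matrix m n E) (i : m) (j : n) : ‖M i j‖ ≤ ‖M‖ := by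
  have h := Matrix.frobenius_norm_def M
  rw [← Real.sqrt_eq_rpow] at h
  rw [h, ← Real.sqrt_sq (norm_nonneg (M i j))]
  refine Real.sqrt_le_sqrt ?_
  simp only [Real.rpow_two]
  calc ‖M i j‖ ^ 2 ≤ ∑ j, ‖M i j‖ ^ 2 :=
        Finset.single_le_sum (f := fun j => ‖M i j‖ ^ 2) (fun _ _ => sq_nonneg _)
          (Finset.mem_univ j)
    _ ≤ ∑ i, ∑ j, ‖M i j‖ ^ 2 :=
        Finset.single_le_sum (f := fun i => ∑ j, ‖M i j‖ ^ 2)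
          (fun _ _ => Finset.sum_nonneg fun _ _ => sq_nonneg _) (Finset.mem_univ i)

lemma norm_mulVec_le {m n R : Type*} [Fintype m] [Fintype n] [SeminormedRing R] (M : Matrix m n R)
    (v : n → R) : ‖M *ᵥ v‖ ≤ Fintype.card n * ‖M‖ * ‖v‖ := by
  refine (pi_norm_le_iff_of_nonneg (by positivity)).2 fun i => ?_
  calc ‖∑ j, M i j * v j‖ ≤ ∑ j, ‖M i j * v j‖ := norm_sum_le _ _
    _ ≤ ∑ _j : n, ‖M‖ * ‖v‖ := Finset.sum_le_sum fun j _ => (norm_mul_le _ _).trans <| by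
        gcongr
        exacts [norm_apply_le_frobenius_norm M i j, norm_le_pi_norm v j]
    _ = Fintype.card n * ‖M‖ * ‖v‖ := by
        rw [Finset.sum_const, Finset.card_univ, nsmul_eq_mul, mul_assoc]

lemma sq_norm_eq (M : Mat2) : ‖M‖ ^ 2 = M 0 0 ^ 2 + M 0 1 ^ 2 + M 1 0 ^ 2 + M 1 1 ^ 2 := by
  rw [Matrix.frobenius_norm_def, ← Real.sqrt_eq_rpow, Real.sq_sqrt (by positivity)]
  simp only [Fin.sum_univ_two, Real.rpow_two, Real.norm_eq_abs, sq_abs, add_assoc]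

lemma det_eq_one (A : SL(2, ℝ)) : A.1 0 0 * A.1 1 1 - A.1 0 1 * A.1 1 0 = 1 := by
  rw [← Matrix.det_fin_two, A.det_coe]

lemma coe_inv_eq (A : SL(2, ℝ)) : (A⁻¹).1 = !![A.1 1 1, -A.1 0 1; -A.1 1 0, A.1 0 0] := by
  rw [Matrix.SpecialLinearGroup.coe_inv, Matrix.adjugate_fin_two]

lemma norm_coe_inv (A : SL(2, ℝ)) : ‖(A⁻¹).1‖ = ‖A.1‖ := by
  rw [← sq_eq_sq₀ (norm_nonneg _) (norm_nonneg _), sq_norm_eq, sq_norm_eq, coe_inv_eq]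
  simp only [Matrix.of_apply, Matrix.cons_val', Matrix.cons_val_zero, Matrix.cons_val_one,
    Matrix.cons_val_fin_one]
  ring

lemma one_le_norm_coe (A : SL(2, ℝ)) : 1 ≤ ‖A.1‖ := by
  refine (one_le_sq_iff₀ (norm_nonneg _)).1 ?_
  rw [sq_norm_eq]
  nlinarith [det_eq_one A, sq_nonneg (A.1 0 0 - A.1 1 1), sq_nonneg (A.1 0 1 + A.1 1 0)]

lemma norm_coe_pos (A : SL(2, ℝ)) : 0 < ‖A.1‖ := zero_lt_one.trans_le (one_le_norm_coe A)

section SpecialLinearGroup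

variable {n R : Type*} [Fintype n] [DecidableEq n] [CommRing R]

lemma coe_mul_coe_inv (A : Matrix.SpecialLinearGroup n R) : A.1 * (A⁻¹).1 = 1 := by
  rw [← Matrix.SpecialLinearGroup.coe_mul, mul_inv_cancel, Matrix.SpecialLinearGroup.coe_one]

lemma coe_inv_mul_coe (A : Matrix.SpecialLinearGroup n R) : (A⁻¹).1 * A.1 = 1 := by
  rw [← Matrix.SpecialLinearGroup.coe_mul, inv_mul_cancel, Matrix.SpecialLinearGroup.coe_one]

lemma coe_mul_mulVec (A B : Matrix.SpecialLinearGroup n R) (v : n → R) :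
    (A * B).1 *ᵥ v = A.1 *ᵥ (B.1 *ᵥ v) := by
  rw [Matrix.SpecialLinearGroup.coe_mul, Matrix.mulVec_mulVec]

end SpecialLinearGroup

/-! ### Points of the projective line -/

section Projectivization

variable {K V : Type*} [Field K] [AddCommGroup V] [Module K V]

lemma mem_submodule_mk {v w : V} (hv : v ≠ 0) :
    w ∈ (Projectivization.mk K v hv).submodule ↔ ∃ c : K, c • v = w := by
  rw [Projectivization.submodule_mk, Submodule.mem_span_singleton]

lemma mk_eq_of_mem {d : ℙ K V} {v : V} (hv : v ≠ 0) (h : v ∈ d.submodule) :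
    Projectivization.mk K v hv = d := by
  induction d using Projectivization.ind with
  | h w hw => exact (Projectivization.mk_eq_mk_iff' K v w hv hw).2 ((mem_submodule_mk hw).1 h)

lemma rep_mem_submodule (d : ℙ K V) : d.rep ∈ d.submodule := by
  rw [d.submodule_eq]
  exact Submodule.mem_span_singleton_self _

lemma isCompl_submodule_of_ne (hV : Module.finrank K V = 2) {d e : ℙ K V} (h : d ≠ e) :
    IsCompl d.submodule e.submodule := by
  have : FiniteDimensional K V := Module.finite_of_finrank_pos (by omega)
  have hdisj : Disjoint d.submodule e.submodule := by
    refine Submodule.disjoint_def.2 fun v hd he => ?_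
    by_contra hv
    exact h ((mk_eq_of_mem hv hd).symm.trans (mk_eq_of_mem hv he))
  refine ⟨hdisj, codisjoint_iff.2 (Submodule.eq_top_of_finrank_eq ?_)⟩
  have hsum := Submodule.finrank_sup_add_finrank_inf_eq d.submodule e.submodule
  rwa [hdisj.eq_bot, finrank_bot, Projectivization.finrank_submodule,
    Projectivization.finrank_submodule, add_zero, one_add_one_eq_two, ← hV] at hsum

lemma mulVec_ne_zero {n : Type*} [Fintype n] [DecidableEq n] (A : Matrix.SpecialLinearGroup n K)
    {v : n → K} (hv : v ≠ 0) : A.1 *ᵥ v ≠ 0 :=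
  (smul_ne_zero_iff_ne A).2 hv

lemma smul_mk_eq {n : Type*} [Fintype n] [DecidableEq n] (A : Matrix.SpecialLinearGroup n K)
    {v : n → K} (hv : v ≠ 0) :
    A • Projectivization.mk K v hv = Projectivization.mk K (A.1 *ᵥ v) (mulVec_ne_zero A hv) :=
  rfl

lemma mulVec_mem_smul {n : Type*} [Fintype n] [DecidableEq n] (A : Matrix.SpecialLinearGroup n K)
    {d : ℙ K (n → K)} {v : n → K} (h : v ∈ d.submodule) : A.1 *ᵥ v ∈ (A • d).submodule := by
  rw [PSL.smul_submodule]
  exact Submodule.smul_mem_pointwise_smul v A _ h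

lemma smul_eq_self_of_mulVec_eq_smul {n : Type*} [Fintype n] [DecidableEq n]
    {A : Matrix.SpecialLinearGroup n K} {d : ℙ K (n → K)} {v : n → K} (hv : v ∈ d.submodule)
    (hv0 : v ≠ 0) {c : K} (h : A.1 *ᵥ v = c • v) : A • d = d :=
  (mk_eq_of_mem (mulVec_ne_zero A hv0) (mulVec_mem_smul A hv)).symm.trans
    (mk_eq_of_mem _ (h ▸ d.submodule.smul_mem c hv))

end Projectivization

lemma continuous_mk' : Continuous (Projectivization.mk' ℝ : {v : Fin 2 → ℝ // v ≠ 0} → P1) :=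
  continuous_coinduced_rng

lemma continuousAt_of_section {X : Type*} [TopologicalSpace X] {E : X → P1} {w : X → Fin 2 → ℝ}
    {x : X} (hw : ContinuousAt w x) (h0 : w x ≠ 0) (h : ∀ y, w y ∈ (E y).submodule) :
    ContinuousAt E x := by
  classical
  have hev : ∀ᶠ y in 𝓝 x, w y ≠ 0 := hw.eventually_ne h0
  let w' : X → {v : Fin 2 → ℝ // v ≠ 0} := fun y => if hy : w y ≠ 0 then ⟨w y, hy⟩ else ⟨w x, h0⟩
  have hw' : ContinuousAt w' x := by
    refine IsInducing.subtypeVal.continuousAt_iff.2 (hw.congr ?_)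
    filter_upwards [hev] with y hy
    simp only [w', dif_pos hy, Function.comp_apply]
  refine (continuous_mk'.continuousAt.comp hw').congr ?_
  filter_upwards [hev] with y hy
  simp only [w', dif_pos hy, Function.comp_apply]
  exact mk_eq_of_mem hy (h y)

/-! ### Most expanded directions of a sequence of products -/

/-- The matrix `MᵀM`, normalized to have trace one. When `M` is large, it is close to the orthogonal
projection onto the direction that `M` expands most. -/
noncomputable def expProj (M : SL(2, ℝ)) : Mat2 := (‖M.1‖ ^ 2)⁻¹ • (M.1ᵀ * M.1)

lemma trace_expProj (M : SL(2, ℝ)) : (expProj M).trace = 1 := by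
  have h : ‖M.1‖ ^ 2 ≠ 0 := (pow_pos (norm_coe_pos M) 2).ne'
  simp only [expProj, Matrix.trace_smul, Matrix.trace_fin_two, Matrix.mul_apply, Fin.sum_univ_two,
    Matrix.transpose_apply, smul_eq_mul]
  rw [inv_mul_eq_one₀ h, sq_norm_eq]
  ring

lemma one_sub_expProj (M : SL(2, ℝ)) :
    1 - expProj M = (‖M.1‖ ^ 2)⁻¹ • ((M⁻¹).1 * (M⁻¹).1ᵀ) := by
  have h : ‖M.1‖ ^ 2 ≠ 0 := (pow_pos (norm_coe_pos M) 2).ne'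
  rw [sub_eq_iff_eq_add, expProj, ← smul_add, eq_inv_smul_iff₀ h, sq_norm_eq, coe_inv_eq]
  ext i j
  fin_cases i <;> fin_cases j <;>
    simp [Matrix.mul_apply, Fin.sum_univ_two, Matrix.vecMul, dotProduct] <;> ring

lemma expProj_mul_one_sub_expProj (M N : SL(2, ℝ)) :
    expProj M * (1 - expProj N) = ((‖M.1‖ ^ 2)⁻¹ * (‖N.1‖ ^ 2)⁻¹) •
      (M.1ᵀ * ((M * N⁻¹).1 * (N⁻¹).1ᵀ)) := by
  rw [one_sub_expProj, expProj, smul_mul_smul_comm, Matrix.SpecialLinearGroup.coe_mul]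
  simp only [mul_assoc]

lemma one_sub_expProj_mul_expProj (M N : SL(2, ℝ)) :
    (1 - expProj M) * expProj N = ((‖M.1‖ ^ 2)⁻¹ * (‖N.1‖ ^ 2)⁻¹) •
      ((M⁻¹).1 * ((N * M⁻¹).1ᵀ * N.1)) := by
  rw [one_sub_expProj, expProj, smul_mul_smul_comm, Matrix.SpecialLinearGroup.coe_mul,
    Matrix.transpose_mul]
  simp only [mul_assoc]

lemma coe_mul_one_sub_expProj (M : SL(2, ℝ)) :
    M.1 * (1 - expProj M) = (‖M.1‖ ^ 2)⁻¹ • (M⁻¹).1ᵀ := by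
  rw [one_sub_expProj, Matrix.mul_smul, ← mul_assoc, coe_mul_coe_inv, one_mul]

lemma norm_expProj_sub_le (M N : SL(2, ℝ)) :
    ‖expProj M - expProj N‖ ≤ 2 * ‖(N * M⁻¹).1‖ / (‖M.1‖ * ‖N.1‖) := by
  have hM := norm_coe_pos M
  have hN := norm_coe_pos N
  have hinv : ‖(M * N⁻¹).1‖ = ‖(N * M⁻¹).1‖ := by rw [← norm_coe_inv, mul_inv_rev, inv_inv]
  have h1 : ‖M.1ᵀ * ((M * N⁻¹).1 * (N⁻¹).1ᵀ)‖ ≤ ‖M.1‖ * (‖(N * M⁻¹).1‖ * ‖N.1‖) :=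
    calc _ ≤ ‖M.1ᵀ‖ * (‖(M * N⁻¹).1‖ * ‖(N⁻¹).1ᵀ‖) :=
          norm_mul_le_of_le le_rfl (norm_mul_le _ _)
      _ = _ := by rw [hinv, Matrix.frobenius_norm_transpose, Matrix.frobenius_norm_transpose,
          norm_coe_inv]
  have h2 : ‖(M⁻¹).1 * ((N * M⁻¹).1ᵀ * N.1)‖ ≤ ‖M.1‖ * (‖(N * M⁻¹).1‖ * ‖N.1‖) :=
    calc _ ≤ ‖(M⁻¹).1‖ * (‖(N * M⁻¹).1ᵀ‖ * ‖N.1‖) :=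
          norm_mul_le_of_le le_rfl (norm_mul_le _ _)
      _ = _ := by rw [Matrix.frobenius_norm_transpose, norm_coe_inv]
  have hs : 0 ≤ (‖M.1‖ ^ 2)⁻¹ * (‖N.1‖ ^ 2)⁻¹ := by positivity
  calc ‖expProj M - expProj N‖
      = ‖expProj M * (1 - expProj N) - (1 - expProj M) * expProj N‖ := by congr 1; noncomm_ring
    _ ≤ ‖expProj M * (1 - expProj N)‖ + ‖(1 - expProj M) * expProj N‖ := norm_sub_le _ _
    _ ≤ (‖M.1‖ ^ 2)⁻¹ * (‖N.1‖ ^ 2)⁻¹ * (‖M.1‖ * (‖(N * M⁻¹).1‖ * ‖N.1‖)) +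
        (‖M.1‖ ^ 2)⁻¹ * (‖N.1‖ ^ 2)⁻¹ * (‖M.1‖ * (‖(N * M⁻¹).1‖ * ‖N.1‖)) := by
        rw [expProj_mul_one_sub_expProj, one_sub_expProj_mul_expProj, norm_smul, norm_smul,
          Real.norm_of_nonneg hs]
        gcongr
    _ = 2 * ‖(N * M⁻¹).1‖ / (‖M.1‖ * ‖N.1‖) := by
        field_simp
        ring

lemma continuous_expProj : Continuous expProj := by
  have h : ∀ M : SL(2, ℝ), ‖M.1‖ ^ 2 ≠ 0 := fun M => (pow_pos (norm_coe_pos M) 2).ne'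
  unfold expProj
  fun_prop (disch := exact h)

lemma exists_ge_forall_mul_pow_le {b : ℕ → ℝ} {c l ν : ℝ} (hc : 0 < c) (hν : 1 < ν) (hl : ν < l)
    (hb : ∀ n, c * l ^ n ≤ b n) (N : ℕ) : ∃ n, N ≤ n ∧ ∀ k, b n * ν ^ k ≤ b (n + k) := by
  have hν0 : 0 < ν := by linarith
  have hratio : Tendsto (fun n : ℕ => b n / ν ^ n) atTop atTop := by
    refine tendsto_atTop_mono (fun n => ?_)
      ((tendsto_pow_atTop_atTop_of_one_lt ((one_lt_div hν0).2 hl)).const_mul_atTop hc)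
    rw [div_pow, ← mul_div_assoc]
    exact div_le_div_of_nonneg_right (hb n) (pow_pos hν0 n).le
  have htail : Tendsto (fun k => b (N + k) / ν ^ (N + k)) cofinite atTop := by
    rw [Nat.cofinite_eq_atTop]
    exact hratio.comp (tendsto_atTop_mono (fun k => Nat.le_add_left k N) tendsto_id)
  obtain ⟨m, hm⟩ := htail.exists_forall_le
  refine ⟨N + m, Nat.le_add_right _ _, fun k => ?_⟩
  have h := hm (m + k)
  rw [div_le_div_iff₀ (pow_pos hν0 _) (pow_pos hν0 _), ← add_assoc, pow_add ν (N + m) k] at h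
  exact le_of_mul_le_mul_right (by linarith) (pow_pos hν0 (N + m))

/-- `M` is a sequence of matrices whose norms grow at least at the exponential rate `l`, and whose
successive quotients are bounded by `L`. -/
structure IsExpGrowing (M : ℕ → SL(2, ℝ)) (c l L : ℝ) : Prop where
  pos : 0 < c
  one_lt : 1 < l
  le_norm : ∀ n, c * l ^ n ≤ ‖(M n).1‖
  norm_mul_inv_le : ∀ n, ‖(M (n + 1) * (M n)⁻¹).1‖ ≤ L

namespace IsExpGrowing

variable {M : ℕ → SL(2, ℝ)} {c l L : ℝ} {Q : Mat2}

lemma inv_sq_lt_one (hM : IsExpGrowing M c l L) : (l ^ 2)⁻¹ < 1 :=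
  inv_lt_one_of_one_lt₀ (one_lt_pow₀ hM.one_lt two_ne_zero)

lemma tendsto_norm (hM : IsExpGrowing M c l L) : Tendsto (fun n => ‖(M n).1‖) atTop atTop :=
  tendsto_atTop_mono hM.le_norm
    ((tendsto_pow_atTop_atTop_of_one_lt hM.one_lt).const_mul_atTop hM.pos)

lemma dist_expProj_le (hM : IsExpGrowing M c l L) (n : ℕ) :
    dist (expProj (M n)) (expProj (M (n + 1))) ≤ 2 * L / c ^ 2 * ((l ^ 2)⁻¹) ^ n := by
  have hc := hM.pos
  have hl0 : 0 < l := zero_lt_one.trans hM.one_lt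
  have hL : 0 ≤ L := (norm_nonneg _).trans (hM.norm_mul_inv_le 0)
  have hprod : c ^ 2 * (l ^ 2) ^ n ≤ ‖(M n).1‖ * ‖(M (n + 1)).1‖ :=
    calc c ^ 2 * (l ^ 2) ^ n ≤ c ^ 2 * (l ^ 2) ^ n * l :=
          le_mul_of_one_le_right (by positivity) hM.one_lt.le
      _ = c * l ^ n * (c * l ^ (n + 1)) := by ring
      _ ≤ ‖(M n).1‖ * ‖(M (n + 1)).1‖ :=
          mul_le_mul (hM.le_norm n) (hM.le_norm (n + 1)) (by positivity) (norm_nonneg _)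
  calc dist (expProj (M n)) (expProj (M (n + 1)))
      ≤ 2 * ‖(M (n + 1) * (M n)⁻¹).1‖ / (‖(M n).1‖ * ‖(M (n + 1)).1‖) :=
        (dist_eq_norm _ _).trans_le (norm_expProj_sub_le _ _)
    _ ≤ 2 * L / (c ^ 2 * (l ^ 2) ^ n) := by
        gcongr
        exact hM.norm_mul_inv_le n
    _ = 2 * L / c ^ 2 * ((l ^ 2)⁻¹) ^ n := by rw [inv_pow]; field_simp

lemma exists_tendsto_expProj (hM : IsExpGrowing M c l L) :
    ∃ Q : Mat2, Tendsto (fun n => expProj (M n)) atTop (𝓝 Q) :=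
  cauchySeq_tendsto_of_complete
    (cauchySeq_of_le_geometric _ _ hM.inv_sq_lt_one hM.dist_expProj_le)

lemma dist_lim_le (hM : IsExpGrowing M c l L)
    (hQ : Tendsto (fun n => expProj (M n)) atTop (𝓝 Q)) (n : ℕ) :
    dist (expProj (M n)) Q ≤ 2 * L / c ^ 2 * ((l ^ 2)⁻¹) ^ n / (1 - (l ^ 2)⁻¹) :=
  dist_le_of_le_geometric_of_tendsto _ _ hM.inv_sq_lt_one hM.dist_expProj_le hQ n

lemma lim_mul_one_sub (hM : IsExpGrowing M c l L)
    (hQ : Tendsto (fun n => expProj (M n)) atTop (𝓝 Q)) : Q * (1 - Q) = 0 := by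
  have hscale : Tendsto (fun n => (‖(M n).1‖ ^ 2)⁻¹) atTop (𝓝 0) :=
    ((tendsto_pow_atTop two_ne_zero).comp hM.tendsto_norm).inv_tendsto_atTop
  have hself : ∀ A : SL(2, ℝ), expProj A * (1 - expProj A) =
      ((‖A.1‖ ^ 2)⁻¹ * (‖A.1‖ ^ 2)⁻¹) • (1 : Mat2) := fun A => by
    rw [expProj_mul_one_sub_expProj, mul_inv_cancel, Matrix.SpecialLinearGroup.coe_one, one_mul,
      ← Matrix.transpose_mul, coe_inv_mul_coe, Matrix.transpose_one]
  refine tendsto_nhds_unique (hQ.mul (hQ.const_sub 1)) ?_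
  simpa only [hself, mul_zero, zero_smul] using (hscale.mul hscale).smul_const (1 : Mat2)

lemma exists_norm_coe_mul_one_sub_lim_le (hM : IsExpGrowing M c l L)
    (hQ : Tendsto (fun n => expProj (M n)) atTop (𝓝 Q)) :
    ∃ C, ∀ N, ∃ n, N ≤ n ∧ ‖(M n).1 * (1 - Q)‖ ≤ C / ‖(M n).1‖ := by
  obtain ⟨ν, hν, hνl⟩ := exists_between hM.one_lt
  refine ⟨1 + 2 * L / (1 - (ν ^ 2)⁻¹), fun N => ?_⟩
  obtain ⟨n, hn, hlate⟩ := exists_ge_forall_mul_pow_le hM.pos hν hνl hM.le_norm N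
  have hpos := norm_coe_pos (M n)
  -- Restarting the sequence at the late time `n` improves the constant `c` to `‖M n‖`.
  have htail : IsExpGrowing (fun k => M (n + k)) ‖(M n).1‖ ν L :=
    ⟨hpos, hν, hlate, fun k => hM.norm_mul_inv_le (n + k)⟩
  have hQ' : Tendsto (fun k => expProj (M (n + k))) atTop (𝓝 Q) :=
    hQ.comp (tendsto_atTop_mono (fun k => Nat.le_add_left k n) tendsto_id)
  have hdist : ‖expProj (M n) - Q‖ ≤ 2 * L / ‖(M n).1‖ ^ 2 / (1 - (ν ^ 2)⁻¹) := by
    have h := htail.dist_lim_le hQ' 0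
    rwa [dist_eq_norm, pow_zero, mul_one] at h
  have : 1 - (ν ^ 2)⁻¹ ≠ 0 := (sub_pos.2 htail.inv_sq_lt_one).ne'
  refine ⟨n, hn, ?_⟩
  calc ‖(M n).1 * (1 - Q)‖
      = ‖(M n).1 * (1 - expProj (M n)) + (M n).1 * (expProj (M n) - Q)‖ := by
        congr 1; noncomm_ring
    _ ≤ (‖(M n).1‖ ^ 2)⁻¹ * ‖(M n).1‖ +
        ‖(M n).1‖ * (2 * L / ‖(M n).1‖ ^ 2 / (1 - (ν ^ 2)⁻¹)) := by
        refine norm_add_le_of_le ?_ (norm_mul_le_of_le le_rfl hdist)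
        rw [coe_mul_one_sub_expProj, norm_smul, Matrix.frobenius_norm_transpose, norm_coe_inv,
          Real.norm_of_nonneg (by positivity)]
    _ = (1 + 2 * L / (1 - (ν ^ 2)⁻¹)) / ‖(M n).1‖ := by field_simp

lemma exists_norm_coe_mul_one_sub_lim_lt (hM : IsExpGrowing M c l L)
    (hQ : Tendsto (fun n => expProj (M n)) atTop (𝓝 Q)) {ε : ℝ} (hε : 0 < ε) (N : ℕ) :
    ∃ n, N ≤ n ∧ ‖(M n).1 * (1 - Q)‖ < ε := by
  obtain ⟨C, hC⟩ := hM.exists_norm_coe_mul_one_sub_lim_le hQ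
  obtain ⟨N', hN'⟩ :=
    ((hM.tendsto_norm.const_div_atTop C).eventually_lt_const hε).exists_forall_of_atTop
  obtain ⟨n, hn, h⟩ := hC (max N N')
  exact ⟨n, le_of_max_le_left hn, h.trans_lt (hN' n (le_of_max_le_right hn))⟩

lemma tendsto_norm_mulVec (hM : IsExpGrowing M c l L)
    (hQ : Tendsto (fun n => expProj (M n)) atTop (𝓝 Q)) {v : Fin 2 → ℝ} (hv : Q *ᵥ v ≠ 0) :
    Tendsto (fun n => ‖(M n).1 *ᵥ v‖) atTop atTop := by
  have hproj : Tendsto (fun n => ‖expProj (M n) *ᵥ v‖) atTop (𝓝 ‖Q *ᵥ v‖) :=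
    ((continuous_id.matrix_mulVec continuous_const).tendsto Q |>.comp hQ).norm
  refine tendsto_atTop_mono (fun n => ?_)
    ((hM.tendsto_norm.atTop_mul_pos (norm_pos_iff.2 hv) hproj).const_mul_atTop one_half_pos)
  have hpos := norm_coe_pos (M n)
  have hle : ‖expProj (M n) *ᵥ v‖ ≤ (‖(M n).1‖ ^ 2)⁻¹ * (2 * ‖(M n).1‖ * ‖(M n).1 *ᵥ v‖) := by
    rw [expProj, Matrix.smul_mulVec, ← Matrix.mulVec_mulVec, norm_smul,
      Real.norm_of_nonneg (by positivity)]
    gcongr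
    simpa [Matrix.frobenius_norm_transpose] using norm_mulVec_le (M n).1ᵀ ((M n).1 *ᵥ v)
  calc 1 / 2 * (‖(M n).1‖ * ‖expProj (M n) *ᵥ v‖)
      ≤ 1 / 2 * (‖(M n).1‖ * ((‖(M n).1‖ ^ 2)⁻¹ * (2 * ‖(M n).1‖ * ‖(M n).1 *ᵥ v‖))) := by gcongr
    _ = ‖(M n).1 *ᵥ v‖ := by field_simp

end IsExpGrowing

/-! ### Uniform exponential growth implies uniform hyperbolicity -/

section Cocycle

variable {X : Type*} [TopologicalSpace X] (f : X ≃ₜ X) (A : X → SL(2, ℝ))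

lemma cocycleIter_zero (x : X) : cocycleIter f A 0 x = 1 := rfl

lemma cocycleIter_succ (n : ℕ) (x : X) :
    cocycleIter f A (n + 1) x = A (f^[n] x) * cocycleIter f A n x := rfl

lemma cocycleIter_one (x : X) : cocycleIter f A 1 x = A x := mul_one _

lemma cocycleIter_add (m n : ℕ) (x : X) :
    cocycleIter f A (m + n) x = cocycleIter f A m (f^[n] x) * cocycleIter f A n x := by
  induction m with
  | zero => rw [zero_add, cocycleIter_zero, one_mul]
  | succ m ih =>
    rw [Nat.succ_add, cocycleIter_succ, ih, cocycleIter_succ, mul_assoc,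
      ← Function.iterate_add_apply]

lemma cocycleIterNeg_add_one (n : ℕ) (x : X) :
    cocycleIterNeg f A (n + 1) x = (A (f.symm (f.symm^[n] x)))⁻¹ * cocycleIterNeg f A n x := by
  rw [cocycleIterNeg, cocycleIterNeg, cocycleIter_add, cocycleIter_one, mul_inv_rev,
    Function.iterate_succ_apply', Function.iterate_one, f.apply_symm_apply]

lemma cocycleIter_symm (n : ℕ) (x : X) :
    cocycleIter f.symm (fun y => (A (f.symm y))⁻¹) n x = cocycleIterNeg f A n x := by
  induction n with
  | zero => exact inv_one.symm
  | succ n ih => rw [cocycleIter_succ, ih, cocycleIterNeg_add_one]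

lemma cocycleIter_mul_cocycleIterNeg (n : ℕ) (x : X) :
    cocycleIter f A n (f.symm^[n] x) * cocycleIterNeg f A n x = 1 := mul_inv_cancel _

variable {A}

lemma continuous_cocycleIter (hA : Continuous A) (n : ℕ) : Continuous (cocycleIter f A n) := by
  induction n with
  | zero => exact continuous_const
  | succ n ih => exact (hA.comp (f.continuous.iterate n)).mul ih

/-- The direction field `E` is invariant under the cocycle. -/
def IsInvariantField (f : X ≃ₜ X) (A : X → SL(2, ℝ)) (E : X → P1) : Prop :=
  ∀ x, A x • E x = E (f x)

/-- The directions of the field `E` are uniformly exponentially contracted by the cocycle under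
forward iteration. -/
def IsContractedField (f : X ≃ₜ X) (A : X → SL(2, ℝ)) (E : X → P1) : Prop :=
  ∃ C r : ℝ, 0 < C ∧ 0 < r ∧ r < 1 ∧ ∀ (n : ℕ) (x : X), ∀ v ∈ (E x).submodule,
    ‖(cocycleIter f A n x).1 *ᵥ v‖ ≤ C * r ^ n * ‖v‖

/-- The norms of the iterates of the cocycle grow uniformly exponentially. -/
def HasUniformGrowth (f : X ≃ₜ X) (A : X → SL(2, ℝ)) : Prop :=
  ∃ c l : ℝ, 0 < c ∧ 1 < l ∧ ∀ (n : ℕ) (x : X), c * l ^ n ≤ ‖(cocycleIter f A n x).1‖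

variable {f} {E : X → P1}

lemma IsInvariantField.cocycleIter_smul (hE : IsInvariantField f A E) (n : ℕ) (x : X) :
    cocycleIter f A n x • E x = E (f^[n] x) := by
  induction n with
  | zero => exact one_smul _ _
  | succ n ih => rw [cocycleIter_succ, mul_smul, ih, hE, Function.iterate_succ_apply']

lemma IsInvariantField.symm (hE : IsInvariantField f A E) :
    IsInvariantField f.symm (fun y => (A (f.symm y))⁻¹) E := fun x => by
  rw [inv_smul_eq_iff, hE, f.apply_symm_apply]

lemma IsInvariantField.of_symm (hE : IsInvariantField f.symm (fun y => (A (f.symm y))⁻¹) E) :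
    IsInvariantField f A E := fun x => by
  have h := hE (f x)
  rw [inv_smul_eq_iff, f.symm_apply_apply] at h
  exact h.symm

lemma IsInvariantField.cocycleIterNeg_smul (hE : IsInvariantField f A E) (n : ℕ) (x : X) :
    cocycleIterNeg f A n x • E x = E (f.symm^[n] x) := by
  rw [← cocycleIter_symm, hE.symm.cocycleIter_smul]

lemma uniformlyHyperbolic_iff : UniformlyHyperbolic f A ↔
    ∃ Es Eu : X → P1, Continuous Es ∧ Continuous Eu ∧
      (∀ x, IsCompl (Es x).submodule (Eu x).submodule) ∧
      IsInvariantField f A Es ∧ IsInvariantField f A Eu ∧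
      IsContractedField f A Es ∧ IsContractedField f.symm (fun y => (A (f.symm y))⁻¹) Eu := by
  simp only [IsContractedField, cocycleIter_symm]
  constructor
  · rintro ⟨Es, Eu, hEs, hEu, hcompl, hsinv, huinv, C, r, hC, hr, hr1, h⟩
    exact ⟨Es, Eu, hEs, hEu, hcompl, hsinv, huinv, ⟨C, r, hC, hr, hr1, fun n x => (h n x).1⟩,
      ⟨C, r, hC, hr, hr1, fun n x => (h n x).2⟩⟩
  · rintro ⟨Es, Eu, hEs, hEu, hcompl, hsinv, huinv, ⟨C, r, hC, hr, hr1, hs⟩,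
      ⟨C', r', _, hr', hr1', hu⟩⟩
    refine ⟨Es, Eu, hEs, hEu, hcompl, hsinv, huinv, max C C', max r r',
      hC.trans_le (le_max_left _ _), hr.trans_le (le_max_left _ _), max_lt hr1 hr1',
      fun n x => ⟨fun v hv => ?_, fun v hv => ?_⟩⟩
    · refine (hs n x v hv).trans ?_
      gcongr
      exacts [le_max_left _ _, le_max_left _ _]
    · refine (hu n x v hv).trans ?_
      gcongr
      exacts [le_max_right _ _, le_max_right _ _]

lemma norm_cocycleIter_mulVec_le {K : ℝ} (hK : ∀ x, 2 * ‖(A x).1‖ ≤ K) (n : ℕ) (x : X)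
    (v : Fin 2 → ℝ) : ‖(cocycleIter f A n x).1 *ᵥ v‖ ≤ K ^ n * ‖v‖ := by
  have hK0 : 0 ≤ K := (by positivity : 0 ≤ 2 * ‖(A x).1‖).trans (hK x)
  induction n with
  | zero => simp [cocycleIter_zero]
  | succ n ih =>
    rw [cocycleIter_succ, coe_mul_mulVec]
    calc _ ≤ 2 * ‖(A (f^[n] x)).1‖ * ‖(cocycleIter f A n x).1 *ᵥ v‖ :=
          (norm_mulVec_le _ _).trans_eq (by simp)
      _ ≤ K * (K ^ n * ‖v‖) := mul_le_mul (hK _) ih (norm_nonneg _) hK0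
      _ = K ^ (n + 1) * ‖v‖ := by ring

/-- Iterating the assumed contraction, whose time `k` depends on the point, leaves a remainder of
at most `m` steps, which is absorbed by the constant. -/
lemma IsInvariantField.isContractedField_of_bounded_time (hE : IsInvariantField f A E) {L : ℝ}
    (hL : ∀ x, ‖(A x).1‖ ≤ L) {m : ℕ} (hm : m ≠ 0)
    (h : ∀ x, ∃ k, 1 ≤ k ∧ k ≤ m ∧ ∀ v ∈ (E x).submodule,
      ‖(cocycleIter f A k x).1 *ᵥ v‖ ≤ 1 / 2 * ‖v‖) : IsContractedField f A E := by
  let K := max (2 * L) 1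
  have hK : ∀ x, 2 * ‖(A x).1‖ ≤ K := fun x => le_max_of_le_left (by linarith [hL x])
  have hK1 : 1 ≤ K := le_max_right _ _
  obtain ⟨r, hr0, hr1, hrm⟩ : ∃ r : ℝ, 0 < r ∧ r < 1 ∧ r ^ m = 1 / 2 :=
    ⟨(1 / 2) ^ (m⁻¹ : ℝ), by positivity,
      Real.rpow_lt_one (by norm_num) (by norm_num) (by positivity),
      Real.rpow_inv_natCast_pow (by norm_num) hm⟩
  have hhalf : ∀ k ≤ m, 1 / 2 ≤ r ^ k := fun k hk => hrm ▸ pow_le_pow_of_le_one hr0.le hr1.le hk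
  refine ⟨2 * K ^ m, r, by positivity, hr0, hr1, fun n => ?_⟩
  induction n using Nat.strong_induction_on with
  | _ n ih =>
    intro x v hv
    rcases lt_or_ge n m with hn | hn
    · calc ‖(cocycleIter f A n x).1 *ᵥ v‖ ≤ K ^ n * ‖v‖ := norm_cocycleIter_mulVec_le hK n x v
        _ ≤ K ^ m * (2 * r ^ n) * ‖v‖ := by
          gcongr
          calc K ^ n ≤ K ^ m * 1 := by rw [mul_one]; exact pow_le_pow_right₀ hK1 hn.le
            _ ≤ K ^ m * (2 * r ^ n) := by gcongr; linarith [hhalf n hn.le]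
        _ = 2 * K ^ m * r ^ n * ‖v‖ := by ring
    · obtain ⟨k, hk1, hkm, hk⟩ := h x
      obtain ⟨j, rfl⟩ := Nat.exists_eq_add_of_le' (hkm.trans hn)
      rw [cocycleIter_add, coe_mul_mulVec]
      have hmem : (cocycleIter f A k x).1 *ᵥ v ∈ (E (f^[k] x)).submodule :=
        hE.cocycleIter_smul k x ▸ mulVec_mem_smul _ hv
      calc _ ≤ 2 * K ^ m * r ^ j * ‖(cocycleIter f A k x).1 *ᵥ v‖ := ih j (by omega) _ _ hmem
        _ ≤ 2 * K ^ m * r ^ j * (r ^ k * ‖v‖) := by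
          gcongr
          exact (hk v hv).trans (mul_le_mul_of_nonneg_right (hhalf k hkm) (norm_nonneg v))
        _ = 2 * K ^ m * r ^ (j + k) * ‖v‖ := by ring

lemma ne_of_isContractedField {Es Eu : X → P1} (hinv : IsInvariantField f A Es)
    (hs : IsContractedField f A Es)
    (hu : IsContractedField f.symm (fun y => (A (f.symm y))⁻¹) Eu) (x : X) : Es x ≠ Eu x := by
  intro heq
  obtain ⟨C, r, hC, hr, hr1, hs⟩ := hs
  obtain ⟨C', r', _, hr', hr1', hu⟩ := hu
  have hv := rep_mem_submodule (Es x)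
  set v := (Es x).rep
  have hv0 : 0 < ‖v‖ := norm_pos_iff.2 (Es x).rep_nonzero
  -- A common direction would be contracted both by an iterate and by its inverse.
  have hle : ∀ n : ℕ, 1 ≤ C * C' * (r * r') ^ n := fun n => by
    have hback := hu n x v (heq ▸ hv)
    rw [cocycleIter_symm] at hback
    have hforth := hs n (f.symm^[n] x) (cocycleIterNeg f A n x *ᵥ v)
      (hinv.cocycleIterNeg_smul n x ▸ mulVec_mem_smul _ hv)
    rw [← coe_mul_mulVec, cocycleIter_mul_cocycleIterNeg, Matrix.SpecialLinearGroup.coe_one,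
      Matrix.one_mulVec] at hforth
    refine le_of_mul_le_mul_right ?_ hv0
    calc 1 * ‖v‖ ≤ C * r ^ n * ‖(cocycleIterNeg f A n x).1 *ᵥ v‖ := (one_mul _).trans_le hforth
      _ ≤ C * r ^ n * (C' * r' ^ n * ‖v‖) := by gcongr
      _ = C * C' * (r * r') ^ n * ‖v‖ := by ring
  have hlim : Tendsto (fun n : ℕ => C * C' * (r * r') ^ n) atTop (𝓝 0) := by
    simpa only [mul_zero] using (tendsto_pow_atTop_nhds_zero_of_lt_one (by positivity)
      (mul_lt_one_of_nonneg_of_lt_one_left hr.le hr1 hr1'.le)).const_mul (C * C')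
  exact not_lt_of_ge (ge_of_tendsto' hlim hle) one_pos

end Cocycle

lemma exists_mem_submodule_iff_mulVec_eq_zero {Q : Mat2} (htr : Q.trace = 1)
    (hQ : Q * (1 - Q) = 0) : ∃ d : P1, ∀ v, v ∈ d.submodule ↔ Q *ᵥ v = 0 := by
  have hidem : IsIdempotentElem Q := by
    rwa [mul_sub, mul_one, sub_eq_zero, eq_comm] at hQ
  have hproj : IsIdempotentElem Q.toLin' := hidem.map Matrix.toLinAlgEquiv'
  have hrange : (Module.finrank ℝ (LinearMap.range Q.toLin') : ℝ) = 1 := by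
    rw [← (LinearMap.IsIdempotentElem.isProj_range _ hproj).trace, Matrix.trace_toLin'_eq, htr]
  have hker : Module.finrank ℝ (LinearMap.ker Q.toLin') = 1 := by
    have h := LinearMap.finrank_range_add_finrank_ker Q.toLin'
    rw [Nat.cast_eq_one.1 hrange, Module.finrank_fin_fun] at h
    omega
  refine ⟨Projectivization.mk'' _ hker, fun v => ?_⟩
  rw [Projectivization.submodule_mk'', LinearMap.mem_ker, Matrix.toLin'_apply]

lemma norm_mulVec_le_of_mulVec_eq_zero (M : Mat2) {Q : Mat2} {v : Fin 2 → ℝ} (h : Q *ᵥ v = 0) :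
    ‖M *ᵥ v‖ ≤ 2 * ‖M * (1 - Q)‖ * ‖v‖ := by
  have hv : (1 - Q) *ᵥ v = v := by rw [Matrix.sub_mulVec, Matrix.one_mulVec, h, sub_zero]
  calc ‖M *ᵥ v‖ = ‖(M * (1 - Q)) *ᵥ v‖ := by rw [← Matrix.mulVec_mulVec, hv]
    _ ≤ 2 * ‖M * (1 - Q)‖ * ‖v‖ := by
      simpa only [Fintype.card_fin, Nat.cast_ofNat] using norm_mulVec_le (M * (1 - Q)) v

section KernelField

variable {X : Type*} [TopologicalSpace X] {f : X ≃ₜ X} {A : X → SL(2, ℝ)} {c l L : ℝ}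
  {Q : X → Mat2} {E : X → P1}

lemma continuous_of_mem_submodule_iff (hQ : Continuous Q) (hidem : ∀ x, Q x * (1 - Q x) = 0)
    (hE : ∀ x v, v ∈ (E x).submodule ↔ Q x *ᵥ v = 0) : Continuous E := by
  refine continuous_iff_continuousAt.2 fun x => ?_
  have hker := (hE x _).1 (rep_mem_submodule (E x))
  have hcont : Continuous fun y => (1 - Q y) *ᵥ (E x).rep := by fun_prop
  refine continuousAt_of_section hcont.continuousAt ?_ fun y => ?_
  · rw [Matrix.sub_mulVec, Matrix.one_mulVec, hker, sub_zero]
    exact (E x).rep_nonzero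
  · rw [hE, Matrix.mulVec_mulVec, hidem, Matrix.zero_mulVec]

lemma continuous_lim_expProj (hA : Continuous A)
    (hM : ∀ x, IsExpGrowing (fun n => cocycleIter f A n x) c l L)
    (hQ : ∀ x, Tendsto (fun n => expProj (cocycleIter f A n x)) atTop (𝓝 (Q x))) :
    Continuous Q := by
  rcases isEmpty_or_nonempty X with hX | ⟨⟨x₀⟩⟩
  · exact continuous_of_const fun x => hX.elim x
  have hbound : Tendsto (fun n : ℕ => 2 * L / c ^ 2 * ((l ^ 2)⁻¹) ^ n / (1 - (l ^ 2)⁻¹)) atTop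
      (𝓝 0) := by
    simpa using ((tendsto_pow_atTop_nhds_zero_of_lt_one (by positivity)
      (hM x₀).inv_sq_lt_one).const_mul (2 * L / c ^ 2)).div_const (1 - (l ^ 2)⁻¹)
  have hunif : TendstoUniformly (fun n x => expProj (cocycleIter f A n x)) Q atTop := by
    refine Metric.tendstoUniformly_iff.2 fun ε hε => ?_
    filter_upwards [hbound.eventually_lt_const hε] with n hn x
    rw [dist_comm]
    exact ((hM x).dist_lim_le (hQ x) n).trans_lt hn
  exact hunif.continuous (Frequently.of_forall fun n =>
    continuous_expProj.comp (continuous_cocycleIter f hA n))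

lemma isInvariantField_of_mem_submodule_iff
    (hM : ∀ x, IsExpGrowing (fun n => cocycleIter f A n x) c l L)
    (hQ : ∀ x, Tendsto (fun n => expProj (cocycleIter f A n x)) atTop (𝓝 (Q x)))
    (hE : ∀ x v, v ∈ (E x).submodule ↔ Q x *ᵥ v = 0) : IsInvariantField f A E := by
  intro x
  have hv := rep_mem_submodule (E x)
  have hAv : A x • E x = Projectivization.mk ℝ _ (mulVec_ne_zero (A x) (E x).rep_nonzero) := by
    rw [← smul_mk_eq (A x) (E x).rep_nonzero, Projectivization.mk_rep]
  rw [hAv]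
  set v := (E x).rep
  refine mk_eq_of_mem _ ((hE _ _).2 ?_)
  -- Otherwise the iterates of `v` would be unbounded, whereas they are small infinitely often.
  by_contra hne
  obtain ⟨N, hN⟩ :=
    (((hM (f x)).tendsto_norm_mulVec (hQ (f x)) hne).eventually_gt_atTop
      (2 * ‖v‖)).exists_forall_of_atTop
  obtain ⟨n, hn, hsmall⟩ := (hM x).exists_norm_coe_mul_one_sub_lim_lt (hQ x) one_pos (N + 1)
  obtain ⟨k, rfl⟩ := Nat.exists_eq_add_of_le' (Nat.one_le_of_lt hn)
  have hlarge := hN k (by omega)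
  rw [← coe_mul_mulVec, ← cocycleIter_one f A x, ← Function.iterate_one f, ← cocycleIter_add]
    at hlarge
  have hle := norm_mulVec_le_of_mulVec_eq_zero (cocycleIter f A (k + 1) x).1 ((hE x v).1 hv)
  nlinarith [norm_nonneg v]

lemma isContractedField_of_mem_submodule_iff [CompactSpace X] (hA : Continuous A)
    (hL : ∀ x, ‖(A x).1‖ ≤ L) (hM : ∀ x, IsExpGrowing (fun n => cocycleIter f A n x) c l L)
    (hQ : ∀ x, Tendsto (fun n => expProj (cocycleIter f A n x)) atTop (𝓝 (Q x)))
    (hE : ∀ x v, v ∈ (E x).submodule ↔ Q x *ᵥ v = 0) : IsContractedField f A E := by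
  have hQc := continuous_lim_expProj hA hM hQ
  let W : ℕ → Set X := fun m => ⋃ k ∈ Icc 1 m, {x | ‖(cocycleIter f A k x).1 * (1 - Q x)‖ < 1 / 4}
  have hopen : ∀ m, IsOpen (W m) := fun m => isOpen_biUnion fun k _ => by
    have hk := continuous_cocycleIter f hA k
    exact isOpen_lt (by fun_prop) continuous_const
  have hmono : Monotone W := fun a b hab =>
    biUnion_subset_biUnion_left fun k hk => ⟨hk.1, hk.2.trans hab⟩
  have hcover : univ ⊆ ⋃ m, W m := fun x _ => by
    obtain ⟨n, hn, h⟩ :=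
      (hM x).exists_norm_coe_mul_one_sub_lim_lt (hQ x) (by norm_num : (0 : ℝ) < 1 / 4) 1
    exact mem_iUnion.2 ⟨n, mem_iUnion₂.2 ⟨n, ⟨hn, le_rfl⟩, h⟩⟩
  obtain ⟨m, hm⟩ := isCompact_univ.elim_directed_cover W hopen hcover hmono.directed_le
  refine (isInvariantField_of_mem_submodule_iff hM hQ hE).isContractedField_of_bounded_time hL
    m.succ_ne_zero fun x => ?_
  obtain ⟨k, hk, hx⟩ := mem_iUnion₂.1 (hm (mem_univ x))
  refine ⟨k, hk.1, hk.2.trans m.le_succ, fun v hv =>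
    (norm_mulVec_le_of_mulVec_eq_zero _ ((hE x v).1 hv)).trans ?_⟩
  gcongr
  linarith [Set.mem_ofPred.1 hx]

end KernelField

section Growth

variable {X : Type*} [TopologicalSpace X] {f : X ≃ₜ X} {A : X → SL(2, ℝ)}

theorem HasUniformGrowth.exists_isContractedField [CompactSpace X] (hg : HasUniformGrowth f A)
    (hA : Continuous A) :
    ∃ E : X → P1, Continuous E ∧ IsInvariantField f A E ∧ IsContractedField f A E := by
  obtain ⟨c, l, hc, hl, hg⟩ := hg
  obtain ⟨L, hL⟩ : ∃ L, ∀ x, ‖(A x).1‖ ≤ L := by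
    obtain ⟨L, hL⟩ := (isCompact_range (f := fun x => ‖(A x).1‖) (by fun_prop)).bddAbove
    exact ⟨L, fun x => hL (mem_range_self x)⟩
  have hM : ∀ x, IsExpGrowing (fun n => cocycleIter f A n x) c l L := fun x =>
    ⟨hc, hl, fun n => hg n x, fun n => by
      rw [cocycleIter_succ, mul_inv_cancel_right]
      exact hL _⟩
  choose Q hQ using fun x => (hM x).exists_tendsto_expProj
  have hidem := fun x => (hM x).lim_mul_one_sub (hQ x)
  have htr : ∀ x, (Q x).trace = 1 := fun x =>
    tendsto_nhds_unique ((continuous_id.matrix_trace.tendsto (Q x)).comp (hQ x))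
      (tendsto_const_nhds.congr fun n => (trace_expProj _).symm)
  choose E hE using fun x => exists_mem_submodule_iff_mulVec_eq_zero (htr x) (hidem x)
  exact ⟨E, continuous_of_mem_submodule_iff (continuous_lim_expProj hA hM hQ) hidem hE,
    isInvariantField_of_mem_submodule_iff hM hQ hE,
    isContractedField_of_mem_submodule_iff hA hL hM hQ hE⟩

lemma HasUniformGrowth.symm (hg : HasUniformGrowth f A) :
    HasUniformGrowth f.symm (fun y => (A (f.symm y))⁻¹) := by
  obtain ⟨c, l, hc, hl, hg⟩ := hg
  refine ⟨c, l, hc, hl, fun n x => ?_⟩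
  rw [cocycleIter_symm, cocycleIterNeg, norm_coe_inv]
  exact hg n _

theorem HasUniformGrowth.uniformlyHyperbolic [CompactSpace X] (hg : HasUniformGrowth f A)
    (hA : Continuous A) : UniformlyHyperbolic f A := by
  obtain ⟨Es, hEs, hsinv, hs⟩ := hg.exists_isContractedField hA
  obtain ⟨Eu, hEu, huinv, hu⟩ :=
    hg.symm.exists_isContractedField (hA.comp f.symm.continuous).inv
  have hcompl : ∀ x, IsCompl (Es x).submodule (Eu x).submodule := fun x =>
    isCompl_submodule_of_ne (Module.finrank_fin_fun ℝ) (ne_of_isContractedField hsinv hs hu x)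
  exact uniformlyHyperbolic_iff.2 ⟨Es, Eu, hEs, hEu, hcompl, hsinv, huinv.of_symm, hs, hu⟩

end Growth

/-! ### Consequences of uniform hyperbolicity -/

lemma lt_one_of_forall_pow_le {C r a : ℝ} (hr0 : 0 ≤ r) (hr1 : r < 1)
    (h : ∀ n : ℕ, a ^ n ≤ C * r ^ n) : a < 1 := by
  by_contra! ha
  have hlim : Tendsto (fun n : ℕ => C * r ^ n) atTop (𝓝 0) := by
    simpa only [mul_zero] using (tendsto_pow_atTop_nhds_zero_of_lt_one hr0 hr1).const_mul C
  exact not_lt_of_ge (ge_of_tendsto' hlim fun n => (one_le_pow₀ ha).trans (h n)) one_pos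

lemma sq_sub_trace_mul_add_one_eq_zero {K : Type*} [Field K] {P : SL(2, K)} {v : Fin 2 → K}
    (hv : v ≠ 0) {μ : K} (h : P.1 *ᵥ v = μ • v) : μ ^ 2 - P.1.trace * μ + 1 = 0 := by
  have hdet : (P.1 - μ • 1).det = 0 := Matrix.exists_mulVec_eq_zero_iff.1
    ⟨v, hv, by rw [Matrix.sub_mulVec, h, Matrix.smul_mulVec, Matrix.one_mulVec, sub_self]⟩
  have hP := P.det_coe
  simp only [Matrix.det_fin_two, Matrix.sub_apply, Matrix.smul_apply, Matrix.one_apply_eq,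
    Matrix.one_apply_ne zero_ne_one, Matrix.one_apply_ne one_ne_zero, smul_eq_mul] at hdet hP
  rw [Matrix.trace_fin_two]
  linear_combination hdet - hP

lemma hyperbolic_of_mulVec_eq_smul {P : SL(2, ℝ)} {v : Fin 2 → ℝ} (hv : v ≠ 0) {μ : ℝ}
    (h : P.1 *ᵥ v = μ • v) (hμ : |μ| ≠ 1) : Hyperbolic P := by
  have hchar := sq_sub_trace_mul_add_one_eq_zero hv h
  have hμ0 : 0 < |μ| := by
    rw [abs_pos]
    rintro rfl
    simp at hchar
  have htr : |P.1.trace| * |μ| = |μ| ^ 2 + 1 := by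
    rw [← abs_mul, sq_abs, show P.1.trace * μ = μ ^ 2 + 1 by linarith]
    exact abs_of_pos (by positivity)
  rw [Hyperbolic]
  refine lt_of_mul_lt_mul_right ?_ hμ0.le
  nlinarith [sq_pos_of_ne_zero (sub_ne_zero.2 hμ)]

lemma coe_pow_mulVec_of_mulVec_eq_smul {n R : Type*} [Fintype n] [DecidableEq n] [CommRing R]
    {P : Matrix.SpecialLinearGroup n R} {v : n → R} {μ : R} (h : P.1 *ᵥ v = μ • v) (k : ℕ) :
    (P ^ k).1 *ᵥ v = μ ^ k • v := by
  induction k with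
  | zero => rw [pow_zero, pow_zero, Matrix.SpecialLinearGroup.coe_one, Matrix.one_mulVec, one_smul]
  | succ k ih => rw [pow_succ, coe_mul_mulVec, h, Matrix.mulVec_smul, ih, smul_smul, pow_succ']

section Cocycle

variable {X : Type*} [TopologicalSpace X] {f : X ≃ₜ X} {A : X → SL(2, ℝ)}

lemma cocycleIter_mul_of_iterate_eq_self {n : ℕ} {x : X} (hx : f^[n] x = x) (k : ℕ) :
    cocycleIter f A (k * n) x = cocycleIter f A n x ^ k := by
  induction k with
  | zero => rw [zero_mul, cocycleIter_zero, pow_zero]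
  | succ k ih => rw [Nat.succ_mul, cocycleIter_add, hx, ih, pow_succ]

lemma cocycleIter_mulVec_of_forall_mulVec_eq_smul {c : ℝ} {v : Fin 2 → ℝ} {x : X} {n : ℕ}
    (h : ∀ k < n, (A (f^[k] x)).1 *ᵥ v = c • v) :
    (cocycleIter f A n x).1 *ᵥ v = c ^ n • v := by
  induction n with
  | zero => rw [cocycleIter_zero, Matrix.SpecialLinearGroup.coe_one, Matrix.one_mulVec, pow_zero,
      one_smul]
  | succ n ih =>
    rw [cocycleIter_succ, coe_mul_mulVec, ih fun k hk => h k (hk.trans n.lt_succ_self),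
      Matrix.mulVec_smul, h n n.lt_succ_self, smul_smul, pow_succ]

theorem UniformlyHyperbolic.hyperbolic_cocycleIter (h : UniformlyHyperbolic f A) {n : ℕ}
    (hn : n ≠ 0) {x : X} (hx : f^[n] x = x) : Hyperbolic (cocycleIter f A n x) := by
  obtain ⟨Es, Eu, -, -, -, hinv, -, ⟨C, r, -, hr0, hr1, hs⟩, -⟩ := uniformlyHyperbolic_iff.1 h
  have hv := rep_mem_submodule (Es x)
  have hv0 := (Es x).rep_nonzero
  obtain ⟨μ, hμ⟩ : ∃ μ : ℝ, μ • (Es x).rep = (cocycleIter f A n x).1 *ᵥ (Es x).rep := by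
    rw [← mem_submodule_mk hv0, mk_eq_of_mem hv0 hv]
    simpa only [hinv.cocycleIter_smul, hx] using mulVec_mem_smul (cocycleIter f A n x) hv
  refine hyperbolic_of_mulVec_eq_smul hv0 hμ.symm (ne_of_lt ?_)
  refine lt_one_of_forall_pow_le (pow_nonneg hr0.le n) (pow_lt_one₀ hr0.le hr1 hn) (C := C)
    fun k => le_of_mul_le_mul_right ?_ (norm_pos_iff.2 hv0)
  calc |μ| ^ k * ‖(Es x).rep‖ = ‖(cocycleIter f A (k * n) x).1 *ᵥ (Es x).rep‖ := by
        rw [cocycleIter_mul_of_iterate_eq_self hx, coe_pow_mulVec_of_mulVec_eq_smul hμ.symm,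
          norm_smul, norm_pow, Real.norm_eq_abs]
    _ ≤ C * r ^ (k * n) * ‖(Es x).rep‖ := hs _ _ _ hv
    _ = C * (r ^ n) ^ k * ‖(Es x).rep‖ := by rw [← pow_mul, mul_comm k]

lemma mem_submodule_of_forall_norm_cocycleIter_mulVec_le {Es Eu : X → P1} {x : X}
    (hcompl : Codisjoint (Es x).submodule (Eu x).submodule) (hinv : IsInvariantField f A Eu)
    (hs : IsContractedField f A Es)
    (hu : IsContractedField f.symm (fun y => (A (f.symm y))⁻¹) Eu) {v : Fin 2 → ℝ} {K : ℝ}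
    (hv : ∀ n, ‖(cocycleIter f A n x).1 *ᵥ v‖ ≤ K) : v ∈ (Es x).submodule := by
  obtain ⟨C, r, -, hr0, hr1, hs⟩ := hs
  obtain ⟨C', r', hC', hr0', hr1', hu⟩ := hu
  obtain ⟨s, hsmem, u, humem, rfl⟩ :=
    Submodule.mem_sup.1 (hcompl.eq_top ▸ Submodule.mem_top (x := v))
  suffices hu0 : u = 0 by rwa [hu0, add_zero]
  have hbound : ∀ n : ℕ, ‖u‖ ≤ C' * r' ^ n * (K + C * r ^ n * ‖s‖) := fun n => by
    have hback := hu n (f^[n] x) ((cocycleIter f A n x).1 *ᵥ u)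
      (hinv.cocycleIter_smul n x ▸ mulVec_mem_smul _ humem)
    rw [cocycleIter_symm, cocycleIterNeg, Function.LeftInverse.iterate f.symm_apply_apply n x,
      ← coe_mul_mulVec, inv_mul_cancel, Matrix.SpecialLinearGroup.coe_one,
      Matrix.one_mulVec] at hback
    refine hback.trans (mul_le_mul_of_nonneg_left ?_ (by positivity))
    rw [← add_sub_cancel_left s u, Matrix.mulVec_sub]
    exact norm_sub_le_of_le (hv n) (hs n x s hsmem)
  have hlim : Tendsto (fun n : ℕ => C' * r' ^ n * (K + C * r ^ n * ‖s‖)) atTop (𝓝 0) := by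
    have hr := (tendsto_pow_atTop_nhds_zero_of_lt_one hr0.le hr1).const_mul C
    have hr' := (tendsto_pow_atTop_nhds_zero_of_lt_one hr0'.le hr1').const_mul C'
    simpa only [mul_zero, zero_mul] using hr'.mul ((hr.mul_const ‖s‖).const_add K)
  exact norm_le_zero_iff.1 (ge_of_tendsto' hlim hbound)

end Cocycle

section Shift

variable {p : SL(2, ℝ) × SL(2, ℝ)}

lemma shift_iterate_apply (n : ℕ) (x : ℤ → Fin 2) (i : ℤ) : (shift^[n] x) i = x (i + n) := by
  induction n generalizing i with
  | zero => rw [Function.iterate_zero_apply, Nat.cast_zero, add_zero]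
  | succ n ih =>
    rw [Function.iterate_succ_apply', Nat.cast_succ, add_comm (n : ℤ) 1, ← add_assoc]
    exact ih (i + 1)

lemma cocycleIter_shift (p : SL(2, ℝ) × SL(2, ℝ)) (n : ℕ) (x : ℤ → Fin 2) :
    cocycleIter shift (fun x => letter p (x 0)) n x =
      ((List.ofFn fun i : Fin n => x (i : ℕ)).reverse.map (letter p)).prod := by
  induction n with
  | zero => rfl
  | succ n ih =>
    rw [cocycleIter_succ, ih, List.ofFn_succ_last, List.reverse_append, List.map_append,
      List.prod_append]
    simp only [shift_iterate_apply, zero_add, Fin.val_castSucc, Fin.val_last,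
      List.reverse_singleton, List.map_singleton, List.prod_singleton]

/-- The norm of the products of the two matrices grows exponentially with the number of factors. -/
def HasGrowth (p : SL(2, ℝ) × SL(2, ℝ)) : Prop :=
  ∃ c l : ℝ, 0 < c ∧ 1 < l ∧ ∀ w : List (Fin 2), c * l ^ w.length ≤ ‖(w.map (letter p)).prod.1‖

lemma HasGrowth.mem_hypLocus (h : HasGrowth p) : p ∈ hypLocus := by
  obtain ⟨c, l, hc, hl, h⟩ := h
  refine HasUniformGrowth.uniformlyHyperbolic ⟨c, l, hc, hl, fun n x => ?_⟩
    (continuous_of_discreteTopology.comp (continuous_apply 0))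
  rw [cocycleIter_shift]
  simpa only [List.length_reverse, List.length_ofFn] using
    h (List.ofFn fun i : Fin n => x (i : ℕ)).reverse

lemma exists_shift_iterate_eq_self (w : List (Fin 2)) :
    ∃ x, shift^[w.length] x = x ∧ (List.ofFn fun i : Fin w.length => x (i : ℕ)).reverse = w := by
  refine ⟨fun i => w.reverse.getD (i % w.length).toNat 0, ?_, ?_⟩
  · ext i
    rw [shift_iterate_apply, Int.add_emod_right]
  · refine List.reverse_eq_iff.2 (List.ext_getElem (by simp) fun i _ hi => ?_)
    have hmod : ((i : ℤ) % w.length).toNat = i := by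
      rw [← Int.natCast_mod, Int.toNat_natCast, Nat.mod_eq_of_lt (by simpa using hi)]
    simp only [List.getElem_ofFn, hmod]
    exact List.getD_eq_getElem _ _ hi

theorem hyperbolic_of_mem_hypLocus (hp : p ∈ hypLocus) {w : List (Fin 2)} (hw : w ≠ []) :
    Hyperbolic (w.map (letter p)).prod := by
  obtain ⟨x, hper, hx⟩ := exists_shift_iterate_eq_self w
  have h := UniformlyHyperbolic.hyperbolic_cocycleIter hp (List.length_pos_iff.2 hw).ne' hper
  rwa [cocycleIter_shift, hx] at h

theorem notMem_hypLocus_of_mulVec_eq_smul {a b : Fin 2} {v : Fin 2 → ℝ} (hv : v ≠ 0) {c c' : ℝ}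
    (hc : 1 ≤ |c|) (hc' : |c'| ≤ 1) (ha : (letter p a).1 *ᵥ v = c • v)
    (hb : (letter p b).1 *ᵥ v = c' • v) : p ∉ hypLocus := by
  intro hp
  obtain ⟨Es, Eu, -, -, hcompl, hsinv, huinv, hs, hu⟩ := uniformlyHyperbolic_iff.1 hp
  -- In the past of `x` the vector `v` is expanded, in its future it is contracted.
  let x : ℤ → Fin 2 := fun i => if i < 0 then a else b
  have hx : v ∈ (Es x).submodule := by
    refine mem_submodule_of_forall_norm_cocycleIter_mulVec_le (hcompl x).codisjoint huinv hs hu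
      (K := ‖v‖) fun n => ?_
    rw [cocycleIter_mulVec_of_forall_mulVec_eq_smul (c := c') fun k _ => by
      rwa [shift_iterate_apply, zero_add, show x k = b from if_neg (by omega)],
      norm_smul, norm_pow, Real.norm_eq_abs]
    exact mul_le_of_le_one_left (norm_nonneg v) (pow_le_one₀ (abs_nonneg c') hc')
  obtain ⟨C, r, -, hr0, hr1, hs⟩ := hs
  refine (lt_one_of_forall_pow_le (C := C) hr0.le hr1 fun n => ?_).not_ge hc
  obtain ⟨y, hy⟩ : ∃ y, shift^[n] y = x := shift.surjective.iterate n x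
  have hyx : ∀ i : ℤ, y i = x (i - n) := fun i => by
    rw [← hy, shift_iterate_apply, sub_add_cancel]
  have hexp : (cocycleIter shift (fun z => letter p (z 0)) n y).1 *ᵥ v = c ^ n • v :=
    cocycleIter_mulVec_of_forall_mulVec_eq_smul fun k hk => by
      rwa [shift_iterate_apply, zero_add, hyx, show x (k - n) = a from if_pos (by omega)]
  have hEy : Es y = Es x := smul_left_cancel _ <| by
    rw [hsinv.cocycleIter_smul n y, smul_eq_self_of_mulVec_eq_smul hx hv hexp, hy]
  have hcontr := hs n y v (hEy ▸ hx)
  rw [hexp, norm_smul, norm_pow, Real.norm_eq_abs] at hcontr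
  exact le_of_mul_le_mul_right hcontr (norm_pos_iff.2 hv)

end Shift

/-! ### Cocycles up to sign -/

section Sign

lemma neg_smul_eq_smul {n K : Type*} [Fintype n] [DecidableEq n] [Fact (Even (Fintype.card n))]
    [Field K] (A : Matrix.SpecialLinearGroup n K) (d : ℙ K (n → K)) : (-A) • d = A • d := by
  induction d using Projectivization.ind with
  | h v hv =>
    rw [smul_mk_eq, smul_mk_eq, Projectivization.mk_eq_mk_iff']
    exact ⟨-1, by rw [neg_one_smul, Matrix.SpecialLinearGroup.coe_neg, Matrix.neg_mulVec]⟩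

variable {X : Type*} [TopologicalSpace X] {f : X ≃ₜ X} {A A' : X → SL(2, ℝ)} {E : X → P1}

lemma IsInvariantField.of_eq_or_eq_neg (h : IsInvariantField f A E)
    (hA : ∀ x, A' x = A x ∨ A' x = -A x) : IsInvariantField f A' E := fun x => by
  rcases hA x with hx | hx
  · rw [hx, h]
  · rw [hx, neg_smul_eq_smul, h]

lemma cocycleIter_eq_or_eq_neg (hA : ∀ x, A' x = A x ∨ A' x = -A x) (n : ℕ) (x : X) :
    cocycleIter f A' n x = cocycleIter f A n x ∨ cocycleIter f A' n x = -cocycleIter f A n x := by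
  induction n with
  | zero => exact Or.inl rfl
  | succ n ih =>
    rw [cocycleIter_succ, cocycleIter_succ]
    rcases ih with h | h <;> rcases hA (f^[n] x) with h' | h' <;> simp [h, h']

lemma IsContractedField.of_eq_or_eq_neg (h : IsContractedField f A E)
    (hA : ∀ x, A' x = A x ∨ A' x = -A x) : IsContractedField f A' E := by
  obtain ⟨C, r, hC, hr0, hr1, h⟩ := h
  refine ⟨C, r, hC, hr0, hr1, fun n x v hv => ?_⟩
  rcases cocycleIter_eq_or_eq_neg hA n x with hx | hx
  · exact hx ▸ h n x v hv
  · rw [hx, Matrix.SpecialLinearGroup.coe_neg, Matrix.neg_mulVec, norm_neg]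
    exact h n x v hv

theorem UniformlyHyperbolic.of_eq_or_eq_neg (h : UniformlyHyperbolic f A)
    (hA : ∀ x, A' x = A x ∨ A' x = -A x) : UniformlyHyperbolic f A' := by
  obtain ⟨Es, Eu, hEs, hEu, hcompl, hsinv, huinv, hs, hu⟩ := uniformlyHyperbolic_iff.1 h
  refine uniformlyHyperbolic_iff.2 ⟨Es, Eu, hEs, hEu, hcompl, hsinv.of_eq_or_eq_neg hA,
    huinv.of_eq_or_eq_neg hA, hs.of_eq_or_eq_neg hA, hu.of_eq_or_eq_neg fun x => ?_⟩
  rcases hA (f.symm x) with hx | hx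
  · exact Or.inl (congrArg _ hx)
  · exact Or.inr (by rw [hx, inv_neg])

lemma mem_hypLocus_of_eq_or_eq_neg {p q : SL(2, ℝ) × SL(2, ℝ)} (h : p ∈ hypLocus)
    (h1 : q.1 = p.1 ∨ q.1 = -p.1) (h2 : q.2 = p.2 ∨ q.2 = -p.2) : q ∈ hypLocus := by
  refine UniformlyHyperbolic.of_eq_or_eq_neg h fun x => ?_
  generalize x 0 = i
  fin_cases i
  exacts [h1, h2]

end Sign

/-! ### Traces of a pair and conjugation -/

section Trace

/-- The trace of the first matrix of a pair. -/
def trA (p : SL(2, ℝ) × SL(2, ℝ)) : ℝ := p.1.1.trace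

/-- The trace of the second matrix of a pair. -/
def trB (p : SL(2, ℝ) × SL(2, ℝ)) : ℝ := p.2.1.trace

/-- The trace of the product of the two matrices of a pair. -/
def trAB (p : SL(2, ℝ) × SL(2, ℝ)) : ℝ := (p.1 * p.2).1.trace

/-- The trace of the commutator `A B A⁻¹ B⁻¹` of a pair, encoded by Fricke's formula as a polynomial
in the traces of `A`, `B` and `A B`. -/
def trComm (p : SL(2, ℝ) × SL(2, ℝ)) : ℝ :=
  trA p ^ 2 + trB p ^ 2 + trAB p ^ 2 - trA p * trB p * trAB p - 2

/-- Simultaneous conjugation of the two matrices of a pair. -/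
def conjPair (g : SL(2, ℝ)) (p : SL(2, ℝ) × SL(2, ℝ)) : SL(2, ℝ) × SL(2, ℝ) :=
  (g * p.1 * g⁻¹, g * p.2 * g⁻¹)

section Conj

variable {n R : Type*} [Fintype n] [DecidableEq n] [CommRing R]
  (g : Matrix.SpecialLinearGroup n R) (M : Matrix n n R)

lemma trace_conj : (g.1 * M * (g⁻¹).1).trace = M.trace := by
  rw [Matrix.trace_mul_cycle, coe_inv_mul_coe, one_mul]

lemma det_conj : (g.1 * M * (g⁻¹).1).det = M.det := by
  rw [Matrix.det_mul, Matrix.det_mul, g.2, (g⁻¹).2, one_mul, mul_one]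

end Conj

variable (g h : SL(2, ℝ)) (p : SL(2, ℝ) × SL(2, ℝ))

lemma trA_conjPair : trA (conjPair g p) = trA p := trace_conj g _

lemma trB_conjPair : trB (conjPair g p) = trB p := trace_conj g _

lemma trAB_conjPair : trAB (conjPair g p) = trAB p := by
  rw [trAB, trAB, ← trace_conj g (p.1 * p.2).1]
  change (MulAut.conj g p.1 * MulAut.conj g p.2).1.trace = (MulAut.conj g (p.1 * p.2)).1.trace
  rw [map_mul]

lemma trComm_conjPair : trComm (conjPair g p) = trComm p := by
  rw [trComm, trA_conjPair, trB_conjPair, trAB_conjPair, trComm]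

lemma letter_conjPair : letter (conjPair g p) = MulAut.conj g ∘ letter p := by
  ext1 i
  fin_cases i <;> rfl

lemma prod_letter_conjPair (w : List (Fin 2)) :
    (w.map (letter (conjPair g p))).prod = g * (w.map (letter p)).prod * g⁻¹ := by
  rw [letter_conjPair, ← List.map_map, ← map_list_prod, MulAut.conj_apply]

lemma conjPair_conjPair : conjPair g (conjPair h p) = conjPair (g * h) p := by
  simp only [conjPair, mul_inv_rev, mul_assoc]

lemma conjPair_one : conjPair 1 p = p := by
  simp only [conjPair, inv_one, one_mul, mul_one]

variable {g p}

lemma HasGrowth.of_conjPair (hg : HasGrowth (conjPair g p)) : HasGrowth p := by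
  obtain ⟨c, l, hc, hl, hg⟩ := hg
  have hpos := norm_coe_pos g
  refine ⟨c / ‖g.1‖ ^ 2, l, by positivity, hl, fun w => ?_⟩
  rw [div_mul_eq_mul_div, div_le_iff₀ (by positivity)]
  calc c * l ^ w.length ≤ ‖g.1 * (w.map (letter p)).prod.1 * (g⁻¹).1‖ := by
        simpa only [prod_letter_conjPair, Matrix.SpecialLinearGroup.coe_mul] using hg w
    _ ≤ ‖g.1‖ * ‖(w.map (letter p)).prod.1‖ * ‖(g⁻¹).1‖ :=
        norm_mul_le_of_le (norm_mul_le _ _) le_rfl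
    _ = ‖(w.map (letter p)).prod.1‖ * ‖g.1‖ ^ 2 := by rw [norm_coe_inv]; ring

end Trace

/-! ### Pairs conjugate to positive pairs -/

lemma exists_conj_eq_conj_of_det_pos {N : Mat2} (hN : 0 < N.det) :
    ∃ g : SL(2, ℝ), ∀ T, g.1 * T * (g⁻¹).1 = N * T * N⁻¹ := by
  have hs : √N.det ≠ 0 := (Real.sqrt_pos.2 hN).ne'
  let g : SL(2, ℝ) := ⟨(√N.det)⁻¹ • N, by
    rw [Matrix.det_smul, Fintype.card_fin, inv_pow, Real.sq_sqrt hN.le, inv_mul_cancel₀ hN.ne']⟩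
  have hginv : (g⁻¹).1 = √N.det • N⁻¹ := by
    refine (Matrix.inv_eq_right_inv (coe_mul_coe_inv g)).symm.trans (Matrix.inv_eq_right_inv ?_)
    rw [smul_mul_smul_comm, inv_mul_cancel₀ hs, one_smul, Matrix.mul_nonsing_inv _ hN.ne'.isUnit]
  refine ⟨g, fun T => ?_⟩
  rw [hginv, smul_mul_assoc, smul_mul_smul_comm, inv_mul_cancel₀ hs, one_smul]

lemma exists_conj_eq_diagonal {M : Mat2} {r : ℝ} (hr : 0 < r) (ht : M.trace = 0)
    (hd : M.det = -r ^ 2) : ∃ g : SL(2, ℝ), g.1 * M * (g⁻¹).1 = !![r, 0; 0, -r] := by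
  -- The rows of `N` are left eigenvectors of `M`.
  suffices h : ∃ N : Mat2, 0 < N.det ∧ N * M = !![r, 0; 0, -r] * N by
    obtain ⟨N, hN, hNM⟩ := h
    obtain ⟨g, hg⟩ := exists_conj_eq_conj_of_det_pos hN
    exact ⟨g, by rw [hg, hNM, Matrix.mul_nonsing_inv_cancel_right _ _ hN.ne'.isUnit]⟩
  have h11 : M 1 1 = -M 0 0 := by linarith [Matrix.trace_fin_two M]
  rw [Matrix.det_fin_two, h11] at hd
  rw [M.eta_fin_two, h11]
  rcases le_total 0 (M 0 0) with h0 | h0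
  · refine ⟨!![M 0 0 + r, M 0 1; -M 1 0, M 0 0 + r], ?_, ?_⟩
    · rw [Matrix.det_fin_two_of]
      nlinarith
    · ext i j
      fin_cases i <;> fin_cases j <;> simp [Matrix.mul_apply] <;> linarith
  · refine ⟨!![M 1 0, r - M 0 0; M 0 0 - r, M 0 1], ?_, ?_⟩
    · rw [Matrix.det_fin_two_of]
      nlinarith
    · ext i j
      fin_cases i <;> fin_cases j <;> simp [Matrix.mul_apply] <;> linarith

lemma exists_conj_offdiag_eq {k : ℝ} (hk : 0 < k) : ∃ g : SL(2, ℝ), ∀ T : Mat2, T.trace = 0 →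
    (g.1 * T * (g⁻¹).1) 0 1 = T 0 0 + (k ^ 2 * T 0 1 - T 1 0) / (2 * k) ∧
    (g.1 * T * (g⁻¹).1) 1 0 = T 0 0 - (k ^ 2 * T 0 1 - T 1 0) / (2 * k) := by
  have hdet : (!![k, -1; k, 1] : Mat2).det = 2 * k := by rw [Matrix.det_fin_two_of]; ring
  obtain ⟨g, hg⟩ := exists_conj_eq_conj_of_det_pos
    (hdet.symm ▸ by positivity : 0 < (!![k, -1; k, 1] : Mat2).det)
  refine ⟨g, fun T hT => ?_⟩
  rw [Matrix.trace_fin_two, add_eq_zero_iff_neg_eq'] at hT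
  rw [hg, Matrix.inv_def, hdet, Matrix.adjugate_fin_two_of]
  constructor <;> simp [Matrix.mul_apply, Matrix.vecMul, dotProduct, ← hT] <;> field_simp <;> ring

lemma exists_abs_sq_mul_sub_lt {h b c : ℝ} (hh : 0 < h) (hd : h ^ 2 + b * c = 1) :
    ∃ k : ℝ, 0 < k ∧ |k ^ 2 * b - c| < 2 * k * h := by
  by_cases hb : b = 0
  · obtain rfl : h = 1 :=
      (pow_eq_one_iff_of_nonneg hh.le two_ne_zero).1 (by rwa [hb, zero_mul, add_zero] at hd)
    refine ⟨|c| + 1, by positivity, ?_⟩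
    rw [hb, mul_zero, zero_sub, abs_neg]
    linarith [abs_nonneg c]
  have hb' : 0 < |b| := abs_pos.2 hb
  by_cases hc : c = 0
  · obtain rfl : h = 1 :=
      (pow_eq_one_iff_of_nonneg hh.le two_ne_zero).1 (by rwa [hc, mul_zero, add_zero] at hd)
    refine ⟨|b|⁻¹, by positivity, ?_⟩
    rw [hc, sub_zero, abs_mul, abs_pow, abs_inv, abs_abs]
    field_simp
    norm_num
  -- This choice of `k` makes `k ^ 2 * b` and `c` equal in absolute value.
  have hk : √(|c| / |b|) ^ 2 * |b| = |c| := by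
    rw [Real.sq_sqrt (by positivity), div_mul_cancel₀ _ hb'.ne']
  have hk0 : 0 < √(|c| / |b|) := Real.sqrt_pos.2 (div_pos (abs_pos.2 hc) hb')
  generalize √(|c| / |b|) = k at hk hk0
  refine ⟨k, hk0, abs_lt_of_sq_lt_sq ?_ (by positivity)⟩
  have hbc : |b| * |c| - b * c < 2 * h ^ 2 := by
    rw [← abs_mul]
    rcases abs_cases (b * c) with ⟨h', -⟩ | ⟨h', -⟩ <;> rw [h'] <;> nlinarith [sq_pos_of_pos hh]
  calc (k ^ 2 * b - c) ^ 2 = 2 * k ^ 2 * (|b| * |c| - b * c) := by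
        linear_combination (k ^ 2 * |b| - |c|) * hk - k ^ 4 * sq_abs b - sq_abs c
    _ < 2 * k ^ 2 * (2 * h ^ 2) := by gcongr
    _ = (2 * k * h) ^ 2 := by ring

/-- Both off-diagonal entries are positive. -/
def OffDiagPos (M : Mat2) : Prop := 0 < M 0 1 ∧ 0 < M 1 0

lemma exists_conj_offDiagPos_of_add_eq_diagonal {R S : Mat2} {r : ℝ} (hr : 0 < r)
    (htR : R.trace = 0) (hR : R.det = -1) (hS : S.det = -1) (h : R + S = !![r, 0; 0, -r]) :
    ∃ g : SL(2, ℝ), OffDiagPos (g.1 * R * (g⁻¹).1) ∧ OffDiagPos (g.1 * S * (g⁻¹).1) := by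
  obtain rfl : S = !![r, 0; 0, -r] - R := eq_sub_of_add_eq' h
  have h11 : R 1 1 = -R 0 0 := by linarith [Matrix.trace_fin_two R]
  rw [Matrix.det_fin_two, h11] at hR
  have h00 : R 0 0 = r / 2 := by
    have h2 : r * (r - 2 * R 0 0) = 0 := by
      rw [Matrix.det_fin_two] at hS
      simp only [Matrix.sub_apply, Matrix.of_apply, Matrix.cons_val', Matrix.cons_val_zero,
        Matrix.cons_val_one, Matrix.cons_val_fin_one, h11] at hS
      linarith
    linarith [(mul_eq_zero.1 h2).resolve_left hr.ne']
  obtain ⟨k, hk, hlt⟩ := exists_abs_sq_mul_sub_lt (h := R 0 0) (b := R 0 1) (c := R 1 0)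
    (by linarith) (by linarith)
  obtain ⟨g, hg⟩ := exists_conj_offdiag_eq hk
  have hbal : |(k ^ 2 * R 0 1 - R 1 0) / (2 * k)| < R 0 0 := by
    rwa [abs_div, abs_of_pos (by positivity : 0 < 2 * k), div_lt_iff₀' (by positivity)]
  obtain ⟨hlt1, hlt2⟩ := abs_lt.1 hbal
  have hdiag : (!![r, 0; 0, -r] : Mat2).trace = 0 := by simp
  obtain ⟨hR01, hR10⟩ := hg R htR
  obtain ⟨hD01, hD10⟩ := hg _ hdiag
  refine ⟨g, ⟨?_, ?_⟩, ?_, ?_⟩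
  · linarith
  · linarith
  all_goals
    rw [mul_sub, sub_mul, Matrix.sub_apply]
    simp only [Matrix.of_apply, Matrix.cons_val', Matrix.cons_val_zero, Matrix.cons_val_one,
      Matrix.cons_val_fin_one, mul_zero, sub_zero, zero_div, add_zero] at hD01 hD10
    linarith

/-- The hypothesis on the trace says that the axes of the involutions `R` and `S` are not
opposed. -/
theorem exists_conj_offDiagPos {R S : Mat2} (htR : R.trace = 0) (htS : S.trace = 0)
    (hR : R.det = -1) (hS : S.det = -1) (hRS : -2 < (R * S).trace) :
    ∃ g : SL(2, ℝ), OffDiagPos (g.1 * R * (g⁻¹).1) ∧ OffDiagPos (g.1 * S * (g⁻¹).1) := by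
  have hr : 0 < 2 + (R * S).trace := by linarith
  have hdet : (R + S).det = -√(2 + (R * S).trace) ^ 2 := by
    rw [Real.sq_sqrt hr.le]
    simp only [Matrix.det_fin_two, Matrix.trace_fin_two, Matrix.add_apply, Matrix.mul_apply,
      Fin.sum_univ_two] at *
    linear_combination hR + hS + (S 0 0 + S 1 1) * htR
  obtain ⟨g, hg⟩ := exists_conj_eq_diagonal (Real.sqrt_pos.2 hr)
    (by rw [Matrix.trace_add, htR, htS, add_zero]) hdet
  rw [mul_add, add_mul] at hg
  obtain ⟨g', hR', hS'⟩ := exists_conj_offDiagPos_of_add_eq_diagonal (Real.sqrt_pos.2 hr)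
    ((trace_conj g R).trans htR) ((det_conj g R).trans hR) ((det_conj g S).trans hS) hg
  refine ⟨g' * g, ?_⟩
  simp only [mul_inv_rev, Matrix.SpecialLinearGroup.coe_mul, mul_assoc] at hR' hS' ⊢
  exact ⟨hR', hS'⟩

/-- Both matrices have positive entries. -/
def PositivePair (p : SL(2, ℝ) × SL(2, ℝ)) : Prop :=
  (∀ i j, 0 < p.1.1 i j) ∧ ∀ i j, 0 < p.2.1 i j

/-- The pairs with traces larger than two whose axes are not opposed. -/
def principalSet : Set (SL(2, ℝ) × SL(2, ℝ)) :=
  {p | 2 < trA p ∧ 2 < trB p ∧ (trComm p < 2 ∨ trA p * trB p < 2 * trAB p)}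

section PositivePair

variable {p : SL(2, ℝ) × SL(2, ℝ)}

lemma trA_eq (p : SL(2, ℝ) × SL(2, ℝ)) : trA p = p.1.1 0 0 + p.1.1 1 1 := Matrix.trace_fin_two _

lemma trB_eq (p : SL(2, ℝ) × SL(2, ℝ)) : trB p = p.2.1 0 0 + p.2.1 1 1 := Matrix.trace_fin_two _

lemma trAB_eq (p : SL(2, ℝ) × SL(2, ℝ)) : trAB p = p.1.1 0 0 * p.2.1 0 0 + p.1.1 0 1 * p.2.1 1 0 +
    p.1.1 1 0 * p.2.1 0 1 + p.1.1 1 1 * p.2.1 1 1 := by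
  rw [trAB, Matrix.trace_fin_two, Matrix.SpecialLinearGroup.coe_mul]
  simp only [Matrix.mul_apply, Fin.sum_univ_two]
  ring

lemma four_mul_trComm_sub (p : SL(2, ℝ) × SL(2, ℝ)) :
    4 * (trComm p - 2) = (2 * trAB p - trA p * trB p) ^ 2 - (trA p ^ 2 - 4) * (trB p ^ 2 - 4) := by
  rw [trComm]; ring

lemma neg_mul_sqrt_lt_of_mem_principalSet (hp : p ∈ principalSet) :
    -(√(trA p ^ 2 - 4) * √(trB p ^ 2 - 4)) < 2 * trAB p - trA p * trB p := by
  obtain ⟨hx, hy, hz⟩ := hp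
  have hx4 : 0 < trA p ^ 2 - 4 := by nlinarith
  have hy4 : 0 < trB p ^ 2 - 4 := by nlinarith
  rcases hz with hz | hz
  · refine (abs_lt.1 (abs_lt_of_sq_lt_sq ?_ (by positivity))).1
    rw [mul_pow, Real.sq_sqrt hx4.le, Real.sq_sqrt hy4.le]
    linarith [four_mul_trComm_sub p]
  · have : 0 ≤ √(trA p ^ 2 - 4) * √(trB p ^ 2 - 4) := by positivity
    linarith

lemma pos_of_offDiagPos {A : SL(2, ℝ)} (ht : 0 < A.1.trace) (h : OffDiagPos A.1) :
    ∀ i j, 0 < A.1 i j := by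
  have h1 : 0 < A.1 0 0 * A.1 1 1 := by linarith [det_eq_one A, mul_pos h.1 h.2]
  rw [Matrix.trace_fin_two] at ht
  rcases pos_and_pos_or_neg_and_neg_of_mul_pos h1 with ⟨h00, h11⟩ | ⟨h00, h11⟩
  · intro i j
    fin_cases i <;> fin_cases j
    exacts [h00, h.1, h.2, h11]
  · linarith

lemma exists_eq_smul_one_add_smul {A : SL(2, ℝ)} (ht : 2 < A.1.trace) :
    ∃ R : Mat2, R.trace = 0 ∧ R.det = -1 ∧
      A.1 = (A.1.trace / 2) • (1 : Mat2) + (√(A.1.trace ^ 2 - 4) / 2) • R := by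
  have ht4 : 0 < A.1.trace ^ 2 - 4 := by nlinarith
  set s := √(A.1.trace ^ 2 - 4)
  have hs0 : 0 < s := Real.sqrt_pos.2 ht4
  have hs2 : s ^ 2 = A.1.trace ^ 2 - 4 := Real.sq_sqrt ht4.le
  refine ⟨(2 / s) • (A.1 - (A.1.trace / 2) • (1 : Mat2)), ?_, ?_, ?_⟩
  · simp
  · rw [Matrix.det_smul, Fintype.card_fin, div_pow, hs2, div_mul_eq_mul_div, div_eq_iff ht4.ne']
    simp only [Matrix.det_fin_two, Matrix.trace_fin_two, Matrix.sub_apply, Matrix.smul_apply,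
      Matrix.one_apply_eq, ne_eq, zero_ne_one, one_ne_zero, not_false_eq_true, Matrix.one_apply_ne,
      smul_eq_mul]
    linear_combination 4 * det_eq_one A
  · rw [smul_smul, div_mul_div_cancel₀ two_ne_zero, div_self hs0.ne', one_smul]
    abel

lemma conj_pos {A g : SL(2, ℝ)} {R : Mat2} {t s : ℝ} (hA : A.1 = t • (1 : Mat2) + s • R)
    (hs : 0 < s) (ht : 0 < A.1.trace) (hR : OffDiagPos (g.1 * R * (g⁻¹).1)) :
    ∀ i j, 0 < (g * A * g⁻¹).1 i j := by
  have hconj : (g * A * g⁻¹).1 = t • (1 : Mat2) + s • (g.1 * R * (g⁻¹).1) := by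
    rw [Matrix.SpecialLinearGroup.coe_mul, Matrix.SpecialLinearGroup.coe_mul, hA, mul_add, add_mul,
      mul_smul_comm, smul_mul_assoc, mul_one, coe_mul_coe_inv, mul_smul_comm, smul_mul_assoc]
  refine pos_of_offDiagPos (ht.trans_eq (trace_conj g A.1).symm) ?_
  rw [hconj]
  exact ⟨by simpa using mul_pos hs hR.1, by simpa using mul_pos hs hR.2⟩

theorem exists_positivePair_conjPair (hp : p ∈ principalSet) :
    ∃ g, PositivePair (conjPair g p) := by
  have hmain := neg_mul_sqrt_lt_of_mem_principalSet hp
  obtain ⟨hx, hy, -⟩ := hp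
  have hα : 0 < √(trA p ^ 2 - 4) := Real.sqrt_pos.2 (by nlinarith)
  have hβ : 0 < √(trB p ^ 2 - 4) := Real.sqrt_pos.2 (by nlinarith)
  obtain ⟨R, htR, hdR, hA⟩ := exists_eq_smul_one_add_smul hx
  obtain ⟨S, htS, hdS, hB⟩ := exists_eq_smul_one_add_smul hy
  have htr : 2 * trAB p - trA p * trB p =
      √(trA p ^ 2 - 4) * √(trB p ^ 2 - 4) * ((R * S).trace / 2) := by
    rw [trAB, Matrix.SpecialLinearGroup.coe_mul, hA, hB]
    simp only [mul_add, add_mul, Matrix.trace_add, smul_mul_assoc, mul_smul_comm, one_mul, mul_one,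
      Matrix.trace_smul, htR, htS, Matrix.trace_one, smul_eq_mul]
    simp only [trA, trB, Fintype.card_fin]
    ring
  have hRS : -2 < (R * S).trace := by
    rw [htr, ← mul_neg_one] at hmain
    linarith [lt_of_mul_lt_mul_left hmain (by positivity)]
  obtain ⟨g, hgR, hgS⟩ := exists_conj_offDiagPos htR htS hdR hdS hRS
  exact ⟨g, conj_pos hA (half_pos hα) (two_pos.trans hx) hgR,
    conj_pos hB (half_pos hβ) (two_pos.trans hy) hgS⟩

lemma two_lt_trace_of_pos {A : SL(2, ℝ)} (h : ∀ i j, 0 < A.1 i j) : 2 < A.1.trace := by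
  rw [Matrix.trace_fin_two]
  refine lt_of_pow_lt_pow_left₀ 2 (add_pos (h 0 0) (h 1 1)).le ?_
  linarith [det_eq_one A, mul_pos (h 0 1) (h 1 0), sq_nonneg (A.1 0 0 - A.1 1 1)]

theorem PositivePair.mem_principalSet (h : PositivePair p) : p ∈ principalSet := by
  refine ⟨two_lt_trace_of_pos h.1, two_lt_trace_of_pos h.2, ?_⟩
  by_contra! ⟨hcomm, hAB⟩
  obtain ⟨hA, hB⟩ := h
  set u := p.1.1 0 0 - p.1.1 1 1 with hu
  set v := p.2.1 0 0 - p.2.1 1 1 with hv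
  set β := p.1.1 0 1 * p.1.1 1 0 with hβ
  set γ := p.2.1 0 1 * p.2.1 1 0 with hγ
  set s := p.1.1 0 1 * p.2.1 1 0 + p.1.1 1 0 * p.2.1 0 1 with hs
  have hβ0 : 0 < β := mul_pos (hA 0 1) (hA 1 0)
  have hγ0 : 0 < γ := mul_pos (hB 0 1) (hB 1 0)
  have hs0 : 0 < s := add_pos (mul_pos (hA 0 1) (hB 1 0)) (mul_pos (hA 1 0) (hB 0 1))
  have hxy : 2 * trAB p - trA p * trB p = u * v + 2 * s := by
    rw [trAB_eq, trA_eq, trB_eq, hu, hv, hs]; ring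
  have hx : trA p ^ 2 - 4 = u ^ 2 + 4 * β := by
    rw [trA_eq, hu, hβ]; linear_combination 4 * det_eq_one p.1
  have hy : trB p ^ 2 - 4 = v ^ 2 + 4 * γ := by
    rw [trB_eq, hv, hγ]; linear_combination 4 * det_eq_one p.2
  have hcomm' := four_mul_trComm_sub p
  rw [hxy, hx, hy] at hcomm'
  have hle : u ^ 2 * γ + v ^ 2 * β + 4 * (β * γ) ≤ (u * v + s) * s := by linarith
  have hneg : (u * v + s) * s ≤ 0 := mul_nonpos_of_nonpos_of_nonneg (by linarith) hs0.le
  have hpos : 0 < u ^ 2 * γ + v ^ 2 * β + 4 * (β * γ) := by positivity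
  exact (hle.trans hneg).not_gt hpos

lemma principalSet_eq : principalSet = {p | ∃ g, PositivePair (conjPair g p)} := by
  ext p
  refine ⟨exists_positivePair_conjPair, fun ⟨g, hg⟩ => ?_⟩
  have h := hg.mem_principalSet
  rw [principalSet, Set.mem_ofPred, trA_conjPair, trB_conjPair, trAB_conjPair,
    trComm_conjPair] at h
  exact h

lemma PositivePair.letter_pos (h : PositivePair p) (a i j : Fin 2) : 0 < (letter p a).1 i j := by
  fin_cases a
  exacts [h.1 i j, h.2 i j]

lemma mulVec_apply_mul_mulVec_apply (A : SL(2, ℝ)) (u : Fin 2 → ℝ) :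
    (A.1 *ᵥ u) 0 * (A.1 *ᵥ u) 1 = A.1 0 0 * A.1 1 0 * u 0 ^ 2 + A.1 0 1 * A.1 1 1 * u 1 ^ 2 +
      (1 + 2 * (A.1 0 1 * A.1 1 0)) * (u 0 * u 1) := by
  simp only [Matrix.mulVec, dotProduct, Fin.sum_univ_two]
  linear_combination (u 0 * u 1) * det_eq_one A

lemma mulVec_apply_pos {A : SL(2, ℝ)} (hA : ∀ i j, 0 < A.1 i j) {u : Fin 2 → ℝ}
    (hu : ∀ i, 0 < u i) (i : Fin 2) : 0 < (A.1 *ᵥ u) i :=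
  Finset.sum_pos (fun j _ => mul_pos (hA i j) (hu j)) Finset.univ_nonempty

lemma PositivePair.prod_letter_mulVec_pos (h : PositivePair p) (w : List (Fin 2)) (i : Fin 2) :
    0 < ((w.map (letter p)).prod.1 *ᵥ 1) i := by
  induction w generalizing i with
  | nil => simp
  | cons a w ih =>
    rw [List.map_cons, List.prod_cons, coe_mul_mulVec]
    exact mulVec_apply_pos (h.letter_pos a) ih i

lemma PositivePair.pow_length_le (h : PositivePair p) {m : ℝ}
    (hm : ∀ a, m ≤ (letter p a).1 0 1 * (letter p a).1 1 0) (hm0 : 0 ≤ m) (w : List (Fin 2)) :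
    (1 + 2 * m) ^ w.length ≤ ((w.map (letter p)).prod.1 *ᵥ 1) 0 *
      ((w.map (letter p)).prod.1 *ᵥ 1) 1 := by
  induction w with
  | nil => simp
  | cons a w ih =>
    have hu := h.prod_letter_mulVec_pos w
    rw [List.map_cons, List.prod_cons, coe_mul_mulVec, List.length_cons, pow_succ']
    set u := (w.map (letter p)).prod.1 *ᵥ 1
    have ha := h.letter_pos a
    have h0 := mul_nonneg (mul_pos (ha 0 0) (ha 1 0)).le (sq_nonneg (u 0))
    have h1 := mul_nonneg (mul_pos (ha 0 1) (ha 1 1)).le (sq_nonneg (u 1))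
    have hma := hm a
    calc (1 + 2 * m) * (1 + 2 * m) ^ w.length
      _ ≤ (1 + 2 * ((letter p a).1 0 1 * (letter p a).1 1 0)) * (u 0 * u 1) :=
          mul_le_mul (by linarith) ih (by positivity) (by linarith)
      _ ≤ _ := by rw [mulVec_apply_mul_mulVec_apply (letter p a) u]; linarith

theorem PositivePair.hasGrowth (h : PositivePair p) : HasGrowth p := by
  obtain ⟨m, hm0, hm⟩ : ∃ m > 0, ∀ a, m ≤ (letter p a).1 0 1 * (letter p a).1 1 0 := by
    refine ⟨_, lt_min (mul_pos (h.1 0 1) (h.1 1 0)) (mul_pos (h.2 0 1) (h.2 1 0)), fun a => ?_⟩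
    fin_cases a
    exacts [min_le_left _ _, min_le_right _ _]
  refine ⟨1 / 2, √(1 + 2 * m), by norm_num, Real.lt_sqrt_of_sq_lt (by linarith), fun w => ?_⟩
  set M := (w.map (letter p)).prod
  have hle : ∀ i, (M.1 *ᵥ 1) i ≤ 2 * ‖M.1‖ := fun i =>
    calc (M.1 *ᵥ 1) i ≤ ‖M.1 *ᵥ 1‖ := (le_abs_self _).trans (norm_le_pi_norm (M.1 *ᵥ 1) i)
      _ ≤ 2 * ‖M.1‖ := by simpa using norm_mulVec_le M.1 1
  have hsq : (√(1 + 2 * m) ^ w.length) ^ 2 ≤ (2 * ‖M.1‖) ^ 2 := by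
    rw [pow_right_comm, Real.sq_sqrt (by positivity), sq]
    exact (h.pow_length_le hm hm0.le w).trans
      (mul_le_mul (hle 0) (hle 1) (h.prod_letter_mulVec_pos w 1).le (by positivity))
  linarith [le_of_sq_le_sq hsq (by positivity)]

lemma principalSet_subset_hypLocus : principalSet ⊆ hypLocus := fun _ hp =>
  (exists_positivePair_conjPair hp).elim fun _ hg => hg.hasGrowth.of_conjPair.mem_hypLocus

end PositivePair

/-! ### Interval multicones -/

section Quadrant

/-- The product of the two coordinates of `g v`; its sign tells whether the direction of `v` lies in
the image of the first quadrant under `g⁻¹`. -/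
noncomputable def coordProd (g : SL(2, ℝ)) (v : Fin 2 → ℝ) : ℝ := (g.1 *ᵥ v) 0 * (g.1 *ᵥ v) 1

/-- The interval of directions in the image of the open first quadrant under `g⁻¹`. -/
def openQuadrant (g : SL(2, ℝ)) : Set P1 := {d | ∀ v ∈ d.submodule, v ≠ 0 → 0 < coordProd g v}

/-- The interval of directions in the image of the closed first quadrant under `g⁻¹`. -/
def closedQuadrant (g : SL(2, ℝ)) : Set P1 := {d | ∀ v ∈ d.submodule, v ≠ 0 → 0 ≤ coordProd g v}

variable {g A : SL(2, ℝ)} {v : Fin 2 → ℝ}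

lemma coordProd_smul (g : SL(2, ℝ)) (c : ℝ) (v : Fin 2 → ℝ) :
    coordProd g (c • v) = c ^ 2 * coordProd g v := by
  simp only [coordProd, Matrix.mulVec_smul, Pi.smul_apply, smul_eq_mul]
  ring

lemma coordProd_mul (g h : SL(2, ℝ)) (v : Fin 2 → ℝ) :
    coordProd (g * h) v = coordProd g (h.1 *ᵥ v) := by
  rw [coordProd, coordProd, coe_mul_mulVec]

lemma continuous_coordProd (g : SL(2, ℝ)) : Continuous (coordProd g) := by
  unfold coordProd
  fun_prop

lemma mk_mem_openQuadrant (hv : v ≠ 0) :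
    Projectivization.mk ℝ v hv ∈ openQuadrant g ↔ 0 < coordProd g v := by
  refine ⟨fun h => h v ((mem_submodule_mk hv).2 ⟨1, one_smul _ _⟩) hv, fun h w hw hw0 => ?_⟩
  obtain ⟨c, rfl⟩ := (mem_submodule_mk hv).1 hw
  have hc : c ≠ 0 := left_ne_zero_of_smul hw0
  rw [coordProd_smul]
  positivity

lemma mk_mem_closedQuadrant (hv : v ≠ 0) :
    Projectivization.mk ℝ v hv ∈ closedQuadrant g ↔ 0 ≤ coordProd g v := by
  refine ⟨fun h => h v ((mem_submodule_mk hv).2 ⟨1, one_smul _ _⟩) hv, fun h w hw _ => ?_⟩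
  obtain ⟨c, rfl⟩ := (mem_submodule_mk hv).1 hw
  rw [coordProd_smul]
  positivity

lemma isOpen_openQuadrant (g : SL(2, ℝ)) : IsOpen (openQuadrant g) := by
  have h : Projectivization.mk' ℝ ⁻¹' openQuadrant g =
      {v : {v : Fin 2 → ℝ // v ≠ 0} | 0 < coordProd g v.1} :=
    Set.ext fun v => mk_mem_openQuadrant v.2
  rw [isOpen_coinduced, h]
  exact isOpen_lt continuous_const ((continuous_coordProd g).comp continuous_subtype_val)

lemma isClosed_closedQuadrant (g : SL(2, ℝ)) : IsClosed (closedQuadrant g) := by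
  have h : Projectivization.mk' ℝ ⁻¹' closedQuadrant g =
      {v : {v : Fin 2 → ℝ // v ≠ 0} | 0 ≤ coordProd g v.1} :=
    Set.ext fun v => mk_mem_closedQuadrant v.2
  rw [isClosed_coinduced, h]
  exact isClosed_le continuous_const ((continuous_coordProd g).comp continuous_subtype_val)

lemma openQuadrant_subset_closedQuadrant (g : SL(2, ℝ)) : openQuadrant g ⊆ closedQuadrant g :=
  fun _ hd v hv hv0 => (hd v hv hv0).le

lemma vec_one_ne_zero (s : ℝ) : (![1, s] : Fin 2 → ℝ) ≠ 0 := fun h => one_ne_zero (congrFun h 0)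

/-- The direction of `g⁻¹ (1, s)`. -/
noncomputable def slopePt (g : SL(2, ℝ)) (s : ℝ) : P1 :=
  Projectivization.mk' ℝ ⟨(g⁻¹).1 *ᵥ ![1, s], mulVec_ne_zero _ (vec_one_ne_zero s)⟩

lemma coordProd_inv_mulVec (g : SL(2, ℝ)) (s : ℝ) :
    coordProd g ((g⁻¹).1 *ᵥ ![1, s]) = s := by
  rw [← coordProd_mul, mul_inv_cancel]
  simp [coordProd]

lemma slopePt_mem_openQuadrant {s : ℝ} : slopePt g s ∈ openQuadrant g ↔ 0 < s :=
  (mk_mem_openQuadrant _).trans (by rw [coordProd_inv_mulVec])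

lemma slopePt_mem_closedQuadrant {s : ℝ} : slopePt g s ∈ closedQuadrant g ↔ 0 ≤ s :=
  (mk_mem_closedQuadrant _).trans (by rw [coordProd_inv_mulVec])

lemma continuous_slopePt (g : SL(2, ℝ)) : Continuous (slopePt g) :=
  continuous_mk'.comp (Continuous.subtype_mk (by fun_prop) _)

lemma openQuadrant_eq_image (g : SL(2, ℝ)) : openQuadrant g = slopePt g '' Ioi 0 := by
  refine Subset.antisymm (fun d hd => ?_) (image_subset_iff.2 fun s => slopePt_mem_openQuadrant.2)
  induction d using Projectivization.ind with
  | h v hv =>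
    have h := (mk_mem_openQuadrant hv).1 hd
    have h0 : (g.1 *ᵥ v) 0 ≠ 0 := left_ne_zero_of_mul h.ne'
    have hdiv : ![1, (g.1 *ᵥ v) 1 / (g.1 *ᵥ v) 0] = ((g.1 *ᵥ v) 0)⁻¹ • (g.1 *ᵥ v) := by
      ext i
      fin_cases i
      exacts [(inv_mul_cancel₀ h0).symm, div_eq_inv_mul _ _]
    refine ⟨(g.1 *ᵥ v) 1 / (g.1 *ᵥ v) 0, ?_, ?_⟩
    · rw [mem_Ioi, ← mul_div_mul_left _ _ h0]
      exact div_pos h (mul_self_pos.2 h0)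
    · refine (Projectivization.mk_eq_mk_iff' _ _ _ _ _).2 ⟨((g.1 *ᵥ v) 0)⁻¹, ?_⟩
      rw [hdiv, Matrix.mulVec_smul, Matrix.mulVec_mulVec, coe_inv_mul_coe, Matrix.one_mulVec]

lemma isConnected_openQuadrant (g : SL(2, ℝ)) : IsConnected (openQuadrant g) := by
  rw [openQuadrant_eq_image]
  exact isConnected_Ioi.image _ (continuous_slopePt g).continuousOn

lemma slopePt_neg_one_notMem_closedQuadrant (g : SL(2, ℝ)) : slopePt g (-1) ∉ closedQuadrant g := by
  rw [slopePt_mem_closedQuadrant]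
  norm_num

lemma isOpenInterval_openQuadrant (g : SL(2, ℝ)) : IsOpenInterval (openQuadrant g) := by
  have h1 := slopePt_neg_one_notMem_closedQuadrant g
  refine ⟨isOpen_openQuadrant g, isConnected_openQuadrant g, slopePt g 0, ?_, slopePt g (-1), ?_,
    fun h => h1 (h ▸ slopePt_mem_closedQuadrant.2 le_rfl)⟩
  · rw [mem_compl_iff, slopePt_mem_openQuadrant]
    exact lt_irrefl _
  · exact fun h => h1 (openQuadrant_subset_closedQuadrant g h)

lemma componentsOf_of_isConnected {X : Type*} [TopologicalSpace X] {S : Set X}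
    (h : IsConnected S) : componentsOf S = {S} := by
  ext C
  constructor
  · rintro ⟨x, hx, rfl⟩
    exact h.isPreconnected.connectedComponentIn hx
  · rintro rfl
    obtain ⟨x, hx⟩ := h.nonempty
    exact ⟨x, hx, (h.isPreconnected.connectedComponentIn hx).symm⟩

lemma coordProd_pos (hA : ∀ i j, 0 < A.1 i j) (hv : v ≠ 0) (h : 0 ≤ coordProd 1 v) :
    0 < coordProd A v := by
  have h01 := mul_pos (hA 0 1) (hA 1 0)
  have hsq : 0 < A.1 0 0 * A.1 1 0 * v 0 ^ 2 + A.1 0 1 * A.1 1 1 * v 1 ^ 2 := by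
    have h0 := mul_pos (hA 0 0) (hA 1 0)
    have h1 := mul_pos (hA 0 1) (hA 1 1)
    by_cases hv0 : v 0 = 0
    · have hv1 : v 1 ≠ 0 := fun hv1 => hv (List.ofFn_inj.1 (by simp [hv0, hv1]))
      positivity
    · positivity
  have hv01 : 0 ≤ v 0 * v 1 := by simpa [coordProd] using h
  rw [coordProd, mulVec_apply_mul_mulVec_apply]
  positivity

lemma closedQuadrant_mul_inv_subset (h : ∀ i j, 0 < (g * A * g⁻¹).1 i j) :
    closedQuadrant (g * A⁻¹) ⊆ openQuadrant g := by
  intro d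
  induction d using Projectivization.ind with
  | h v hv =>
    rw [mk_mem_closedQuadrant, mk_mem_openQuadrant, ← one_mul (g * A⁻¹), coordProd_mul]
    intro hd
    have hpos := coordProd_pos h (mulVec_ne_zero _ hv) hd
    rwa [← coordProd_mul, ← mul_assoc, inv_mul_cancel_right, mul_inv_cancel_right] at hpos

lemma smul_mem_closedQuadrant {d : P1} (h : d ∈ openQuadrant g) :
    A • d ∈ closedQuadrant (g * A⁻¹) := by
  induction d using Projectivization.ind with
  | h v hv =>
    rw [smul_mk_eq, mk_mem_closedQuadrant, ← coordProd_mul, inv_mul_cancel_right]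
    exact ((mk_mem_openQuadrant hv).1 h).le

lemma isMulticone_openQuadrant {p : SL(2, ℝ) × SL(2, ℝ)} (h : PositivePair (conjPair g p)) :
    IsMulticone p (openQuadrant g) where
  nonempty := (isConnected_openQuadrant g).nonempty
  isOpen := isOpen_openQuadrant g
  closure_ne_univ hu := slopePt_neg_one_notMem_closedQuadrant g <|
    closure_minimal (openQuadrant_subset_closedQuadrant g) (isClosed_closedQuadrant g)
      (hu ▸ mem_univ _)
  closure_image_subset i := by
    have hpos := h.letter_pos i
    rw [letter_conjPair] at hpos
    rw [(isOpen_openQuadrant g).interior_eq]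
    exact (closure_minimal (image_subset_iff.2 fun d hd => smul_mem_closedQuadrant hd)
      (isClosed_closedQuadrant (g * (letter p i)⁻¹))).trans (closedQuadrant_mul_inv_subset hpos)
  finite_components := by
    rw [componentsOf_of_isConnected (isConnected_openQuadrant g)]
    exact finite_singleton _
  disjoint_closures := by
    rw [componentsOf_of_isConnected (isConnected_openQuadrant g)]
    exact pairwiseDisjoint_singleton _ _

end Quadrant

/-! ### Connectedness -/

lemma continuous_of_continuous_coe_apply {X : Type*} [TopologicalSpace X] {f : X → SL(2, ℝ)}
    (h : ∀ i j, Continuous fun x => (f x).1 i j) : Continuous f :=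
  continuous_induced_rng.2 (continuous_matrix h)

lemma joined_one (A : SL(2, ℝ)) : Joined 1 A := by
  induction A using Matrix.SL2.transvection_induction with
  | htransvec i j h c =>
    have hcont : Continuous fun b : ℝ => Matrix.SpecialLinearGroup.transvection h b :=
      continuous_of_continuous_coe_apply fun k l => by
        simp only [Matrix.SpecialLinearGroup.transvection_coe, Matrix.add_apply,
          Matrix.single_apply]
        split_ifs <;> fun_prop
    simpa only [Matrix.SpecialLinearGroup.transvection_coeff_zero] using
      (PathConnectedSpace.joined (0 : ℝ) c).map hcont
  | hmul A B hA hB => simpa only [mul_one] using hA.mul hB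

instance : PathConnectedSpace SL(2, ℝ) where
  nonempty := ⟨1⟩
  joined A B := (joined_one A).symm.trans (joined_one B)

lemma isConnected_pos : IsConnected {A : SL(2, ℝ) | ∀ i j, 0 < A.1 i j} := by
  let F : Ioi (0 : ℝ) × Ioi (0 : ℝ) × Ioi (0 : ℝ) → SL(2, ℝ) := fun q =>
    ⟨!![q.1.1, q.2.1.1; q.2.2.1, (1 + q.2.1.1 * q.2.2.1) / q.1.1], by
      rw [Matrix.det_fin_two_of, mul_div_cancel₀ _ (mem_Ioi.1 q.1.2).ne', add_sub_cancel_right]⟩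
  have hF : Continuous F := continuous_of_continuous_coe_apply fun i j => by
    fin_cases i <;> fin_cases j
    · exact continuous_subtype_val.comp continuous_fst
    · exact continuous_subtype_val.comp (continuous_fst.comp continuous_snd)
    · exact continuous_subtype_val.comp (continuous_snd.comp continuous_snd)
    · exact Continuous.div (by fun_prop) (by fun_prop) fun q => (mem_Ioi.1 q.1.2).ne'
  have hrange : {A : SL(2, ℝ) | ∀ i j, 0 < A.1 i j} = range F := by
    ext A
    constructor
    · intro h
      refine ⟨(⟨A.1 0 0, h 0 0⟩, ⟨A.1 0 1, h 0 1⟩, ⟨A.1 1 0, h 1 0⟩), ?_⟩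
      ext i j
      fin_cases i <;> fin_cases j
      exacts [rfl, rfl, rfl, (div_eq_iff (h 0 0).ne').2
        (show 1 + A.1 0 1 * A.1 1 0 = A.1 1 1 * A.1 0 0 by linarith [det_eq_one A])]
    · rintro ⟨⟨⟨a, ha⟩, ⟨b, hb⟩, ⟨c, hc⟩⟩, rfl⟩ i j
      rw [mem_Ioi] at ha hb hc
      fin_cases i <;> fin_cases j
      exacts [ha, hb, hc, div_pos (by positivity) ha]
  have : ConnectedSpace (Ioi (0 : ℝ)) := Subtype.connectedSpace isConnected_Ioi
  rw [hrange]
  exact isConnected_range hF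

lemma isConnected_principalSet : IsConnected principalSet := by
  have himage : principalSet = (fun q : SL(2, ℝ) × (SL(2, ℝ) × SL(2, ℝ)) => conjPair q.1 q.2) ''
      (univ ×ˢ ({A : SL(2, ℝ) | ∀ i j, 0 < A.1 i j} ×ˢ {A : SL(2, ℝ) | ∀ i j, 0 < A.1 i j})) := by
    rw [principalSet_eq]
    ext p
    constructor
    · rintro ⟨g, h1, h2⟩
      exact ⟨(g⁻¹, conjPair g p), ⟨mem_univ _, h1, h2⟩,
        (conjPair_conjPair _ _ _).trans (by rw [inv_mul_cancel, conjPair_one])⟩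
    · rintro ⟨⟨g, q⟩, ⟨-, hq⟩, rfl⟩
      refine ⟨g⁻¹, ?_⟩
      rw [conjPair_conjPair, inv_mul_cancel, conjPair_one]
      exact hq
  rw [himage]
  refine (isConnected_univ.prod (isConnected_pos.prod isConnected_pos)).image _
    (Continuous.continuousOn ?_)
  unfold conjPair
  fun_prop

/-! ### Growth in reflection groups -/

section Reflections

variable {ι : Type*}

/-- The coefficient vector `c` is nonnegative, with largest coefficient the `i`-th one, which is
at least `m`. -/
structure Dominated (i : ι) (c : ι → ℝ) (m : ℝ) : Prop where
  le_apply : m ≤ c i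
  nonneg : ∀ j, 0 ≤ c j
  apply_le : ∀ j, c j ≤ c i

lemma dominated_one (i : ι) : Dominated i 1 1 := ⟨le_rfl, fun _ => zero_le_one, fun _ => le_rfl⟩

lemma Dominated.mono {i : ι} {c : ι → ℝ} {m m' : ℝ} (h : Dominated i c m) (hm : m' ≤ m) :
    Dominated i c m' := ⟨hm.trans h.le_apply, h.nonneg, h.apply_le⟩

/-- Gram matrices of the unit normals of pairwise ultraparallel lines in the hyperbolic plane,
with a quantitative gap `ε`. -/
structure IsUltraparallelGram (g : Matrix ι ι ℝ) (ε : ℝ) : Prop where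
  pos : 0 < ε
  diag : ∀ i, g i i = 1
  offDiag_le : ∀ i j, i ≠ j → g i j ≤ -(1 + ε)

variable {g : Matrix ι ι ℝ} {ε : ℝ} {i j : ι} {c : ι → ℝ} {m : ℝ}

lemma IsUltraparallelGram.le_mul (hg : IsUltraparallelGram g ε) (hm : 0 ≤ m) :
    m ≤ (1 + 2 * ε) * m :=
  le_mul_of_one_le_left hm (by linarith [hg.pos])

lemma Dominated.mulVec_le [Fintype ι] (hg : IsUltraparallelGram g ε) (h : Dominated i c m)
    (hij : i ≠ j) : (g *ᵥ c) j ≤ c j - (1 + ε) * c i := by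
  classical
  have hoff : ∑ k ∈ Finset.univ.erase j, g j k * c k ≤ -(1 + ε) * c i := by
    have hle : ∀ k ∈ Finset.univ.erase j, g j k * c k ≤ -(1 + ε) * c k := fun k hk =>
      mul_le_mul_of_nonneg_right (hg.offDiag_le j k (Finset.ne_of_mem_erase hk).symm) (h.nonneg k)
    refine (Finset.sum_le_sum hle).trans ?_
    rw [← Finset.mul_sum]
    exact mul_le_mul_of_nonpos_left
      (Finset.single_le_sum (fun k _ => h.nonneg k) (Finset.mem_erase.2 ⟨hij, Finset.mem_univ i⟩))
      (by linarith [hg.pos])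
  rw [Matrix.mulVec, dotProduct, ← Finset.add_sum_erase _ _ (Finset.mem_univ j), hg.diag, one_mul]
  linarith

variable [Fintype ι] [DecidableEq ι]

/-- The action on coefficient vectors of the reflection in the `i`-th of a family of unit vectors
with Gram matrix `g`. -/
def reflCoeff (g : Matrix ι ι ℝ) (i : ι) (c : ι → ℝ) : ι → ℝ :=
  c - Pi.single i (2 * (g *ᵥ c) i)

lemma reflCoeff_apply_self (g : Matrix ι ι ℝ) (i : ι) (c : ι → ℝ) :
    reflCoeff g i c i = c i - 2 * (g *ᵥ c) i := by
  rw [reflCoeff, Pi.sub_apply, Pi.single_eq_same]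

lemma reflCoeff_apply_of_ne (g : Matrix ι ι ℝ) {i j : ι} (h : j ≠ i) (c : ι → ℝ) :
    reflCoeff g i c j = c j := by
  rw [reflCoeff, Pi.sub_apply, Pi.single_eq_of_ne h, sub_zero]

lemma reflCoeff_reflCoeff {g : Matrix ι ι ℝ} {i : ι} (hg : g i i = 1) (c : ι → ℝ) :
    reflCoeff g i (reflCoeff g i c) = c := by
  have h : (g *ᵥ reflCoeff g i c) i = -(g *ᵥ c) i := by
    rw [reflCoeff, Matrix.mulVec_sub, Pi.sub_apply, Matrix.mulVec_single]
    simp only [Pi.smul_apply, Matrix.col_apply, MulOpposite.smul_eq_mul_unop,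
      MulOpposite.unop_op, hg]
    ring
  rw [reflCoeff, h, reflCoeff, mul_neg, Pi.single_neg, sub_neg_eq_add, sub_add_cancel]

lemma Dominated.reflCoeff (hg : IsUltraparallelGram g ε) (h : Dominated i c m) (hij : i ≠ j) :
    Dominated j (reflCoeff g j c) ((1 + 2 * ε) * m) := by
  have hε := hg.pos
  have hnew : (1 + 2 * ε) * c i ≤ FullTwoShift.reflCoeff g j c j := by
    rw [reflCoeff_apply_self]
    linarith [h.mulVec_le hg hij, h.apply_le j]
  have hle : c i ≤ FullTwoShift.reflCoeff g j c j :=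
    (le_mul_of_one_le_left (h.nonneg i) (by linarith)).trans hnew
  refine ⟨(mul_le_mul_of_nonneg_left h.le_apply (by positivity)).trans hnew, fun k => ?_,
    fun k => ?_⟩
  · rcases eq_or_ne k j with rfl | hk
    · exact (h.nonneg i).trans hle
    · exact (h.nonneg k).trans_eq (reflCoeff_apply_of_ne g hk c).symm
  · rcases eq_or_ne k j with rfl | hk
    · exact le_rfl
    · exact (reflCoeff_apply_of_ne g hk c).trans_le ((h.apply_le k).trans hle)

end Reflections

section WordState

variable {κ : Type*} [Fintype κ] [DecidableEq κ] {g : Matrix (Option κ) (Option κ) ℝ} {ε m : ℝ}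
  {c : Option κ → ℝ}

/-- The action on coefficients of the letters `k ^ {±1}`, when the generator `k` is the product of
the reflections with indices `some k` and `none`. -/
def letterAct (g : Matrix (Option κ) (Option κ) ℝ) : κ × Bool → (Option κ → ℝ) → Option κ → ℝ
  | (k, true), c => reflCoeff g (some k) (reflCoeff g none c)
  | (k, false), c => reflCoeff g none (reflCoeff g (some k) c)

/-- What is known on the coefficients after the action of a reduced word with given first letter.
The second condition for the inverse of a generator is what remains when the next letter cancels
the reflection `none`. -/
def WordState (g : Matrix (Option κ) (Option κ) ℝ) : κ × Bool → (Option κ → ℝ) → ℝ → Prop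
  | (k, true), c, m => Dominated (some k) c m
  | (k, false), c, m => Dominated none c m ∧ Dominated (some k) (reflCoeff g none c) m

lemma WordState.exists_dominated {a : κ × Bool} (h : WordState g a c m) :
    ∃ i, Dominated i c m := by
  obtain ⟨k, _ | _⟩ := a
  exacts [⟨none, h.1⟩, ⟨some k, h⟩]

lemma Dominated.wordState_true (hg : IsUltraparallelGram g ε) (hm : 0 ≤ m) {i : Option κ}
    (h : Dominated i c m) (hi : i ≠ none) (k : κ) :
    WordState g (k, true) (letterAct g (k, true) c) ((1 + 2 * ε) * m) :=
  ((h.reflCoeff hg hi).mono (hg.le_mul hm)).reflCoeff hg (Option.some_ne_none k).symm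

lemma Dominated.wordState_false (hg : IsUltraparallelGram g ε) (hm : 0 ≤ m) {i : Option κ}
    {k : κ} (h : Dominated i c m) (hi : i ≠ some k) :
    WordState g (k, false) (letterAct g (k, false) c) ((1 + 2 * ε) * m) := by
  have hk := h.reflCoeff hg hi
  refine ⟨(hk.mono (hg.le_mul hm)).reflCoeff hg (Option.some_ne_none k), ?_⟩
  rwa [letterAct, reflCoeff_reflCoeff (hg.diag none)]

lemma WordState.step (hg : IsUltraparallelGram g ε) (hm : 0 ≤ m) {a b : κ × Bool}
    (hab : a.1 = b.1 → a.2 = b.2) (h : WordState g b c m) :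
    WordState g a (letterAct g a c) ((1 + 2 * ε) * m) := by
  obtain ⟨k, s⟩ := a
  obtain ⟨l, t⟩ := b
  have hkl : s ≠ t → some l ≠ some k := fun hst hlk =>
    hst (hab (Option.some_injective _ hlk).symm)
  cases s <;> cases t
  · exact h.1.wordState_false hg hm (Option.some_ne_none k).symm
  · exact h.wordState_false hg hm (hkl Bool.false_ne_true)
  · exact h.2.reflCoeff hg (hkl Bool.false_ne_true.symm)
  · exact h.wordState_true hg hm (Option.some_ne_none l) k

lemma wordState_foldr (hg : IsUltraparallelGram g ε) (L : List (κ × Bool)) (a : κ × Bool)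
    (hL : FreeGroup.IsReduced (a :: L)) :
    WordState g a ((a :: L).foldr (letterAct g) 1) ((1 + 2 * ε) ^ (a :: L).length) := by
  have hε := hg.pos
  induction L generalizing a with
  | nil =>
    rw [List.length_singleton, pow_one, ← mul_one (1 + 2 * ε)]
    obtain ⟨k, _ | _⟩ := a
    · exact (dominated_one none).wordState_false hg zero_le_one (Option.some_ne_none k).symm
    · exact (dominated_one (some k)).wordState_true hg zero_le_one (Option.some_ne_none k) k
  | cons b L ih =>
    rw [FreeGroup.isReduced_cons_cons] at hL
    rw [List.length_cons, pow_succ']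
    exact (ih b hL.2).step hg (by positivity) hL.1

end WordState

section Involutions

lemma mul_add_mul_of_trace_eq_zero {R : Type*} [CommRing R] {M N : Matrix (Fin 2) (Fin 2) R}
    (hM : M.trace = 0) (hN : N.trace = 0) : M * N + N * M = (M * N).trace • 1 := by
  rw [Matrix.trace_fin_two, add_eq_zero_iff_eq_neg] at hM hN
  ext i j
  fin_cases i <;> fin_cases j <;>
    simp [Matrix.mul_apply, Matrix.trace_fin_two, Fin.sum_univ_two, hM, hN] <;> ring

lemma mul_self_of_trace_eq_zero {R : Type*} [CommRing R] {M : Matrix (Fin 2) (Fin 2) R}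
    (hM : M.trace = 0) : M * M = -M.det • 1 := by
  rw [Matrix.trace_fin_two, add_eq_zero_iff_eq_neg] at hM
  ext i j
  fin_cases i <;> fin_cases j <;>
    simp [Matrix.mul_apply, Matrix.det_fin_two, Fin.sum_univ_two, hM] <;> ring

/-- The Gram matrix for the form `(M, N) ↦ tr (M N) / 2`, for which traceless matrices of
determinant `-1` are unit vectors. -/
noncomputable def traceGram {ι : Type*} (n : ι → Mat2) : Matrix ι ι ℝ :=
  .of fun i j => (n i * n j).trace / 2

variable {ι : Type*} [Fintype ι] {n : ι → Mat2}

lemma trace_mul_linearCombination (n : ι → Mat2) (i : ι) (c : ι → ℝ) :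
    (n i * Fintype.linearCombination ℝ n c).trace = 2 * (traceGram n *ᵥ c) i := by
  rw [Fintype.linearCombination_apply, Finset.mul_sum, Matrix.trace_sum, Matrix.mulVec,
    dotProduct, Finset.mul_sum]
  refine Finset.sum_congr rfl fun j _ => ?_
  rw [mul_smul_comm, Matrix.trace_smul, smul_eq_mul, traceGram, Matrix.of_apply]
  ring

lemma trace_linearCombination (htr : ∀ i, (n i).trace = 0) (c : ι → ℝ) :
    (Fintype.linearCombination ℝ n c).trace = 0 := by
  simp only [Fintype.linearCombination_apply, Matrix.trace_sum, Matrix.trace_smul, htr, smul_zero,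
    Finset.sum_const_zero]

lemma mul_linearCombination_mul [DecidableEq ι] (htr : ∀ i, (n i).trace = 0) {i : ι}
    (hinv : n i * n i = 1) (c : ι → ℝ) :
    n i * Fintype.linearCombination ℝ n c * n i =
      -Fintype.linearCombination ℝ n (reflCoeff (traceGram n) i c) := by
  have h := mul_add_mul_of_trace_eq_zero (htr i) (trace_linearCombination htr c)
  rw [trace_mul_linearCombination] at h
  rw [eq_sub_of_add_eq h, sub_mul, smul_mul_assoc, one_mul, mul_assoc, hinv, mul_one, reflCoeff,
    map_sub, Fintype.linearCombination_apply_single, neg_sub]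

lemma mul_mul_linearCombination_mul_mul [DecidableEq ι] (htr : ∀ i, (n i).trace = 0)
    (hinv : ∀ i, n i * n i = 1) (i j : ι) (c : ι → ℝ) :
    n i * n j * Fintype.linearCombination ℝ n c * (n j * n i) = Fintype.linearCombination ℝ n
      (reflCoeff (traceGram n) i (reflCoeff (traceGram n) j c)) := by
  calc n i * n j * Fintype.linearCombination ℝ n c * (n j * n i)
      = n i * (n j * Fintype.linearCombination ℝ n c * n j) * n i := by simp only [mul_assoc]
    _ = _ := by
      rw [mul_linearCombination_mul htr (hinv j), mul_neg, neg_mul,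
        mul_linearCombination_mul htr (hinv i), neg_neg]

lemma exists_isUltraparallelGram_traceGram {ι : Type*} [Finite ι] {n : ι → Mat2}
    (hinv : ∀ i, n i * n i = 1) (hlt : ∀ i j, i ≠ j → (n i * n j).trace < -2) :
    ∃ ε, IsUltraparallelGram (traceGram n) ε := by
  have hev : ∀ᶠ ε : ℝ in 𝓝[>] 0, ∀ i j, i ≠ j → traceGram n i j ≤ -(1 + ε) := by
    simp only [eventually_all]
    intro i j hij
    have hc : Continuous fun ε : ℝ => -(1 + ε) := by fun_prop
    have h0 : traceGram n i j < -(1 + 0) := by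
      rw [traceGram, Matrix.of_apply]
      linarith [hlt i j hij]
    exact ((hc.tendsto 0).mono_left nhdsWithin_le_nhds).eventually_const_le h0
  obtain ⟨ε, hε, hpos⟩ := (hev.and self_mem_nhdsWithin).exists
  refine ⟨ε, hpos, fun i => ?_, hε⟩
  rw [traceGram, Matrix.of_apply, hinv, Matrix.trace_one, Fintype.card_fin, Nat.cast_ofNat,
    div_self two_ne_zero]

end Involutions

/-! ### Growth in the free group -/

section FreeGrowth

variable {κ : Type*}

/-- Exponential growth along the free group generated by a family of matrices. -/
def HasFreeGrowth [DecidableEq κ] (f : κ → SL(2, ℝ)) : Prop :=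
  ∃ c l : ℝ, 0 < c ∧ 1 < l ∧ ∀ w : FreeGroup κ, c * l ^ w.norm ≤ ‖(FreeGroup.lift f w).1‖

lemma abs_trace_le_two_mul_norm (M : Mat2) : |M.trace| ≤ 2 * ‖M‖ := by
  rw [Matrix.trace_fin_two]
  refine (abs_add_le _ _).trans ?_
  linarith [norm_apply_le_frobenius_norm M 0 0, norm_apply_le_frobenius_norm M 1 1,
    Real.norm_eq_abs (M 0 0), Real.norm_eq_abs (M 1 1)]

variable [DecidableEq κ] {f : κ → SL(2, ℝ)} {n : Option κ → Mat2}

lemma coe_inv_eq_neg_mul {A : SL(2, ℝ)} {M N : Mat2} (hA : A.1 = -(M * N)) (hM : M * M = 1)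
    (hN : N * N = 1) : (A⁻¹).1 = -(N * M) := by
  refine left_inv_eq_right_inv (coe_inv_mul_coe A) ?_
  rw [hA, neg_mul_neg, mul_assoc, ← mul_assoc N, hN, one_mul, hM]

lemma lift_mul_linearCombination_mul [Fintype κ] (htr : ∀ i, (n i).trace = 0)
    (hinv : ∀ i, n i * n i = 1) (hf : ∀ k, (f k).1 = -(n (some k) * n none)) (w : FreeGroup κ) :
    (FreeGroup.lift f w).1 * Fintype.linearCombination ℝ n 1 * ((FreeGroup.lift f w)⁻¹).1 =
      Fintype.linearCombination ℝ n (w.toWord.foldr (letterAct (traceGram n)) 1) := by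
  have hf' k : ((f k)⁻¹).1 = -(n none * n (some k)) :=
    coe_inv_eq_neg_mul (hf k) (hinv _) (hinv _)
  have hletter : ∀ (a : κ × Bool) c, (cond a.2 (f a.1) (f a.1)⁻¹).1 *
      Fintype.linearCombination ℝ n c * ((cond a.2 (f a.1) (f a.1)⁻¹)⁻¹).1 =
        Fintype.linearCombination ℝ n (letterAct (traceGram n) a c) := by
    rintro ⟨k, _ | _⟩ c <;>
      simp only [letterAct, cond_true, cond_false, inv_inv, hf, hf', neg_mul, mul_neg,
        neg_neg] <;>
      exact mul_mul_linearCombination_mul_mul htr hinv _ _ _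
  suffices h : ∀ L : List (κ × Bool), (FreeGroup.lift f (.mk L)).1 *
      Fintype.linearCombination ℝ n 1 * ((FreeGroup.lift f (.mk L))⁻¹).1 =
        Fintype.linearCombination ℝ n (L.foldr (letterAct (traceGram n)) 1) by
    simpa only [FreeGroup.mk_toWord] using h w.toWord
  intro L
  induction L with
  | nil => simp only [← FreeGroup.one_eq_mk, map_one, inv_one, List.foldr_nil,
      Matrix.SpecialLinearGroup.coe_one, one_mul, mul_one]
  | cons a L ih =>
    rw [List.foldr_cons, ← hletter, ← ih, FreeGroup.lift_mk, FreeGroup.lift_mk, List.map_cons,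
      List.prod_cons, mul_inv_rev, Matrix.SpecialLinearGroup.coe_mul,
      Matrix.SpecialLinearGroup.coe_mul]
    simp only [mul_assoc]

lemma Dominated.le_norm_linearCombination {ι : Type*} [Fintype ι] [Nontrivial ι] {n : ι → Mat2}
    {i : ι} {c : ι → ℝ} {ε m : ℝ} (hg : IsUltraparallelGram (traceGram n) ε)
    (h : Dominated i c m) :
    ε * m ≤ (∑ j, ‖n j‖) * ‖Fintype.linearCombination ℝ n c‖ := by
  obtain ⟨k, hk⟩ := exists_ne i
  have htrace := (neg_abs_le _).trans' <| neg_le_neg <|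
    abs_trace_le_two_mul_norm (n k * Fintype.linearCombination ℝ n c)
  rw [trace_mul_linearCombination] at htrace
  calc ε * m ≤ ε * c i := mul_le_mul_of_nonneg_left h.le_apply hg.pos.le
    _ ≤ ‖n k * Fintype.linearCombination ℝ n c‖ := by
      linarith [h.mulVec_le hg hk.symm, h.apply_le k]
    _ ≤ ‖n k‖ * ‖Fintype.linearCombination ℝ n c‖ := norm_mul_le _ _
    _ ≤ _ := mul_le_mul_of_nonneg_right
      (Finset.single_le_sum (fun j _ => norm_nonneg (n j)) (Finset.mem_univ k)) (norm_nonneg _)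

lemma exists_mul_pow_norm_le [Finite κ] (htr : ∀ i, (n i).trace = 0) (hinv : ∀ i, n i * n i = 1)
    (hf : ∀ k, (f k).1 = -(n (some k) * n none)) {ε : ℝ}
    (hg : IsUltraparallelGram (traceGram n) ε) :
    ∃ K, 0 ≤ K ∧ ∀ w : FreeGroup κ, w ≠ 1 →
      ε * (1 + 2 * ε) ^ w.norm ≤ K * ‖(FreeGroup.lift f w).1‖ ^ 2 := by
  cases nonempty_fintype κ
  refine ⟨(∑ j, ‖n j‖) * ‖Fintype.linearCombination ℝ n 1‖, by positivity, fun w hw1 => ?_⟩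
  have hV := lift_mul_linearCombination_mul htr hinv hf w
  obtain ⟨a, L, hw⟩ := List.exists_cons_of_ne_nil (mt FreeGroup.toWord_eq_nil_iff.1 hw1)
  obtain ⟨i, hi⟩ := (wordState_foldr hg L a (hw ▸ FreeGroup.isReduced_toWord)).exists_dominated
  rw [← hw] at hi
  have : Nonempty κ := ⟨a.1⟩
  set M := FreeGroup.lift f w
  calc ε * (1 + 2 * ε) ^ w.norm
      ≤ (∑ j, ‖n j‖) * ‖M.1 * Fintype.linearCombination ℝ n 1 * (M⁻¹).1‖ :=
        hV ▸ hi.le_norm_linearCombination hg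
    _ ≤ (∑ j, ‖n j‖) * (‖M.1‖ * ‖Fintype.linearCombination ℝ n 1‖ * ‖M.1‖) := by
        gcongr
        exact norm_mul_le_of_le (norm_mul_le _ _) (norm_coe_inv M).le
    _ = _ := by ring

theorem hasFreeGrowth_of_involutions [Finite κ] (htr : ∀ i, (n i).trace = 0)
    (hdet : ∀ i, (n i).det = -1) (hlt : ∀ i j, i ≠ j → (n i * n j).trace < -2)
    (hf : ∀ k, (f k).1 = -(n (some k) * n none)) : HasFreeGrowth f := by
  have hinv i : n i * n i = 1 := by
    rw [mul_self_of_trace_eq_zero (htr i), hdet, neg_neg, one_smul]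
  obtain ⟨ε, hg⟩ := exists_isUltraparallelGram_traceGram hinv hlt
  obtain ⟨K, hK, hle⟩ := exists_mul_pow_norm_le htr hinv hf hg
  have hε := hg.pos
  refine ⟨√(ε / (K + ε)), √(1 + 2 * ε), Real.sqrt_pos.2 (by positivity),
    Real.lt_sqrt_of_sq_lt (by linarith), fun w => ?_⟩
  refine le_of_sq_le_sq ?_ (norm_nonneg _)
  rw [mul_pow, Real.sq_sqrt (by positivity), pow_right_comm, Real.sq_sqrt (by positivity),
    div_mul_eq_mul_div, div_le_iff₀ (by positivity), mul_comm (_ ^ 2)]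
  have hM : 1 ≤ ‖(FreeGroup.lift f w).1‖ ^ 2 := one_le_pow₀ (one_le_norm_coe _)
  rcases eq_or_ne w 1 with rfl | hw
  · rw [FreeGroup.norm_one, pow_zero, mul_one]
    nlinarith
  · nlinarith [hle w hw]

lemma norm_lift_le {κ' : Type*} [DecidableEq κ'] {f : κ → FreeGroup κ'} {K : ℕ}
    (hf : ∀ k, (f k).norm ≤ K) (w : FreeGroup κ) : (FreeGroup.lift f w).norm ≤ K * w.norm := by
  suffices h : ∀ L : List (κ × Bool), (FreeGroup.lift f (.mk L)).norm ≤ K * L.length by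
    simpa only [FreeGroup.mk_toWord, FreeGroup.norm] using h w.toWord
  intro L
  induction L with
  | nil => simp only [← FreeGroup.one_eq_mk, map_one, FreeGroup.norm_one, zero_le]
  | cons a L ih =>
    rw [FreeGroup.lift_mk] at ih ⊢
    rw [List.map_cons, List.prod_cons, List.length_cons, mul_add, mul_one, add_comm]
    refine (FreeGroup.norm_mul_le _ _).trans (add_le_add ?_ ih)
    obtain ⟨k, _ | _⟩ := a
    · exact FreeGroup.norm_inv_eq.trans_le (hf k)
    · exact hf k

/-- Growth along one basis of a free group gives growth along any other, `v` expressing the old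
basis in the new one. -/
lemma HasFreeGrowth.of_basis_change {κ' : Type*} [DecidableEq κ'] {f' : κ' → SL(2, ℝ)}
    (h : HasFreeGrowth f') {u : κ → FreeGroup κ'} {v : κ' → FreeGroup κ}
    (hu : ∀ k, FreeGroup.lift f' (u k) = f k) (huv : ∀ k, FreeGroup.lift v (u k) = .of k)
    (hv : ∀ k, (v k).norm ≤ 2) : HasFreeGrowth f := by
  obtain ⟨c, l, hc, hl, h⟩ := h
  have hl1 : 1 < √l := Real.lt_sqrt_of_sq_lt (by linarith)
  refine ⟨c, √l, hc, hl1, fun w => ?_⟩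
  have hfu : (FreeGroup.lift f').comp (FreeGroup.lift u) = FreeGroup.lift f :=
    FreeGroup.ext_hom _ _ fun k => by simp only [MonoidHom.comp_apply, FreeGroup.lift_apply_of, hu]
  have hvu : (FreeGroup.lift v).comp (FreeGroup.lift u) = MonoidHom.id _ :=
    FreeGroup.ext_hom _ _ fun k => by
      simp only [MonoidHom.comp_apply, FreeGroup.lift_apply_of, huv, MonoidHom.id_apply]
  have hnorm : w.norm ≤ 2 * (FreeGroup.lift u w).norm := by
    simpa only [← MonoidHom.comp_apply, hvu, MonoidHom.id_apply] using
      norm_lift_le hv (FreeGroup.lift u w)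
  calc c * √l ^ w.norm ≤ c * √l ^ (2 * (FreeGroup.lift u w).norm) := by gcongr; exact hl1.le
    _ = c * l ^ (FreeGroup.lift u w).norm := by rw [pow_mul, Real.sq_sqrt (by linarith)]
    _ ≤ ‖(FreeGroup.lift f' (FreeGroup.lift u w)).1‖ := h _
    _ = _ := by rw [← MonoidHom.comp_apply, hfu]

lemma isReduced_map_true {α : Type*} (w : List α) :
    FreeGroup.IsReduced (w.map fun a => (a, true)) :=
  (List.isChain_map _).2 (List.pairwise_of_forall fun _ _ _ => rfl).isChain

lemma HasFreeGrowth.hasGrowth {p : SL(2, ℝ) × SL(2, ℝ)} (h : HasFreeGrowth (letter p)) :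
    HasGrowth p := by
  obtain ⟨c, l, hc, hl, h⟩ := h
  refine ⟨c, l, hc, hl, fun w => ?_⟩
  have hw := h (.mk (w.map fun i => (i, true)))
  rwa [FreeGroup.norm, FreeGroup.toWord_mk, (isReduced_map_true w).reduce_eq, List.length_map,
    FreeGroup.lift_mk, List.map_map] at hw

end FreeGrowth

/-! ### Schottky pairs -/

/-- The pairs with `tr A > 2`, `tr B > 2` and `tr AB < -2`. -/
def schottkySet : Set (SL(2, ℝ) × SL(2, ℝ)) := {p | 2 < trA p ∧ 2 < trB p ∧ trAB p < -2}

lemma det_commutator (p : SL(2, ℝ) × SL(2, ℝ)) :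
    (p.1.1 * p.2.1 - p.2.1 * p.1.1).det = 2 - trComm p := by
  have hA := det_eq_one p.1
  have hB := det_eq_one p.2
  simp only [trComm, trA_eq, trB_eq, trAB_eq, Matrix.det_fin_two, Matrix.sub_apply,
    Matrix.mul_apply, Fin.sum_univ_two]
  linear_combination (4 * (p.2.1 0 0 * p.2.1 1 1 - p.2.1 0 1 * p.2.1 1 0) -
    (p.2.1 0 0 + p.2.1 1 1) ^ 2) * hA + (4 - (p.1.1 0 0 + p.1.1 1 1) ^ 2) * hB

lemma two_lt_trComm_of_mem_schottkySet {p : SL(2, ℝ) × SL(2, ℝ)} (hp : p ∈ schottkySet) :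
    2 < trComm p := by
  obtain ⟨hx, hy, hz⟩ := hp
  rw [trComm]
  nlinarith [mul_pos (sub_pos.2 hx) (sub_pos.2 hy), mul_pos (by linarith : 0 < trA p)
    (by linarith : 0 < trB p)]

lemma exists_involution_of_two_lt_trComm {p : SL(2, ℝ) × SL(2, ℝ)} (h : 2 < trComm p) :
    ∃ Y : Mat2, Y.trace = 0 ∧ Y.det = -1 ∧ (p.1.1 * Y).trace = 0 ∧ (Y * p.2.1).trace = 0 := by
  set C := p.1.1 * p.2.1 - p.2.1 * p.1.1 with hC
  refine ⟨(√(trComm p - 2))⁻¹ • C, ?_, ?_, ?_, ?_⟩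
  · rw [Matrix.trace_smul, hC, Matrix.trace_sub, Matrix.trace_mul_comm, sub_self, smul_zero]
  · rw [Matrix.det_smul, Fintype.card_fin, det_commutator, inv_pow, Real.sq_sqrt (by linarith),
      ← neg_sub (trComm p), mul_neg, inv_mul_cancel₀ (by linarith)]
  · rw [mul_smul_comm, Matrix.trace_smul, hC, mul_sub, Matrix.trace_sub, ← mul_assoc p.1.1 p.2.1,
      Matrix.trace_mul_comm _ p.1.1, sub_self, smul_zero]
  · rw [smul_mul_assoc, Matrix.trace_smul, hC, sub_mul, Matrix.trace_sub, mul_assoc p.2.1,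
      Matrix.trace_mul_comm p.2.1, sub_self, smul_zero]

lemma exists_involutions_of_mem_schottkySet {p : SL(2, ℝ) × SL(2, ℝ)} (hp : p ∈ schottkySet) :
    ∃ n : Option (Fin 2) → Mat2, (∀ i, (n i).trace = 0) ∧ (∀ i, (n i).det = -1) ∧
      (∀ i j, i ≠ j → (n i * n j).trace < -2) ∧
      ∀ k, (![p.1, p.2⁻¹] k).1 = -(n (some k) * n none) := by
  obtain ⟨Y, hY, hYdet, hAY, hYB⟩ :=
    exists_involution_of_two_lt_trComm (two_lt_trComm_of_mem_schottkySet hp)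
  obtain ⟨hx, hy, hz⟩ := hp
  have hYY : Y * Y = 1 := by rw [mul_self_of_trace_eq_zero hY, hYdet, neg_neg, one_smul]
  have hYBdet : (Y * p.2.1).det = -1 := by rw [Matrix.det_mul, p.2.det_coe, hYdet, mul_one]
  have hA : p.1.1 * Y * -Y = -p.1.1 := by rw [mul_neg, mul_assoc, hYY, mul_one]
  have hB : Y * p.2.1 * -Y = -(p.2⁻¹).1 := by
    rw [mul_neg, neg_inj]
    refine left_inv_eq_right_inv ?_ (coe_mul_coe_inv p.2)
    rw [mul_assoc, mul_self_of_trace_eq_zero hYB, hYBdet, neg_neg, one_smul]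
  have hA2 : (p.1.1 * Y * -Y).trace < -2 := by rwa [hA, Matrix.trace_neg, neg_lt_neg_iff]
  have hB2 : (Y * p.2.1 * -Y).trace < -2 := by
    rw [mul_neg, Matrix.trace_neg, neg_lt_neg_iff, Matrix.trace_mul_comm, ← mul_assoc, hYY, one_mul]
    exact hy
  have hAB2 : (p.1.1 * Y * (Y * p.2.1)).trace < -2 := by
    rwa [mul_assoc, ← mul_assoc Y, hYY, one_mul]
  refine ⟨fun o => o.elim (-Y) ![p.1.1 * Y, Y * p.2.1], ?_, ?_, ?_, ?_⟩
  · rintro (_ | k)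
    · exact (Matrix.trace_neg Y).trans (by rw [hY, neg_zero])
    · fin_cases k
      exacts [hAY, hYB]
  · rintro (_ | k)
    · exact (Matrix.det_neg Y).trans (by rw [hYdet, Fintype.card_fin, neg_one_sq, one_mul])
    · fin_cases k
      exacts [(Matrix.det_mul _ _).trans (by rw [p.1.det_coe, hYdet, one_mul]), hYBdet]
  · rintro (_ | k) (_ | l) hij
    · exact absurd rfl hij
    · fin_cases l
      exacts [(Matrix.trace_mul_comm _ _).trans_lt hA2, (Matrix.trace_mul_comm _ _).trans_lt hB2]
    · fin_cases k
      exacts [hA2, hB2]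
    · fin_cases k <;> fin_cases l
      exacts [absurd rfl hij, hAB2, (Matrix.trace_mul_comm _ _).trans_lt hAB2, absurd rfl hij]
  · rw [Fin.forall_fin_two]
    exact ⟨neg_eq_iff_eq_neg.1 hA.symm, neg_eq_iff_eq_neg.1 hB.symm⟩

theorem hasFreeGrowth_of_mem_schottkySet {p : SL(2, ℝ) × SL(2, ℝ)} (hp : p ∈ schottkySet) :
    HasFreeGrowth (letter p) := by
  obtain ⟨n, htr, hdet, hlt, hn⟩ := exists_involutions_of_mem_schottkySet hp
  refine (hasFreeGrowth_of_involutions htr hdet hlt hn).of_basis_change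
    (u := ![.of 0, (.of 1)⁻¹]) (v := ![.of 0, (.of 1)⁻¹]) ?_ ?_ ?_ <;>
    intro i <;> fin_cases i <;> simp [letter]

/-! ### The reduction algorithm -/

lemma exists_prod_map_eq_prod_map {α β M : Type*} [Monoid M] {f : α → M} {g : β → M}
    (h : ∀ b, ∃ u : List α, u ≠ [] ∧ g b = (u.map f).prod) {w : List β} (hw : w ≠ []) :
    ∃ w' : List α, w' ≠ [] ∧ (w.map g).prod = (w'.map f).prod := by
  choose u hu hgu using h
  refine ⟨w.flatMap u, ?_, ?_⟩
  · obtain ⟨b, w, rfl⟩ := List.exists_cons_of_ne_nil hw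
    simp [hu b]
  · clear hw
    induction w with
    | nil => rfl
    | cons b w ih => simp [hgu, ih]

/-- One step of the reduction: `(A, B) ↦ (A, AB)` for `true` and `(A, B) ↦ (AB, B)` for
`false`. -/
def stepHomeo : Bool → (SL(2, ℝ) × SL(2, ℝ)) ≃ₜ (SL(2, ℝ) × SL(2, ℝ))
  | true =>
    { toFun := fun p => (p.1, p.1 * p.2)
      invFun := fun p => (p.1, p.1⁻¹ * p.2)
      left_inv := fun p => by simp
      right_inv := fun p => by simp
      continuous_toFun := by fun_prop
      continuous_invFun := by fun_prop }
  | false =>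
    { toFun := fun p => (p.1 * p.2, p.2)
      invFun := fun p => (p.1 * p.2⁻¹, p.2)
      left_inv := fun p => by simp
      right_inv := fun p => by simp
      continuous_toFun := by fun_prop
      continuous_invFun := by fun_prop }

/-- A sequence of reduction steps, the head of the list being performed first. -/
def reduction : List Bool → (SL(2, ℝ) × SL(2, ℝ)) ≃ₜ (SL(2, ℝ) × SL(2, ℝ))
  | [] => Homeomorph.refl _
  | b :: F => (stepHomeo b).trans (reduction F)

section Step

variable (b : Bool) (F : List Bool) (p : SL(2, ℝ) × SL(2, ℝ))

lemma stepHomeo_true : stepHomeo true p = (p.1, p.1 * p.2) := rfl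

lemma stepHomeo_false : stepHomeo false p = (p.1 * p.2, p.2) := rfl

lemma reduction_nil : reduction [] p = p := rfl

lemma exists_letter_stepHomeo_eq (i : Fin 2) :
    ∃ u : List (Fin 2), u ≠ [] ∧ letter (stepHomeo b p) i = (u.map (letter p)).prod := by
  cases b <;> fin_cases i
  · exact ⟨[0, 1], by simp, by simp [letter, stepHomeo_false]⟩
  · exact ⟨[1], by simp, by simp [letter, stepHomeo_false]⟩
  · exact ⟨[0], by simp, by simp [letter, stepHomeo_true]⟩
  · exact ⟨[0, 1], by simp, by simp [letter, stepHomeo_true]⟩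

lemma exists_letter_reduction_eq (i : Fin 2) :
    ∃ u : List (Fin 2), u ≠ [] ∧ letter (reduction F p) i = (u.map (letter p)).prod := by
  induction F generalizing p with
  | nil => exact ⟨[i], by simp, by simp [reduction_nil]⟩
  | cons b F ih =>
    obtain ⟨u, hu, hpu⟩ := ih (stepHomeo b p)
    obtain ⟨w, hw, huw⟩ := exists_prod_map_eq_prod_map (exists_letter_stepHomeo_eq b p) hu
    exact ⟨w, hw, (hpu.trans huw :)⟩

end Step

lemma HasFreeGrowth.of_stepHomeo {b : Bool} {p : SL(2, ℝ) × SL(2, ℝ)}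
    (h : HasFreeGrowth (letter (stepHomeo b p))) : HasFreeGrowth (letter p) := by
  have hnorm : ((FreeGroup.of 0 : FreeGroup (Fin 2)) * FreeGroup.of 1).norm ≤ 2 :=
    (FreeGroup.norm_mul_le _ _).trans (by simp)
  cases b
  · refine h.of_basis_change (u := ![FreeGroup.of 0 * (FreeGroup.of 1)⁻¹, FreeGroup.of 1])
      (v := ![FreeGroup.of 0 * FreeGroup.of 1, FreeGroup.of 1]) ?_ ?_ ?_ <;>
    · intro i
      fin_cases i <;> simp [letter, stepHomeo_false, hnorm]
  · refine h.of_basis_change (u := ![FreeGroup.of 0, (FreeGroup.of 0)⁻¹ * FreeGroup.of 1])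
      (v := ![FreeGroup.of 0, FreeGroup.of 0 * FreeGroup.of 1]) ?_ ?_ ?_ <;>
    · intro i
      fin_cases i <;> simp [letter, stepHomeo_true, hnorm]

lemma hasFreeGrowth_of_reduction_mem_schottkySet {F : List Bool} {p : SL(2, ℝ) × SL(2, ℝ)}
    (h : reduction F p ∈ schottkySet) : HasFreeGrowth (letter p) := by
  induction F generalizing p with
  | nil => exact hasFreeGrowth_of_mem_schottkySet h
  | cons b F ih => exact (ih h).of_stepHomeo

section Traces

variable (p : SL(2, ℝ) × SL(2, ℝ))

lemma trA_step_true : trA (stepHomeo true p) = trA p := rfl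

lemma trB_step_true : trB (stepHomeo true p) = trAB p := rfl

lemma trAB_step_true : trAB (stepHomeo true p) = trA p * trAB p - trB p := by
  have hA := det_eq_one p.1
  simp only [trAB, trA, trB, stepHomeo_true, Matrix.SpecialLinearGroup.coe_mul,
    Matrix.trace_fin_two, Matrix.mul_apply, Fin.sum_univ_two]
  linear_combination (-p.2.1 0 0 - p.2.1 1 1) * hA

lemma trA_step_false : trA (stepHomeo false p) = trAB p := rfl

lemma trB_step_false : trB (stepHomeo false p) = trB p := rfl

lemma trAB_step_false : trAB (stepHomeo false p) = trAB p * trB p - trA p := by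
  have hB := det_eq_one p.2
  simp only [trAB, trA, trB, stepHomeo_false, Matrix.SpecialLinearGroup.coe_mul,
    Matrix.trace_fin_two, Matrix.mul_apply, Fin.sum_univ_two]
  linear_combination (-p.1.1 0 0 - p.1.1 1 1) * hB

lemma trComm_step (b : Bool) : trComm (stepHomeo b p) = trComm p := by
  cases b
  · rw [trComm, trA_step_false, trB_step_false, trAB_step_false, trComm]; ring
  · rw [trComm, trA_step_true, trB_step_true, trAB_step_true, trComm]; ring

end Traces

/-- The pairs with `tr A > 2` and `tr B > 2` whose axes have disjoint closures and are pointed in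
opposite senses. -/
def opposedSet : Set (SL(2, ℝ) × SL(2, ℝ)) :=
  {p | 2 < trA p ∧ 2 < trB p ∧ 2 * trAB p < trA p * trB p ∧ 2 < trComm p}

lemma mul_lt_two_mul_of_opposed {x y z : ℝ} (hx : 2 < x) (hxy : x ≤ y) (hz : 2 * z < x * y)
    (hk : 2 < x ^ 2 + y ^ 2 + z ^ 2 - x * y * z - 2) : x * z < 2 * y := by
  by_contra! h
  have hx2 : 0 < x ^ 2 - 4 := by nlinarith
  have hfac : 0 ≤ (x * z - 2 * y) * (x ^ 2 * y - x * z - 2 * y) := by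
    refine mul_nonneg (by linarith) ?_
    nlinarith [mul_pos (by linarith : 0 < x) (sub_pos.2 hz),
      mul_nonneg hx2.le (by linarith : 0 ≤ y)]
  have hpos : 0 < x ^ 2 * (x ^ 2 + y ^ 2 + z ^ 2 - x * y * z - 4) :=
    mul_pos (by positivity) (by linarith)
  have hxy2 : 0 ≤ (x ^ 2 - 4) * (y ^ 2 - x ^ 2) := mul_nonneg hx2.le (by nlinarith)
  linarith

lemma add_le_of_mul_le_two_mul {x y z δ : ℝ} (hx : 2 ≤ x) (hz : 2 ≤ z)
    (hk : δ ^ 2 + 2 ≤ x ^ 2 + y ^ 2 + z ^ 2 - x * y * z - 2) (h : x * z ≤ 2 * y) :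
    z + δ ≤ y ∧ x + δ ≤ y := by
  have hsq : (2 * δ) ^ 2 ≤ (2 * y - x * z) ^ 2 := by
    have h4 : 0 ≤ (x ^ 2 - 4) * (z ^ 2 - 4) := mul_nonneg (by nlinarith) (by nlinarith)
    linear_combination 4 * hk + h4
  have hδ : 2 * δ ≤ 2 * y - x * z := le_of_sq_le_sq hsq (by linarith)
  constructor <;> nlinarith

section Opposed

variable {p : SL(2, ℝ) × SL(2, ℝ)}

lemma stepHomeo_true_mem_opposedSet (hp : p ∈ opposedSet) (hz : 2 < trAB p)
    (hlt : trA p < trB p) : stepHomeo true p ∈ opposedSet ∧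
      trA (stepHomeo true p) + trB (stepHomeo true p) + √(trComm p - 2) ≤ trA p + trB p := by
  obtain ⟨hx, -, hxy, hk⟩ := hp
  have hδ := Real.sq_sqrt (sub_pos.2 hk).le
  have hmul : trA p * trAB p < 2 * trB p :=
    mul_lt_two_mul_of_opposed hx hlt.le hxy (by rwa [trComm] at hk)
  have hgap := (add_le_of_mul_le_two_mul hx.le hz.le (by rw [hδ, trComm]; linarith) hmul.le).1
  refine ⟨⟨hx, hz, ?_, (trComm_step p true).symm ▸ hk⟩, ?_⟩
  · rw [trAB_step_true, trA_step_true, trB_step_true]; linarith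
  · rw [trA_step_true, trB_step_true]; linarith

lemma stepHomeo_false_mem_opposedSet (hp : p ∈ opposedSet) (hz : 2 < trAB p)
    (hlt : trB p < trA p) : stepHomeo false p ∈ opposedSet ∧
      trA (stepHomeo false p) + trB (stepHomeo false p) + √(trComm p - 2) ≤ trA p + trB p := by
  obtain ⟨-, hy, hxy, hk⟩ := hp
  have hδ := Real.sq_sqrt (sub_pos.2 hk).le
  have hmul : trB p * trAB p < 2 * trA p :=
    mul_lt_two_mul_of_opposed hy hlt.le (by linarith) (by rw [trComm] at hk; linarith)
  have hgap := (add_le_of_mul_le_two_mul hy.le hz.le (by rw [hδ, trComm]; linarith) hmul.le).1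
  refine ⟨⟨hz, hy, ?_, (trComm_step p false).symm ▸ hk⟩, ?_⟩
  · rw [trAB_step_false, trA_step_false, trB_step_false]; linarith
  · rw [trA_step_false, trB_step_false]; linarith

lemma trA_ne_trB_of_mem_opposedSet (hp : p ∈ opposedSet) (hz : 2 < trAB p) : trA p ≠ trB p := by
  intro hxy
  obtain ⟨-, -, hlt, hk⟩ := hp
  rw [trComm] at hk
  rw [← hxy] at hlt hk
  nlinarith [mul_pos (sub_pos.2 hz) (by nlinarith : 0 < trA p * trA p - trAB p - 2)]

lemma exists_step_of_mem_opposedSet (hp : p ∈ opposedSet) (hz : 2 < trAB p) :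
    ∃ b, stepHomeo b p ∈ opposedSet ∧
      trA (stepHomeo b p) + trB (stepHomeo b p) + √(trComm p - 2) ≤ trA p + trB p :=
  (trA_ne_trB_of_mem_opposedSet hp hz).lt_or_gt.elim
    (fun h => ⟨true, stepHomeo_true_mem_opposedSet hp hz h⟩)
    fun h => ⟨false, stepHomeo_false_mem_opposedSet hp hz h⟩

-- Each step keeps `trComm p` and lowers `trA p + trB p > 4` by at least `√(trComm p - 2)`.
theorem exists_reduction_mem_schottkySet (hp : p ∈ opposedSet)
    (hh : ∀ w : List (Fin 2), w ≠ [] → Hyperbolic (w.map (letter p)).prod) :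
    ∃ F, reduction F p ∈ schottkySet := by
  set δ := √(trComm p - 2) with hδ
  have hδ0 : 0 < δ := Real.sqrt_pos.2 (sub_pos.2 hp.2.2.2)
  obtain ⟨n, hn⟩ := exists_nat_gt ((trA p + trB p - 4) / δ)
  rw [div_lt_iff₀ hδ0] at hn
  clear_value δ
  induction n generalizing p with
  | zero =>
    rw [Nat.cast_zero, zero_mul] at hn
    linarith [hp.1, hp.2.1]
  | succ n ih =>
    have hAB : 2 < |trAB p| := by
      simpa [Hyperbolic, letter, trAB] using hh [0, 1] (List.cons_ne_nil _ _)
    rcases lt_abs.1 hAB with h | h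
    · obtain ⟨b, hb, hlt⟩ := exists_step_of_mem_opposedSet hp h
      have hh' : ∀ w : List (Fin 2), w ≠ [] →
          Hyperbolic (w.map (letter (stepHomeo b p))).prod := by
        intro w hw
        obtain ⟨w', hw', e⟩ := exists_prod_map_eq_prod_map (exists_letter_stepHomeo_eq b p) hw
        exact e ▸ hh w' hw'
      obtain ⟨F, hF⟩ := ih hb hh' (by rw [trComm_step]; exact hδ) (by
        rw [Nat.cast_succ] at hn
        linarith)
      exact ⟨b :: F, hF⟩
    · exact ⟨[], hp.1, hp.2.1, lt_neg.1 h⟩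

/-! ### Closures of the pieces -/

/-- The closed counterpart of `schottkySet`. -/
def schottkyClosed : Set (SL(2, ℝ) × SL(2, ℝ)) := {p | 2 ≤ trA p ∧ 2 ≤ trB p ∧ trAB p ≤ -2}

/-- A closed set of opposed pairs, stable under inverse reduction steps. The bound `18` is the
minimum of `trComm` on `schottkyClosed`. -/
def opposedClosed : Set (SL(2, ℝ) × SL(2, ℝ)) :=
  {p | 2 ≤ trA p ∧ 2 ≤ trB p ∧ 2 * trAB p ≤ trA p * trB p ∧ 18 ≤ trComm p}

lemma schottkyClosed_subset_opposedClosed : schottkyClosed ⊆ opposedClosed := by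
  rintro p ⟨hx, hy, hz⟩
  have hxy : 4 ≤ trA p * trB p := by nlinarith
  refine ⟨hx, hy, by linarith, ?_⟩
  rw [trComm]
  nlinarith

lemma mem_opposedClosed_of_stepHomeo_true (h : stepHomeo true p ∈ opposedClosed) :
    p ∈ opposedClosed ∧ 2 ≤ trAB p ∧ trAB p + 4 ≤ trB p ∧ trA p + 4 ≤ trB p := by
  obtain ⟨hx, hz, hxz, hk⟩ := h
  rw [trComm_step] at hk
  rw [trAB_step_true] at hxz
  rw [trA_step_true] at hx hxz
  rw [trB_step_true] at hz hxz
  obtain ⟨hzy, hxy⟩ := add_le_of_mul_le_two_mul (δ := 4) (y := trB p) hx hz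
    (by rw [trComm] at hk; linarith) (by linarith)
  exact ⟨⟨hx, by linarith, by nlinarith, hk⟩, hz, hzy, hxy⟩

lemma mem_opposedClosed_of_stepHomeo_false (h : stepHomeo false p ∈ opposedClosed) :
    p ∈ opposedClosed ∧ 2 ≤ trAB p ∧ trAB p + 4 ≤ trA p ∧ trB p + 4 ≤ trA p := by
  obtain ⟨hz, hy, hyz, hk⟩ := h
  rw [trComm_step] at hk
  rw [trAB_step_false] at hyz
  rw [trA_step_false] at hz hyz
  rw [trB_step_false] at hy hyz
  obtain ⟨hzx, hyx⟩ := add_le_of_mul_le_two_mul (δ := 4) (y := trA p) hy hz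
    (by rw [trComm] at hk; linarith) (by linarith)
  exact ⟨⟨by linarith, hy, by nlinarith, hk⟩, hz, hzx, hyx⟩

lemma mem_opposedClosed_of_stepHomeo {b : Bool} (h : stepHomeo b p ∈ opposedClosed) :
    p ∈ opposedClosed ∧ 2 ≤ trAB p ∧
      trA (stepHomeo b p) + trB (stepHomeo b p) + 4 ≤ trA p + trB p ∧
      (b = true ↔ trA p < trB p) := by
  cases b
  · obtain ⟨hp, hz, hzx, hyx⟩ := mem_opposedClosed_of_stepHomeo_false h
    rw [trA_step_false, trB_step_false]
    exact ⟨hp, hz, by linarith, iff_of_false Bool.false_ne_true (by linarith)⟩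
  · obtain ⟨hp, hz, hzy, hxy⟩ := mem_opposedClosed_of_stepHomeo_true h
    rw [trA_step_true, trB_step_true]
    exact ⟨hp, hz, by linarith, iff_of_true rfl (by linarith)⟩

lemma mem_opposedClosed_of_reduction {F : List Bool} (h : reduction F p ∈ schottkyClosed) :
    p ∈ opposedClosed ∧ 4 * (F.length : ℝ) ≤ trA p + trB p := by
  induction F generalizing p with
  | nil =>
    have hp : p ∈ opposedClosed := schottkyClosed_subset_opposedClosed h
    refine ⟨hp, ?_⟩
    rw [List.length_nil, Nat.cast_zero]
    linarith [hp.1, hp.2.1]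
  | cons b F ih =>
    obtain ⟨hb, hF⟩ := ih (p := stepHomeo b p) h
    obtain ⟨hp, -, hle, -⟩ := mem_opposedClosed_of_stepHomeo hb
    rw [List.length_cons, Nat.cast_succ]
    exact ⟨hp, by linarith⟩

lemma reduction_cons_notMem_schottkyClosed {b : Bool} {F : List Bool} (hp : p ∈ schottkyClosed) :
    reduction (b :: F) p ∉ schottkyClosed := fun h => by
  have hz : trAB p ≤ -2 := hp.2.2
  linarith [(mem_opposedClosed_of_stepHomeo (mem_opposedClosed_of_reduction (F := F) h).1).2.1]

lemma reduction_unique {F G : List Bool} (hF : reduction F p ∈ schottkyClosed)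
    (hG : reduction G p ∈ schottkyClosed) : F = G := by
  induction F generalizing p G with
  | nil =>
    cases G with
    | nil => rfl
    | cons b G => exact absurd hG (reduction_cons_notMem_schottkyClosed hF)
  | cons a F ih =>
    cases G with
    | nil => exact absurd hF (reduction_cons_notMem_schottkyClosed hG)
    | cons b G =>
      have ha := mem_opposedClosed_of_stepHomeo (mem_opposedClosed_of_reduction (F := F) hF).1
      have hb := mem_opposedClosed_of_stepHomeo (mem_opposedClosed_of_reduction (F := G) hG).1
      obtain rfl : a = b := Bool.eq_iff_iff.2 (ha.2.2.2.trans hb.2.2.2.symm)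
      rw [ih hF hG]

end Opposed

/-! ### Common invariant directions -/

lemma exists_conj_eq_diagonal_inv {A : SL(2, ℝ)} (hA : 2 < A.1.trace) :
    ∃ (g : SL(2, ℝ)) (l : ℝ), 1 < l ∧ (g * A * g⁻¹).1 = !![l, 0; 0, l⁻¹] := by
  obtain ⟨R, htR, hdR, hAR⟩ := exists_eq_smul_one_add_smul hA
  obtain ⟨g, hg⟩ := exists_conj_eq_diagonal one_pos htR (by rw [hdR, one_pow])
  set s := √(A.1.trace ^ 2 - 4)
  have hs : s ^ 2 = A.1.trace ^ 2 - 4 := Real.sq_sqrt (by nlinarith)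
  have hs0 : 0 ≤ s := Real.sqrt_nonneg _
  have hinv : (A.1.trace / 2 + s / 2)⁻¹ = A.1.trace / 2 - s / 2 :=
    inv_eq_of_mul_eq_one_right (by linear_combination -hs / 4)
  refine ⟨g, A.1.trace / 2 + s / 2, by linarith, ?_⟩
  calc (g * A * g⁻¹).1 = g.1 * A.1 * (g⁻¹).1 := rfl
    _ = (A.1.trace / 2) • (g.1 * (g⁻¹).1) + (s / 2) • (g.1 * R * (g⁻¹).1) := by
        conv_lhs => rw [hAR]
        rw [mul_add, add_mul, mul_smul_comm, smul_mul_assoc, mul_one, mul_smul_comm,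
          smul_mul_assoc]
    _ = !![A.1.trace / 2 + s / 2, 0; 0, (A.1.trace / 2 + s / 2)⁻¹] := by
        rw [coe_mul_coe_inv, hg, hinv]
        ext i j
        fin_cases i <;> fin_cases j <;> simp [sub_eq_add_neg]

lemma mulVec_inv_mulVec_of_conj {n R : Type*} [Fintype n] [DecidableEq n] [CommRing R]
    {g A : Matrix.SpecialLinearGroup n R} {v : n → R} {c : R}
    (h : (g * A * g⁻¹).1 *ᵥ v = c • v) : A.1 *ᵥ ((g⁻¹).1 *ᵥ v) = c • ((g⁻¹).1 *ᵥ v) := by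
  rw [← coe_mul_mulVec, show A * g⁻¹ = g⁻¹ * (g * A * g⁻¹) by group, coe_mul_mulVec, h,
    Matrix.mulVec_smul]

lemma unstableEqStable_of_mulVec_eq_smul {A B : SL(2, ℝ)} {v : Fin 2 → ℝ} (hv : v ≠ 0) {a b : ℝ}
    (ha : 1 < |a|) (hA : A.1 *ᵥ v = a • v) (hb : |b| < 1) (hB : B.1 *ᵥ v = b • v) :
    UnstableEqStable A B := by
  refine ⟨Projectivization.mk ℝ v hv,
    Or.inl ⟨hyperbolic_of_mulVec_eq_smul hv hA ha.ne', a, ha, fun w hw => ?_⟩,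
    Or.inl ⟨hyperbolic_of_mulVec_eq_smul hv hB hb.ne, b, hb, fun w hw => ?_⟩⟩
  · obtain ⟨t, rfl⟩ := (mem_submodule_mk hv).1 hw
    rw [Matrix.mulVec_smul, hA, smul_comm]
  · obtain ⟨t, rfl⟩ := (mem_submodule_mk hv).1 hw
    rw [Matrix.mulVec_smul, hB, smul_comm]

lemma entries_of_trComm_eq_two {p : SL(2, ℝ) × SL(2, ℝ)} {l : ℝ} (hl : 1 < l)
    (hA : p.1.1 = !![l, 0; 0, l⁻¹]) (hy : 2 < trB p) (hz : 2 * trAB p < trA p * trB p)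
    (hk : trComm p = 2) :
    p.2.1 0 1 * p.2.1 1 0 = 0 ∧ 0 < p.2.1 0 0 ∧ p.2.1 0 0 < 1 ∧ 1 < p.2.1 1 1 := by
  have hdB := det_eq_one p.2
  have hl1 : 0 < l - l⁻¹ := by linarith [inv_lt_one_of_one_lt₀ hl]
  have hdet := (det_commutator p).trans (by rw [hk, sub_self])
  have hbc : p.2.1 0 1 * p.2.1 1 0 = 0 := by
    rw [Matrix.det_fin_two] at hdet
    simp only [Matrix.sub_apply, Matrix.mul_apply, Fin.sum_univ_two, hA, Matrix.of_apply,
      Matrix.cons_val_zero, Matrix.cons_val_one] at hdet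
    refine (mul_eq_zero.1 ?_).resolve_left (pow_ne_zero 2 hl1.ne')
    linear_combination hdet
  have had : p.2.1 0 0 < p.2.1 1 1 := by
    simp only [trAB_eq, trA_eq, trB_eq, hA, Matrix.of_apply, Matrix.cons_val_zero,
      Matrix.cons_val_one] at hz
    nlinarith
  rw [trB_eq] at hy
  rw [hbc, sub_zero] at hdB
  have ha0 : 0 < p.2.1 0 0 := by
    by_contra! h
    nlinarith
  exact ⟨hbc, ha0, by nlinarith, by nlinarith⟩

theorem unstableEqStable_of_trComm_eq_two {p : SL(2, ℝ) × SL(2, ℝ)} (hx : 2 < trA p)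
    (hy : 2 < trB p) (hz : 2 * trAB p < trA p * trB p) (hk : trComm p = 2) :
    UnstableEqStable p.1 p.2 ∨ UnstableEqStable p.2 p.1 := by
  obtain ⟨g, l, hl, hg⟩ := exists_conj_eq_diagonal_inv hx
  obtain ⟨hbc, ha0, ha1, hd1⟩ := entries_of_trComm_eq_two (p := conjPair g p) hl hg
    (by rwa [trB_conjPair]) (by rwa [trAB_conjPair, trA_conjPair, trB_conjPair])
    (by rwa [trComm_conjPair])
  have hl0 : 0 < l := one_pos.trans hl
  rcases mul_eq_zero.1 hbc with hb | hc
  · refine Or.inr (unstableEqStable_of_mulVec_eq_smul (v := (g⁻¹).1 *ᵥ ![0, 1])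
      (a := (conjPair g p).2.1 1 1) (b := l⁻¹) (mulVec_ne_zero g⁻¹ ?_) ?_ ?_ ?_ ?_)
    · exact fun h => one_ne_zero (congrFun h 1)
    · rwa [abs_of_pos (one_pos.trans hd1)]
    · refine mulVec_inv_mulVec_of_conj (A := p.2) ?_
      change (conjPair g p).2.1 *ᵥ ![0, 1] = _
      ext i
      fin_cases i <;> simp [Matrix.mulVec, dotProduct, hb]
    · rw [abs_of_pos (inv_pos.2 hl0)]
      exact inv_lt_one_of_one_lt₀ hl
    · refine mulVec_inv_mulVec_of_conj (hg ▸ funext fun i => ?_)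
      fin_cases i <;> simp
  · refine Or.inl (unstableEqStable_of_mulVec_eq_smul (v := (g⁻¹).1 *ᵥ ![1, 0])
      (a := l) (b := (conjPair g p).2.1 0 0) (mulVec_ne_zero g⁻¹ (vec_one_ne_zero 0)) ?_ ?_ ?_ ?_)
    · rwa [abs_of_pos hl0]
    · refine mulVec_inv_mulVec_of_conj (hg ▸ funext fun i => ?_)
      fin_cases i <;> simp
    · rwa [abs_of_pos ha0]
    · refine mulVec_inv_mulVec_of_conj (A := p.2) ?_
      change (conjPair g p).2.1 *ᵥ ![1, 0] = _
      ext i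
      fin_cases i <;> simp [Matrix.mulVec, dotProduct, hc]

lemma exists_mulVec_eq_smul_of_smul_eq_self {n K : Type*} [Fintype n] [DecidableEq n] [Field K]
    {A : Matrix.SpecialLinearGroup n K} {d : ℙ K (n → K)} (h : A • d = d) :
    ∃ c : K, A.1 *ᵥ d.rep = c • d.rep := by
  have hmem : A.1 *ᵥ d.rep ∈ d.submodule := by
    simpa only [h] using mulVec_mem_smul A (rep_mem_submodule d)
  rw [d.submodule_eq, Submodule.mem_span_singleton] at hmem
  exact hmem.imp fun c hc => hc.symm

lemma trComm_eq_two_of_mulVec_eq_smul {p : SL(2, ℝ) × SL(2, ℝ)} {v : Fin 2 → ℝ} (hv : v ≠ 0)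
    {a b : ℝ} (ha : p.1.1 *ᵥ v = a • v) (hb : p.2.1 *ᵥ v = b • v) : trComm p = 2 := by
  have hdet : (p.1.1 * p.2.1 - p.2.1 * p.1.1).det = 0 :=
    Matrix.exists_mulVec_eq_zero_iff.1 ⟨v, hv, by
      rw [Matrix.sub_mulVec, ← Matrix.mulVec_mulVec, ← Matrix.mulVec_mulVec, ha, hb,
        Matrix.mulVec_smul, Matrix.mulVec_smul, ha, hb, smul_comm, sub_self]⟩
  linarith [det_commutator p]

lemma trComm_eq_two_of_unstableEqStable {A B : SL(2, ℝ)} (h : UnstableEqStable A B) :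
    trComm (A, B) = 2 := by
  obtain ⟨d, hA, hB⟩ := h
  obtain ⟨a, ha⟩ : ∃ a : ℝ, A.1 *ᵥ d.rep = a • d.rep := by
    rcases hA with ⟨-, a, -, ha⟩ | ⟨-, -, -, hd⟩
    · exact ⟨a, ha _ (rep_mem_submodule d)⟩
    · exact exists_mulVec_eq_smul_of_smul_eq_self hd
  obtain ⟨b, hb⟩ : ∃ b : ℝ, B.1 *ᵥ d.rep = b • d.rep := by
    rcases hB with ⟨-, b, -, hb⟩ | ⟨-, -, -, hd⟩
    · exact ⟨b, hb _ (rep_mem_submodule d)⟩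
    · exact exists_mulVec_eq_smul_of_smul_eq_self hd
  exact trComm_eq_two_of_mulVec_eq_smul d.rep_nonzero ha hb

lemma trComm_swap (p : SL(2, ℝ) × SL(2, ℝ)) : trComm p.swap = trComm p := by
  have hAB : trAB p.swap = trAB p := Matrix.trace_mul_comm _ _
  rw [trComm, trComm, hAB, show trA p.swap = trB p from rfl, show trB p.swap = trA p from rfl]
  ring

/-! ### Orientation of Schottky pairs -/

/-- The signs `-1` and `1`. -/
def sgn (b : Bool) : ℝ := bif b then -1 else 1

lemma sgn_mul_self (b : Bool) : sgn b * sgn b = 1 := by cases b <;> norm_num [sgn]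

lemma sgn_ne_zero (b : Bool) : sgn b ≠ 0 := by cases b <;> norm_num [sgn]

lemma exists_sgn_mul_pos {t : ℝ} (ht : t ≠ 0) : ∃ b, 0 < sgn b * t :=
  ht.lt_or_gt.elim (fun h => ⟨true, by simpa [sgn] using h⟩)
    fun h => ⟨false, by simpa [sgn] using h⟩

lemma eq_of_sgn_mul_pos {a b : Bool} {t : ℝ} (ha : 0 < sgn a * t) (hb : 0 < sgn b * t) : a = b := by
  have hab : 0 < sgn a * sgn b * (t * t) := by
    linear_combination mul_pos ha hb
  cases a <;> cases b <;> simp only [sgn, cond_true, cond_false] at hab ⊢ <;>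
    nlinarith [mul_self_nonneg t]

/-- The lower left entry of `tr B • A + tr A • B`, whose sign distinguishes the two orientations of
Schottky pairs. -/
def orient (p : SL(2, ℝ) × SL(2, ℝ)) : ℝ := trB p * p.1.1 1 0 + trA p * p.2.1 1 0

section Orient

variable {p : SL(2, ℝ) × SL(2, ℝ)}

lemma orient_ne_zero (hp : p ∈ schottkyClosed) : orient p ≠ 0 := by
  intro h0
  obtain ⟨hx, hy, hz⟩ := hp
  -- The discriminant of `tr B • A + tr A • B`, which is negative.
  have hdisc : (trB p * p.1.1 0 0 + trA p * p.2.1 0 0 - trB p * p.1.1 1 1 - trA p * p.2.1 1 1) ^ 2 +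
      4 * (trB p * p.1.1 0 1 + trA p * p.2.1 0 1) * orient p =
      4 * (trA p * trB p * trAB p - trA p ^ 2 - trB p ^ 2) := by
    rw [orient, trAB_eq, trA_eq, trB_eq]
    linear_combination (-4 * (p.2.1 0 0 + p.2.1 1 1) ^ 2) * det_eq_one p.1 -
      4 * (p.1.1 0 0 + p.1.1 1 1) ^ 2 * det_eq_one p.2
  rw [h0, mul_zero, add_zero] at hdisc
  have hxyz : trA p * trB p * trAB p < 0 := mul_neg_of_pos_of_neg (by positivity) (by linarith)
  linarith [sq_nonneg (trA p), sq_nonneg (trB p), sq_nonneg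
    (trB p * p.1.1 0 0 + trA p * p.2.1 0 0 - trB p * p.1.1 1 1 - trA p * p.2.1 1 1)]

lemma orient_of_diagonal {l m : ℝ} (hA : p.1.1 = !![l, 0; 0, m]) :
    orient p = trA p * p.2.1 1 0 := by
  rw [orient, hA]
  simp

lemma continuous_trA : Continuous trA := by
  unfold trA
  fun_prop

lemma continuous_trB : Continuous trB := by
  unfold trB
  fun_prop

lemma continuous_trAB : Continuous trAB := by
  unfold trAB
  fun_prop

lemma continuous_trComm : Continuous trComm := by
  have hA := continuous_trA
  have hB := continuous_trB
  have hAB := continuous_trAB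
  unfold trComm
  fun_prop

lemma continuous_orient : Continuous orient := by
  have hA := continuous_trA
  have hB := continuous_trB
  unfold orient
  fun_prop

lemma continuous_conjPair : Continuous fun q : SL(2, ℝ) × (SL(2, ℝ) × SL(2, ℝ)) =>
    conjPair q.1 q.2 := by
  unfold conjPair
  fun_prop

lemma schottkySet_subset_schottkyClosed : schottkySet ⊆ schottkyClosed := fun _ hp =>
  ⟨hp.1.le, hp.2.1.le, hp.2.2.le⟩

lemma conjPair_mem_schottkyClosed (hp : p ∈ schottkyClosed) (g : SL(2, ℝ)) :
    conjPair g p ∈ schottkyClosed :=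
  ⟨(trA_conjPair g p).symm ▸ hp.1, (trB_conjPair g p).symm ▸ hp.2.1,
    (trAB_conjPair g p).symm ▸ hp.2.2⟩

lemma conjPair_mem_schottkySet (hp : p ∈ schottkySet) (g : SL(2, ℝ)) :
    conjPair g p ∈ schottkySet :=
  ⟨(trA_conjPair g p).symm ▸ hp.1, (trB_conjPair g p).symm ▸ hp.2.1,
    (trAB_conjPair g p).symm ▸ hp.2.2⟩

lemma sgn_mul_orient_conjPair_pos {e : Bool} (hp : p ∈ schottkyClosed) (g : SL(2, ℝ))
    (h : 0 < sgn e * orient p) : 0 < sgn e * orient (conjPair g p) := by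
  by_contra! hle
  have hpair : Continuous fun g : SL(2, ℝ) => (g, p) := by fun_prop
  have hcont : Continuous fun g => sgn e * orient (conjPair g p) :=
    continuous_const.mul (continuous_orient.comp (continuous_conjPair.comp hpair))
  obtain ⟨g', hg'⟩ := mem_range_of_exists_le_of_exists_ge hcont ⟨g, hle⟩
    ⟨1, by rw [conjPair_one]; exact h.le⟩
  exact mul_ne_zero (sgn_ne_zero e) (orient_ne_zero (conjPair_mem_schottkyClosed hp g')) hg'

/-- The Schottky pairs of a given orientation. -/
def schottkyOriented (e : Bool) : Set (SL(2, ℝ) × SL(2, ℝ)) :=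
  {p | p ∈ schottkySet ∧ 0 < sgn e * orient p}

end Orient

/-- Parameters `(l, y, z, t)` for the normal form of an oriented Schottky pair `(A, B)`: the large
eigenvalue `l` of `A`, the traces `y` of `B` and `z` of `AB`, and the modulus `t` of the lower left
entry of `B`. -/
abbrev NormalFormParam : Type := Ioi (1 : ℝ) × Ioi (2 : ℝ) × Iio (-2 : ℝ) × Ioi (0 : ℝ)

section NormalForm

variable (e : Bool) (q : NormalFormParam)

/-- The upper left entry of `B` in the normal form, determined by `tr B` and `tr AB`. -/
noncomputable def normalFormEntry : ℝ := (q.1.1 * q.2.2.1.1 - q.2.1.1) / (q.1.1 ^ 2 - 1)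

/-- The pair `(A, B)` with given parameters for which `A` is diagonal and the lower left entry of
`B` has sign `sgn e`. -/
noncomputable def normalForm : SL(2, ℝ) × SL(2, ℝ) :=
  (⟨!![q.1.1, 0; 0, (q.1.1)⁻¹], by
      rw [Matrix.det_fin_two_of, mul_inv_cancel₀ (one_pos.trans q.1.2).ne', mul_zero, sub_zero]⟩,
    ⟨!![normalFormEntry q,
        (normalFormEntry q * (q.2.1.1 - normalFormEntry q) - 1) / (sgn e * q.2.2.2.1);
        sgn e * q.2.2.2.1, q.2.1.1 - normalFormEntry q], by
      rw [Matrix.det_fin_two_of,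
        div_mul_cancel₀ _ (mul_ne_zero (sgn_ne_zero e) (ne_of_gt q.2.2.2.2)), sub_sub_cancel]⟩)

lemma normalForm_fst_coe : (normalForm e q).1.1 = !![q.1.1, 0; 0, (q.1.1)⁻¹] := rfl

lemma normalForm_snd_coe_one_zero : (normalForm e q).2.1 1 0 = sgn e * q.2.2.2.1 := rfl

lemma sq_sub_one_pos : 0 < q.1.1 ^ 2 - 1 := sub_pos.2 (one_lt_pow₀ q.1.2 two_ne_zero)

lemma two_lt_trA_normalForm : 2 < trA (normalForm e q) := by
  have hl : 1 < q.1.1 := q.1.2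
  have hx : trA (normalForm e q) = q.1.1 + (q.1.1)⁻¹ := trA_eq _
  rw [hx]
  nlinarith [mul_inv_cancel₀ (one_pos.trans hl).ne', inv_lt_one_of_one_lt₀ hl]

lemma trB_normalForm : trB (normalForm e q) = q.2.1.1 :=
  (trB_eq _).trans (add_sub_cancel _ _)

lemma trAB_normalForm : trAB (normalForm e q) = q.2.2.1.1 := by
  have hl : q.1.1 ≠ 0 := (one_pos.trans q.1.2).ne'
  have hl1 := (sq_sub_one_pos q).ne'
  rw [trAB_eq, normalForm_fst_coe]
  simp only [normalForm, normalFormEntry, Matrix.of_apply, Matrix.cons_val_zero,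
    Matrix.cons_val_one]
  field_simp
  ring

lemma continuous_normalForm : Continuous (normalForm e) := by
  have hl : ∀ q : NormalFormParam, q.1.1 ≠ 0 := fun q => (one_pos.trans q.1.2).ne'
  have ht : ∀ q : NormalFormParam, sgn e * q.2.2.2.1 ≠ 0 := fun q =>
    mul_ne_zero (sgn_ne_zero e) (ne_of_gt q.2.2.2.2)
  have ha : Continuous normalFormEntry :=
    Continuous.div (by fun_prop) (by fun_prop) fun q => (sq_sub_one_pos q).ne'
  refine Continuous.prodMk (continuous_of_continuous_coe_apply fun i j => ?_)
    (continuous_of_continuous_coe_apply fun i j => ?_)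
  · fin_cases i <;> fin_cases j
    · exact continuous_subtype_val.comp continuous_fst
    · exact continuous_const
    · exact continuous_const
    · exact Continuous.inv₀ (by fun_prop) hl
  · fin_cases i <;> fin_cases j
    · exact ha
    · exact Continuous.div (by fun_prop) (by fun_prop) ht
    · exact Continuous.mul (by fun_prop) (by fun_prop)
    · exact Continuous.sub (by fun_prop) ha

lemma normalForm_mem_schottkyOriented : normalForm e q ∈ schottkyOriented e := by
  have hx := two_lt_trA_normalForm e q
  refine ⟨⟨hx, (trB_normalForm e q).symm ▸ q.2.1.2, (trAB_normalForm e q).symm ▸ q.2.2.1.2⟩, ?_⟩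
  rw [orient_of_diagonal (normalForm_fst_coe e q), normalForm_snd_coe_one_zero]
  calc 0 < trA (normalForm e q) * q.2.2.2.1 := mul_pos (by linarith) q.2.2.2.2
    _ = sgn e * (trA (normalForm e q) * (sgn e * q.2.2.2.1)) := by
      linear_combination (-trA (normalForm e q) * q.2.2.2.1) * sgn_mul_self e

end NormalForm

lemma eq_of_trB_eq_of_trAB_eq {p q : SL(2, ℝ) × SL(2, ℝ)} {l : ℝ} (hl : 1 < l)
    (hp : p.1.1 = !![l, 0; 0, l⁻¹]) (hq : q.1.1 = !![l, 0; 0, l⁻¹]) (hB : trB p = trB q)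
    (hAB : trAB p = trAB q) (hc : p.2.1 1 0 = q.2.1 1 0) (hc0 : p.2.1 1 0 ≠ 0) : p = q := by
  rw [trB_eq, trB_eq] at hB
  simp only [trAB_eq, hp, hq, Matrix.of_apply, Matrix.cons_val_zero, Matrix.cons_val_one] at hAB
  have h00 : p.2.1 0 0 = q.2.1 0 0 := by
    have hl1 : l - l⁻¹ ≠ 0 := by linarith [inv_lt_one_of_one_lt₀ hl]
    refine mul_left_cancel₀ hl1 ?_
    linear_combination hAB - l⁻¹ * hB
  have h11 : p.2.1 1 1 = q.2.1 1 1 := by linarith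
  have h01 : p.2.1 0 1 = q.2.1 0 1 := by
    refine mul_right_cancel₀ hc0 ?_
    linear_combination p.2.1 1 1 * h00 + q.2.1 0 0 * h11 - q.2.1 0 1 * hc - det_eq_one p.2 +
      det_eq_one q.2
  refine Prod.ext (Subtype.ext (hp.trans hq.symm)) (Subtype.ext ?_)
  ext i j
  fin_cases i <;> fin_cases j <;> assumption

lemma exists_conjPair_eq_normalForm {e : Bool} {p : SL(2, ℝ) × SL(2, ℝ)}
    (hp : p ∈ schottkyOriented e) : ∃ g q, conjPair g p = normalForm e q := by
  obtain ⟨hp, ho⟩ := hp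
  obtain ⟨g, l, hl, hg⟩ := exists_conj_eq_diagonal_inv hp.1
  replace hg : (conjPair g p).1.1 = !![l, 0; 0, l⁻¹] := hg
  have ho' := sgn_mul_orient_conjPair_pos (schottkySet_subset_schottkyClosed hp) g ho
  rw [orient_of_diagonal hg, trA_conjPair, mul_left_comm] at ho'
  have ht : 0 < sgn e * (conjPair g p).2.1 1 0 :=
    pos_of_mul_pos_right ho' (by linarith [hp.1])
  let q : NormalFormParam := (⟨l, hl⟩, ⟨trB p, hp.2.1⟩, ⟨trAB p, hp.2.2⟩, ⟨_, ht⟩)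
  refine ⟨g, q, eq_of_trB_eq_of_trAB_eq hl hg (normalForm_fst_coe e q) ?_ ?_ ?_
    (right_ne_zero_of_mul ht.ne')⟩
  · rw [trB_conjPair, trB_normalForm]
  · rw [trAB_conjPair, trAB_normalForm]
  · rw [normalForm_snd_coe_one_zero, ← mul_assoc, sgn_mul_self, one_mul]

lemma schottkyOriented_eq_image (e : Bool) :
    schottkyOriented e = (fun q : SL(2, ℝ) × (SL(2, ℝ) × SL(2, ℝ)) => conjPair q.1 q.2) ''
      (univ ×ˢ range (normalForm e)) := by
  ext p
  constructor
  · intro hp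
    obtain ⟨g, q, hgq⟩ := exists_conjPair_eq_normalForm hp
    refine ⟨(g⁻¹, normalForm e q), ⟨mem_univ _, mem_range_self q⟩, ?_⟩
    simp only [← hgq, conjPair_conjPair, inv_mul_cancel, conjPair_one]
  · rintro ⟨⟨g, -⟩, ⟨-, q, rfl⟩, rfl⟩
    obtain ⟨hmem, ho⟩ := normalForm_mem_schottkyOriented e q
    exact ⟨conjPair_mem_schottkySet hmem g,
      sgn_mul_orient_conjPair_pos (schottkySet_subset_schottkyClosed hmem) g ho⟩

theorem isConnected_schottkyOriented (e : Bool) : IsConnected (schottkyOriented e) := by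
  have _ : ConnectedSpace (Ioi (1 : ℝ)) := Subtype.connectedSpace isConnected_Ioi
  have _ : ConnectedSpace (Ioi (2 : ℝ)) := Subtype.connectedSpace isConnected_Ioi
  have _ : ConnectedSpace (Iio (-2 : ℝ)) := Subtype.connectedSpace isConnected_Iio
  have _ : ConnectedSpace (Ioi (0 : ℝ)) := Subtype.connectedSpace isConnected_Ioi
  rw [schottkyOriented_eq_image]
  exact (isConnected_univ.prod (isConnected_range (continuous_normalForm e))).image _
    continuous_conjPair.continuousOn

/-! ### Locally finite families of components -/

section Components

variable {X ι : Type*} [TopologicalSpace X] {U : ι → Set X}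

lemma connectedComponentIn_iUnion (ho : ∀ i, IsOpen (U i)) (hc : ∀ i, IsPreconnected (U i))
    (hd : Pairwise fun i j => Disjoint (U i) (U j)) {i : ι} {x : X} (hx : x ∈ U i) :
    connectedComponentIn (⋃ i, U i) x = U i := by
  have hxU : x ∈ ⋃ i, U i := mem_iUnion_of_mem i hx
  refine Subset.antisymm ?_ ((hc i).subset_connectedComponentIn hx (subset_iUnion U i))
  refine isPreconnected_connectedComponentIn.subset_left_of_subset_union (ho i)
    (isOpen_biUnion fun j (_ : j ≠ i) => ho j) ?_ ?_ ⟨x, mem_connectedComponentIn hxU, hx⟩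
  · exact disjoint_iUnion₂_right.2 fun j hj => hd (Ne.symm hj)
  · refine (connectedComponentIn_subset _ _).trans (iUnion_subset fun j => ?_)
    by_cases hj : j = i
    · exact hj ▸ subset_union_left
    · exact (subset_biUnion_of_mem (u := U) (show j ∈ {j | j ≠ i} from hj)).trans
        subset_union_right

lemma componentsOf_iUnion (ho : ∀ i, IsOpen (U i)) (hc : ∀ i, IsConnected (U i))
    (hd : Pairwise fun i j => Disjoint (U i) (U j)) : componentsOf (⋃ i, U i) = range U := by
  have hcomp {i : ι} {x : X} (hx : x ∈ U i) : connectedComponentIn (⋃ i, U i) x = U i :=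
    connectedComponentIn_iUnion ho (fun i => (hc i).isPreconnected) hd hx
  ext C
  constructor
  · rintro ⟨x, hx, rfl⟩
    obtain ⟨i, hi⟩ := mem_iUnion.1 hx
    exact ⟨i, (hcomp hi).symm⟩
  · rintro ⟨i, rfl⟩
    obtain ⟨x, hx⟩ := (hc i).nonempty
    exact ⟨x, mem_iUnion_of_mem i hx, (hcomp hx).symm⟩

lemma frontier_iUnion_of_disjoint_closure (ho : ∀ i, IsOpen (U i)) (hf : LocallyFinite U)
    (hd : Pairwise fun i j => Disjoint (closure (U i)) (closure (U j))) :
    frontier (⋃ i, U i) = ⋃ i, frontier (U i) := by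
  rw [(isOpen_iUnion ho).frontier_eq, hf.closure_iUnion]
  ext x
  simp only [Set.mem_sdiff, mem_iUnion, not_exists, (ho _).frontier_eq]
  constructor
  · rintro ⟨⟨i, hi⟩, hn⟩
    exact ⟨i, hi, hn i⟩
  · rintro ⟨i, hi, hn⟩
    refine ⟨⟨i, hi⟩, fun j hj => ?_⟩
    obtain rfl | hij := eq_or_ne i j
    · exact hn hj
    · exact disjoint_left.1 (hd hij) hi (subset_closure hj)

lemma pairwiseDisjoint_frontier_range
    (hd : Pairwise fun i j => Disjoint (closure (U i)) (closure (U j))) :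
    (range U).PairwiseDisjoint frontier := by
  rintro _ ⟨i, rfl⟩ _ ⟨j, rfl⟩ hne
  exact (hd (ne_of_apply_ne U hne)).mono frontier_subset_closure frontier_subset_closure

end Components

/-! ### Changes of sign -/

section Sign

variable {s : Bool × Bool} {p : SL(2, ℝ) × SL(2, ℝ)}

/-- The involution of pairs that multiplies the two matrices by the signs `sgn s.1`, `sgn s.2`. -/
def signHomeo (s : Bool × Bool) : (SL(2, ℝ) × SL(2, ℝ)) ≃ₜ (SL(2, ℝ) × SL(2, ℝ)) :=
  (Homeomorph.mulLeft (bif s.1 then -1 else 1)).prodCongr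
    (Homeomorph.mulLeft (bif s.2 then -1 else 1))

variable (s p)

lemma signHomeo_fst : (signHomeo s p).1 = p.1 ∨ (signHomeo s p).1 = -p.1 := by
  rcases s with ⟨_ | _, _⟩ <;> simp [signHomeo]

lemma signHomeo_snd : (signHomeo s p).2 = p.2 ∨ (signHomeo s p).2 = -p.2 := by
  rcases s with ⟨_, _ | _⟩ <;> simp [signHomeo]

lemma trA_signHomeo : trA (signHomeo s p) = sgn s.1 * trA p := by
  rcases s with ⟨_ | _, _⟩ <;> simp [signHomeo, trA, sgn]

lemma trB_signHomeo : trB (signHomeo s p) = sgn s.2 * trB p := by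
  rcases s with ⟨_, _ | _⟩ <;> simp [signHomeo, trB, sgn]

lemma trAB_signHomeo : trAB (signHomeo s p) = sgn s.1 * sgn s.2 * trAB p := by
  rcases s with ⟨_ | _, _ | _⟩ <;> simp [signHomeo, trAB, sgn]

lemma trComm_signHomeo : trComm (signHomeo s p) = trComm p := by
  rw [trComm, trA_signHomeo, trB_signHomeo, trAB_signHomeo, trComm]
  rcases s with ⟨_ | _, _ | _⟩ <;> simp [sgn]

lemma signHomeo_signHomeo : signHomeo s (signHomeo s p) = p := by
  rcases s with ⟨_ | _, _ | _⟩ <;> simp [signHomeo, Prod.map]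

lemma letter_signHomeo (i : Fin 2) :
    letter (signHomeo s p) i = letter p i ∨ letter (signHomeo s p) i = -letter p i := by
  fin_cases i
  · exact signHomeo_fst s p
  · exact signHomeo_snd s p

lemma prod_letter_signHomeo (w : List (Fin 2)) :
    (w.map (letter (signHomeo s p))).prod = (w.map (letter p)).prod ∨
      (w.map (letter (signHomeo s p))).prod = -(w.map (letter p)).prod := by
  induction w with
  | nil => exact Or.inl rfl
  | cons a w ih =>
    rcases ih with h | h <;> rcases letter_signHomeo s p a with h' | h' <;> simp [h, h']

variable {s p}

lemma signHomeo_mem_hypLocus : signHomeo s p ∈ hypLocus ↔ p ∈ hypLocus := by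
  have h (q) (hq : q ∈ hypLocus) : signHomeo s q ∈ hypLocus :=
    mem_hypLocus_of_eq_or_eq_neg hq (signHomeo_fst s q) (signHomeo_snd s q)
  exact ⟨fun hs => signHomeo_signHomeo s p ▸ h _ hs, h p⟩

lemma isMulticone_of_signHomeo {M : Set P1} (h : IsMulticone (signHomeo s p) M) :
    IsMulticone p M where
  nonempty := h.nonempty
  isOpen := h.isOpen
  closure_ne_univ := h.closure_ne_univ
  closure_image_subset i := by
    have hact : (fun x : P1 => letter p i • x) = fun x => letter (signHomeo s p) i • x := by
      funext x
      rcases letter_signHomeo s p i with hi | hi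
      · rw [hi]
      · rw [hi, neg_smul_eq_smul]
    rw [hact]
    exact h.closure_image_subset i
  finite_components := h.finite_components
  disjoint_closures := h.disjoint_closures

section Neg

variable {A B A' B' : SL(2, ℝ)} {d : P1}

lemma Hyperbolic.neg (h : Hyperbolic A) : Hyperbolic (-A) := by
  rwa [Hyperbolic, Matrix.SpecialLinearGroup.coe_neg, Matrix.trace_neg, abs_neg]

lemma Parabolic.neg (h : Parabolic A) : Parabolic (-A) := by
  rwa [Parabolic, Matrix.SpecialLinearGroup.coe_neg, Matrix.trace_neg, abs_neg]

lemma IsUnstableDir.neg (h : IsUnstableDir A d) : IsUnstableDir (-A) d := by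
  rcases h with ⟨hA, c, hc, hd⟩ | ⟨hA, h1, h2, hd⟩
  · refine Or.inl ⟨hA.neg, -c, by rwa [abs_neg], fun v hv => ?_⟩
    rw [Matrix.SpecialLinearGroup.coe_neg, Matrix.neg_mulVec, hd v hv, neg_smul]
  · exact Or.inr ⟨hA.neg, mt neg_eq_iff_eq_neg.1 h2, mt neg_inj.1 h1,
      (neg_smul_eq_smul A d).trans hd⟩

lemma IsStableDir.neg (h : IsStableDir A d) : IsStableDir (-A) d := by
  rcases h with ⟨hA, c, hc, hd⟩ | ⟨hA, h1, h2, hd⟩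
  · refine Or.inl ⟨hA.neg, -c, by rwa [abs_neg], fun v hv => ?_⟩
    rw [Matrix.SpecialLinearGroup.coe_neg, Matrix.neg_mulVec, hd v hv, neg_smul]
  · exact Or.inr ⟨hA.neg, mt neg_eq_iff_eq_neg.1 h2, mt neg_inj.1 h1,
      (neg_smul_eq_smul A d).trans hd⟩

lemma UnstableEqStable.of_eq_or_eq_neg (h : UnstableEqStable A B) (hA : A' = A ∨ A' = -A)
    (hB : B' = B ∨ B' = -B) : UnstableEqStable A' B' := by
  obtain ⟨d, hu, hs⟩ := h
  refine ⟨d, ?_, ?_⟩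
  · rcases hA with rfl | rfl
    exacts [hu, hu.neg]
  · rcases hB with rfl | rfl
    exacts [hs, hs.neg]

end Neg

lemma unstableEqStable_of_signHomeo
    (h : UnstableEqStable (signHomeo s p).1 (signHomeo s p).2 ∨
      UnstableEqStable (signHomeo s p).2 (signHomeo s p).1) :
    UnstableEqStable p.1 p.2 ∨ UnstableEqStable p.2 p.1 := by
  have h1 := signHomeo_fst s (signHomeo s p)
  have h2 := signHomeo_snd s (signHomeo s p)
  rw [signHomeo_signHomeo] at h1 h2
  exact h.imp (fun h => h.of_eq_or_eq_neg h1 h2) (fun h => h.of_eq_or_eq_neg h2 h1)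

lemma HasParabolicProduct.of_signHomeo (h : HasParabolicProduct (signHomeo s p)) :
    HasParabolicProduct p := by
  obtain ⟨w, hw, h⟩ := h
  refine ⟨w, hw, ?_⟩
  rcases prod_letter_signHomeo s p w with hsign | hsign
  · exact hsign ▸ h
  · exact neg_neg (w.map (letter p)).prod ▸ (hsign ▸ h).neg

lemma HasParabolicProduct.of_reduction {F : List Bool} (h : HasParabolicProduct (reduction F p)) :
    HasParabolicProduct p := by
  obtain ⟨w, hw, h⟩ := h
  obtain ⟨w', hw', e⟩ := exists_prod_map_eq_prod_map (exists_letter_reduction_eq F p) hw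
  exact ⟨w', hw', e ▸ h⟩

lemma hasParabolicProduct_of_trA (h : |trA p| = 2) : HasParabolicProduct p :=
  ⟨[0], by simp, by simpa [Parabolic, letter, trA] using h⟩

lemma hasParabolicProduct_of_trB (h : |trB p| = 2) : HasParabolicProduct p :=
  ⟨[1], by simp, by simpa [Parabolic, letter, trB] using h⟩

lemma hasParabolicProduct_of_trAB (h : |trAB p| = 2) : HasParabolicProduct p :=
  ⟨[0, 1], by simp, by simpa [Parabolic, letter, trAB] using h⟩

end Sign

/-! ### The components of the hyperbolicity locus -/

section Pieces

variable {p : SL(2, ℝ) × SL(2, ℝ)}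

/-- Indices of the components of the hyperbolicity locus on which both traces are positive: `none`
for the principal one, `some (F, e)` for the pairs that the word `F` reduces to Schottky pairs of
orientation `e`. -/
abbrev BaseIndex : Type := Option (List Bool × Bool)

/-- The components of the hyperbolicity locus on which both traces are positive. -/
def basePiece : BaseIndex → Set (SL(2, ℝ) × SL(2, ℝ))
  | none => principalSet
  | some (F, e) => reduction F ⁻¹' schottkyOriented e

/-- The components of the hyperbolicity locus: those with positive traces, up to signs. -/
def piece (i : (Bool × Bool) × BaseIndex) : Set (SL(2, ℝ) × SL(2, ℝ)) :=
  signHomeo i.1 ⁻¹' basePiece i.2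

/-- The closed set obtained from `principalSet` by making its inequalities weak. -/
def principalClosed : Set (SL(2, ℝ) × SL(2, ℝ)) :=
  {p | 2 ≤ trA p ∧ 2 ≤ trB p ∧ (trComm p ≤ 2 ∨ trA p * trB p ≤ 2 * trAB p)}

/-- The closed set obtained from `schottkyOriented e` by making its inequalities weak. -/
def schottkyOrientedClosed (e : Bool) : Set (SL(2, ℝ) × SL(2, ℝ)) :=
  {p | p ∈ schottkyClosed ∧ 0 ≤ sgn e * orient p}

/-- Pairwise disjoint closed sets containing the sets `basePiece j`. -/
def baseClosed : BaseIndex → Set (SL(2, ℝ) × SL(2, ℝ))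
  | none => principalClosed
  | some (F, e) => reduction F ⁻¹' schottkyOrientedClosed e

lemma isOpen_principalSet : IsOpen principalSet :=
  (isOpen_lt continuous_const continuous_trA).inter
    ((isOpen_lt continuous_const continuous_trB).inter
      ((isOpen_lt continuous_trComm continuous_const).union
        (isOpen_lt (continuous_trA.mul continuous_trB) (continuous_const.mul continuous_trAB))))

lemma isOpen_schottkySet : IsOpen schottkySet :=
  (isOpen_lt continuous_const continuous_trA).inter
    ((isOpen_lt continuous_const continuous_trB).inter (isOpen_lt continuous_trAB continuous_const))

lemma isOpen_schottkyOriented (e : Bool) : IsOpen (schottkyOriented e) :=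
  isOpen_schottkySet.inter (isOpen_lt continuous_const (continuous_const.mul continuous_orient))

lemma isClosed_principalClosed : IsClosed principalClosed :=
  (isClosed_le continuous_const continuous_trA).inter
    ((isClosed_le continuous_const continuous_trB).inter
      ((isClosed_le continuous_trComm continuous_const).union
        (isClosed_le (continuous_trA.mul continuous_trB) (continuous_const.mul continuous_trAB))))

lemma isClosed_schottkyClosed : IsClosed schottkyClosed :=
  (isClosed_le continuous_const continuous_trA).inter
    ((isClosed_le continuous_const continuous_trB).inter
      (isClosed_le continuous_trAB continuous_const))

lemma isClosed_schottkyOrientedClosed (e : Bool) : IsClosed (schottkyOrientedClosed e) :=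
  isClosed_schottkyClosed.inter
    (isClosed_le continuous_const (continuous_const.mul continuous_orient))

lemma sgn_mul_orient_pos {e : Bool} (hp : p ∈ schottkyOrientedClosed e) :
    0 < sgn e * orient p :=
  hp.2.lt_of_ne' (mul_ne_zero (sgn_ne_zero e) (orient_ne_zero hp.1))

lemma closure_piece_subset (i : (Bool × Bool) × BaseIndex) :
    closure (piece i) ⊆ signHomeo i.1 ⁻¹' baseClosed i.2 := by
  obtain ⟨s, _ | ⟨F, e⟩⟩ := i
  · refine closure_minimal ?_ (isClosed_principalClosed.preimage (signHomeo s).continuous)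
    exact fun p hp => ⟨hp.1.le, hp.2.1.le, hp.2.2.imp le_of_lt le_of_lt⟩
  · refine closure_minimal ?_ (((isClosed_schottkyOrientedClosed e).preimage
      (reduction F).continuous).preimage (signHomeo s).continuous)
    exact fun p hp => ⟨schottkySet_subset_schottkyClosed hp.1, hp.2.le⟩

lemma two_le_of_mem_baseClosed {j : BaseIndex} (h : p ∈ baseClosed j) :
    2 ≤ trA p ∧ 2 ≤ trB p := by
  rcases j with _ | ⟨F, e⟩
  · exact ⟨h.1, h.2.1⟩
  · obtain ⟨hx, hy, -⟩ := (mem_opposedClosed_of_reduction h.1).1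
    exact ⟨hx, hy⟩

lemma notMem_opposedClosed_of_mem_principalClosed (h : p ∈ principalClosed) :
    p ∉ opposedClosed := by
  rintro ⟨hx, hy, hz, hk⟩
  rcases h.2.2 with hk' | hz'
  · linarith
  · have hzero : 2 * trAB p - trA p * trB p = 0 := by linarith
    have hcomm := four_mul_trComm_sub p
    rw [hzero] at hcomm
    have hprod : 0 ≤ (trA p ^ 2 - 4) * (trB p ^ 2 - 4) :=
      mul_nonneg (by nlinarith) (by nlinarith)
    linarith

lemma eq_of_mem_baseClosed {j k : BaseIndex} (hj : p ∈ baseClosed j) (hk : p ∈ baseClosed k) :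
    j = k := by
  rcases j with _ | ⟨F, e⟩ <;> rcases k with _ | ⟨G, e'⟩
  · rfl
  · exact absurd (mem_opposedClosed_of_reduction hk.1).1
      (notMem_opposedClosed_of_mem_principalClosed hj)
  · exact absurd (mem_opposedClosed_of_reduction hj.1).1
      (notMem_opposedClosed_of_mem_principalClosed hk)
  · obtain rfl := reduction_unique hj.1 hk.1
    rw [eq_of_sgn_mul_pos (sgn_mul_orient_pos hj) (sgn_mul_orient_pos hk)]

lemma disjoint_closure_piece :
    Pairwise fun i j => Disjoint (closure (piece i)) (closure (piece j)) := by
  intro i j hij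
  refine disjoint_left.2 fun p hi hj => hij ?_
  have hi := closure_piece_subset i hi
  have hj := closure_piece_subset j hj
  obtain ⟨hAi, hBi⟩ := two_le_of_mem_baseClosed hi
  obtain ⟨hAj, hBj⟩ := two_le_of_mem_baseClosed hj
  rw [trA_signHomeo] at hAi hAj
  rw [trB_signHomeo] at hBi hBj
  have hs : i.1 = j.1 := Prod.ext
    (eq_of_sgn_mul_pos (two_pos.trans_le hAi) (two_pos.trans_le hAj))
    (eq_of_sgn_mul_pos (two_pos.trans_le hBi) (two_pos.trans_le hBj))
  rw [hs] at hi
  exact Prod.ext hs (eq_of_mem_baseClosed hi hj)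

lemma isOpen_piece (i : (Bool × Bool) × BaseIndex) : IsOpen (piece i) := by
  refine IsOpen.preimage (signHomeo i.1).continuous ?_
  rcases i with ⟨s, _ | ⟨F, e⟩⟩
  · exact isOpen_principalSet
  · exact (isOpen_schottkyOriented e).preimage (reduction F).continuous

lemma isConnected_piece (i : (Bool × Bool) × BaseIndex) : IsConnected (piece i) := by
  refine (signHomeo i.1).isConnected_preimage.2 ?_
  rcases i with ⟨s, _ | ⟨F, e⟩⟩
  · exact isConnected_principalSet
  · exact (reduction F).isConnected_preimage.2 (isConnected_schottkyOriented e)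

lemma not_unstableEqStable_of_mem_hypLocus (hp : p ∈ hypLocus) (a b : Fin 2) :
    ¬ UnstableEqStable (letter p a) (letter p b) := by
  have hyp (i : Fin 2) : ¬ Parabolic (letter p i) := fun h =>
    (show Hyperbolic (letter p i) by
      simpa using hyperbolic_of_mem_hypLocus hp (List.cons_ne_nil i [])).ne' h
  rintro ⟨d, hu, hs⟩
  obtain ⟨-, c, hc, hu⟩ := hu.resolve_right fun h => hyp a h.1
  obtain ⟨-, c', hc', hs⟩ := hs.resolve_right fun h => hyp b h.1
  exact notMem_hypLocus_of_mulVec_eq_smul d.rep_nonzero hc.le hc'.le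
    (hu _ (rep_mem_submodule d)) (hs _ (rep_mem_submodule d)) hp

lemma two_le_trComm_and_lt_of_notMem_principalSet (hp : p ∉ principalSet) (hx : 2 < trA p)
    (hy : 2 < trB p) : 2 ≤ trComm p ∧ 2 * trAB p < trA p * trB p := by
  have hn : ¬ (trComm p < 2 ∨ trA p * trB p < 2 * trAB p) := fun h => hp ⟨hx, hy, h⟩
  push Not at hn
  obtain ⟨hk, hz⟩ := hn
  refine ⟨hk, hz.lt_of_ne fun h => ?_⟩
  have hcomm := four_mul_trComm_sub p
  rw [h, sub_self] at hcomm
  have hprod : 0 < (trA p ^ 2 - 4) * (trB p ^ 2 - 4) := mul_pos (by nlinarith) (by nlinarith)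
  linarith

lemma exists_mem_basePiece (hp : p ∈ hypLocus) (hx : 2 < trA p) (hy : 2 < trB p) :
    ∃ j, p ∈ basePiece j := by
  by_cases hpr : p ∈ principalSet
  · exact ⟨none, hpr⟩
  obtain ⟨hk, hz⟩ := two_le_trComm_and_lt_of_notMem_principalSet hpr hx hy
  have hk' : 2 < trComm p := hk.lt_of_ne' fun h =>
    (unstableEqStable_of_trComm_eq_two hx hy hz h).elim
      (not_unstableEqStable_of_mem_hypLocus hp 0 1) (not_unstableEqStable_of_mem_hypLocus hp 1 0)
  obtain ⟨F, hF⟩ := exists_reduction_mem_schottkySet (p := p) ⟨hx, hy, hz, hk'⟩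
    fun w hw => hyperbolic_of_mem_hypLocus hp hw
  obtain ⟨e, he⟩ := exists_sgn_mul_pos (orient_ne_zero (schottkySet_subset_schottkyClosed hF))
  exact ⟨some (F, e), hF, he⟩

lemma exists_lt_sgn_mul {r t : ℝ} (h : r < |t|) : ∃ b, r < sgn b * t := by
  rcases lt_abs.1 h with h | h
  · exact ⟨false, by simpa [sgn] using h⟩
  · exact ⟨true, by simpa [sgn] using h⟩

lemma sgn_mul_le_abs (b : Bool) (t : ℝ) : sgn b * t ≤ |t| := by
  cases b <;> simp [sgn, le_abs_self, neg_le_abs]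

theorem hypLocus_eq_iUnion_piece : hypLocus = ⋃ i, piece i := by
  ext p
  rw [mem_iUnion]
  constructor
  · intro hp
    have hA : 2 < |trA p| := by
      simpa [Hyperbolic, letter, trA] using hyperbolic_of_mem_hypLocus hp (w := [0]) (by simp)
    have hB : 2 < |trB p| := by
      simpa [Hyperbolic, letter, trB] using hyperbolic_of_mem_hypLocus hp (w := [1]) (by simp)
    obtain ⟨a, ha⟩ := exists_lt_sgn_mul hA
    obtain ⟨b, hb⟩ := exists_lt_sgn_mul hB
    obtain ⟨j, hj⟩ := exists_mem_basePiece (signHomeo_mem_hypLocus (s := (a, b)).2 hp)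
      (by rwa [trA_signHomeo]) (by rwa [trB_signHomeo])
    exact ⟨((a, b), j), hj⟩
  · rintro ⟨⟨s, j⟩, hp⟩
    rw [← signHomeo_mem_hypLocus (s := s)]
    rcases j with _ | ⟨F, e⟩
    · exact principalSet_subset_hypLocus hp
    · exact (hasFreeGrowth_of_reduction_mem_schottkySet hp.1).hasGrowth.mem_hypLocus

lemma length_le_of_mem_piece {s : Bool × Bool} {F : List Bool} {e : Bool}
    (h : p ∈ piece (s, some (F, e))) : 4 * (F.length : ℝ) ≤ |trA p| + |trB p| := by
  have hlen := (mem_opposedClosed_of_reduction (schottkySet_subset_schottkyClosed h.1)).2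
  rw [trA_signHomeo, trB_signHomeo] at hlen
  exact hlen.trans (add_le_add (sgn_mul_le_abs _ _) (sgn_mul_le_abs _ _))

theorem locallyFinite_piece : LocallyFinite piece := by
  intro p
  obtain ⟨N, hN⟩ := exists_nat_gt (|trA p| + |trB p|)
  refine ⟨{q | |trA q| + |trB q| < N},
    (isOpen_lt (continuous_trA.abs.add continuous_trB.abs) continuous_const).mem_nhds hN, ?_⟩
  have hfin : ((univ : Set (Bool × Bool)) ×ˢ
      insert none (some '' ({F : List Bool | F.length ≤ N} ×ˢ (univ : Set Bool)))).Finite :=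
    finite_univ.prod ((((List.finite_length_le Bool N).prod finite_univ).image _).insert _)
  refine hfin.subset ?_
  rintro ⟨s, _ | ⟨F, e⟩⟩ ⟨q, hq, hqN⟩
  · exact ⟨mem_univ _, mem_insert _ _⟩
  · have hlen : (F.length : ℝ) ≤ N := by
      have hqN : |trA q| + |trB q| < N := hqN
      linarith [length_le_of_mem_piece hq, (Nat.cast_nonneg F.length : (0 : ℝ) ≤ F.length)]
    exact ⟨mem_univ _, mem_insert_of_mem _ ⟨(F, e), ⟨Nat.cast_le.1 hlen, mem_univ _⟩, rfl⟩⟩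

theorem componentsOf_hypLocus : componentsOf hypLocus = range piece := by
  rw [hypLocus_eq_iUnion_piece]
  exact componentsOf_iUnion isOpen_piece isConnected_piece fun i j hij =>
    (disjoint_closure_piece hij).mono subset_closure subset_closure

lemma isPrincipalComponent_piece (s : Bool × Bool) : IsPrincipalComponent (piece (s, none)) := by
  refine ⟨componentsOf_hypLocus ▸ mem_range_self _, fun p hp => ?_⟩
  obtain ⟨g, hg⟩ := exists_positivePair_conjPair hp
  exact ⟨openQuadrant g, isMulticone_of_signHomeo (isMulticone_openQuadrant hg),
    isOpenInterval_openQuadrant g⟩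

end Pieces

/-! ### Boundary points -/

section Boundary

variable {p : SL(2, ℝ) × SL(2, ℝ)}

lemma frontier_hypLocus_eq_iUnion_piece : frontier hypLocus = ⋃ i, frontier (piece i) := by
  rw [hypLocus_eq_iUnion_piece]
  exact frontier_iUnion_of_disjoint_closure isOpen_piece locallyFinite_piece disjoint_closure_piece

lemma hasParabolicProduct_or_of_mem_principalClosed (hp : p ∈ principalClosed)
    (hn : p ∉ principalSet) :
    HasParabolicProduct p ∨ (UnstableEqStable p.1 p.2 ∨ UnstableEqStable p.2 p.1) := by
  obtain ⟨hx, hy, hz⟩ := hp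
  rcases hx.eq_or_lt with hx' | hx'
  · exact Or.inl (hasParabolicProduct_of_trA (by rw [← hx']; norm_num))
  rcases hy.eq_or_lt with hy' | hy'
  · exact Or.inl (hasParabolicProduct_of_trB (by rw [← hy']; norm_num))
  obtain ⟨hk, hlt⟩ := two_le_trComm_and_lt_of_notMem_principalSet hn hx' hy'
  have hk2 : trComm p = 2 := le_antisymm (hz.resolve_right hlt.not_ge) hk
  exact Or.inr (unstableEqStable_of_trComm_eq_two hx' hy' hlt hk2)

lemma hasParabolicProduct_of_mem_schottkyClosed (hp : p ∈ schottkyClosed)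
    (hn : p ∉ schottkySet) : HasParabolicProduct p := by
  obtain ⟨hx, hy, hz⟩ := hp
  rcases hx.eq_or_lt with hx' | hx'
  · exact hasParabolicProduct_of_trA (by rw [← hx']; norm_num)
  rcases hy.eq_or_lt with hy' | hy'
  · exact hasParabolicProduct_of_trB (by rw [← hy']; norm_num)
  rcases hz.eq_or_lt with hz' | hz'
  · exact hasParabolicProduct_of_trAB (by rw [hz']; norm_num)
  exact absurd ⟨hx', hy', hz'⟩ hn

theorem hasParabolicProduct_or_of_mem_frontier (hp : p ∈ frontier hypLocus) :
    HasParabolicProduct p ∨ (UnstableEqStable p.1 p.2 ∨ UnstableEqStable p.2 p.1) := by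
  rw [frontier_hypLocus_eq_iUnion_piece, mem_iUnion] at hp
  obtain ⟨⟨s, j⟩, hi⟩ := hp
  rw [(isOpen_piece _).frontier_eq] at hi
  have hc := closure_piece_subset _ hi.1
  rcases j with _ | ⟨F, e⟩
  · exact (hasParabolicProduct_or_of_mem_principalClosed hc hi.2).imp (fun h => h.of_signHomeo)
      unstableEqStable_of_signHomeo
  · exact Or.inl (hasParabolicProduct_of_mem_schottkyClosed hc.1
      fun h => hi.2 ⟨h, sgn_mul_orient_pos hc⟩).of_reduction.of_signHomeo

theorem exists_isPrincipalComponent_of_mem_frontier (hp : p ∈ frontier hypLocus)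
    (h : UnstableEqStable p.1 p.2 ∨ UnstableEqStable p.2 p.1) :
    ∃ C, IsPrincipalComponent C ∧ p ∈ frontier C := by
  have hk : trComm p = 2 := h.elim trComm_eq_two_of_unstableEqStable
    fun h => (trComm_swap p).symm.trans (trComm_eq_two_of_unstableEqStable h)
  rw [frontier_hypLocus_eq_iUnion_piece, mem_iUnion] at hp
  obtain ⟨⟨s, _ | ⟨F, e⟩⟩, hi⟩ := hp
  · exact ⟨_, isPrincipalComponent_piece s, hi⟩
  · have hc := closure_piece_subset _ (frontier_subset_closure hi)
    have hlt := (mem_opposedClosed_of_reduction hc.1).1.2.2.2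
    rw [trComm_signHomeo, hk] at hlt
    norm_num at hlt

theorem finite_setOf_component_inter_nonempty {K : Set (SL(2, ℝ) × SL(2, ℝ))} (hK : IsCompact K) :
    {C ∈ componentsOf hypLocus | (C ∩ K).Nonempty}.Finite := by
  refine ((locallyFinite_piece.finite_nonempty_inter_compact hK).image piece).subset ?_
  rintro C ⟨hC, hCK⟩
  rw [componentsOf_hypLocus] at hC
  obtain ⟨i, rfl⟩ := hC
  exact ⟨i, hCK, rfl⟩

theorem frontier_hypLocus : frontier hypLocus = ⋃ C ∈ componentsOf hypLocus, frontier C := by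
  rw [componentsOf_hypLocus, biUnion_range, frontier_hypLocus_eq_iUnion_piece]

theorem pairwiseDisjoint_frontier_componentsOf_hypLocus :
    (componentsOf hypLocus).PairwiseDisjoint frontier := by
  rw [componentsOf_hypLocus]
  exact pairwiseDisjoint_frontier_range disjoint_closure_piece

end Boundary

end FullTwoShift

theorem theorem3p2 :
    -- a compact set meets only finitely many components
    (∀ K : Set (SL(2, ℝ) × SL(2, ℝ)), IsCompact K →
      {C ∈ FullTwoShift.componentsOf FullTwoShift.hypLocus | (C ∩ K).Nonempty}.Finite) ∧
    -- the boundary is the disjoint union of the boundaries of the components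
    (frontier FullTwoShift.hypLocus =
      ⋃ C ∈ FullTwoShift.componentsOf FullTwoShift.hypLocus, frontier C) ∧
    (FullTwoShift.componentsOf FullTwoShift.hypLocus).PairwiseDisjoint frontier ∧
    -- the two possibilities at a boundary point
    (∀ A B : SL(2, ℝ), (A, B) ∈ frontier FullTwoShift.hypLocus →
      FullTwoShift.HasParabolicProduct (A, B) ∨
        (FullTwoShift.UnstableEqStable A B ∨ FullTwoShift.UnstableEqStable B A)) ∧
    -- the second one occurs only on the boundary of a principal component
    (∀ A B : SL(2, ℝ), (A, B) ∈ frontier FullTwoShift.hypLocus →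
      (FullTwoShift.UnstableEqStable A B ∨ FullTwoShift.UnstableEqStable B A) →
        ∃ C, FullTwoShift.IsPrincipalComponent C ∧ (A, B) ∈ frontier C) := by
  exact ⟨fun _ hK => FullTwoShift.finite_setOf_component_inter_nonempty hK,
    FullTwoShift.frontier_hypLocus,
    FullTwoShift.pairwiseDisjoint_frontier_componentsOf_hypLocus,
    fun _ _ h => FullTwoShift.hasParabolicProduct_or_of_mem_frontier h,
    fun _ _ h h' => FullTwoShift.exists_isPrincipalComponent_of_mem_frontier h h'⟩
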